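/- **Theorem.** Let $n:\mathbb N\to\mathbb N$ satisfy $n(\lambda)=\omega(\log\lambda)$. There is no quantum fully black-box reduction $(C,S)$ from QCCC key agreements (quantum computation, classical communication) to $(\lambda,n)$-pseudorandom state generators (PRSGs) in which $C$ makes only classical queries to the PRSG. This holds even if the local computation of $C$ and $S$ is unbounded and non-uniform and only their queries are restricted to be polynomial. Here the terms have the following meaning. * *Generators.* An implementation $I$ of a $(\lambda,n)$-PRSG assigns to each $\lambda$ and each key $k\in\{0,1\}^\lambda$ a pure $n(\lambda)$-qubit state $|I_k\rangle$; it need not be efficient. An algorithm $D$ that receives $t(\lambda)$ copies of an $n(\lambda)$-qubit state, $t$ being polynomially bounded, *breaks* $I$ if $$\Bigl|\Pr_{k\leftarrow\{0,1\}^\lambda}\bigl[D(|I_k\rangle^{\otimes t(\lambda)})=1\bigr]-\Pr_{|\varphi\rangle\leftarrow\mathcal H_{n(\lambda)}}\bigl[D(|\varphi\rangle^{\otimes t(\lambda)})=1\bigr]\Bigr|$$ is not negligible in $\lambda$, where $\mathcal H_m$ is the Haar distribution on $m$-qubit pure states. * *Construction.* $C$ is a pair of parties $(A,B)$. For each security parameter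 $\lambda$ they start in a product state and run a protocol of polynomially many rounds in which they apply local quantum operations, exchange classical messages $\tau$ (the transcript) and make polynomially many classical queries to $I$: a party that asks a classical key $k$, of polynomial length, receives a copy of $|I_k\rangle$. At the end they output bits $k_A$ and $k_B$. The protocol obtained with generator $I$ is denoted $C^I$. It is a *key agreement* if $\Pr[k_A=k_B]\ge 1-\varepsilon(\lambda)$ for all $\lambda$, for some negligible $\varepsilon$. * *Eavesdroppers.* An eavesdropper $E$ is an arbitrary (unbounded) quantum algorithm, given by a family of unitaries indexed by $\lambda$, that takes the transcript $\tau$ and outputs a bit $k_E$. It *breaks* $C^I$ if there is no negligible $\delta$ with $\Pr[k_E=k_B]\le\frac12+\delta(\lambda)$ for all $\lambda$. * *Security reduction.* $S$ is a quantum oracle algorithm that receives polynomially many copies of a state and makes polynomially many quantum queries to $I$, through the isometries $|k\rangle\mapsto|k\rangle|I_k\rangle$ on keys of polynomial length, and to the unitaries of $E$ and their inverses, on polynomially bounded security parameters. * *Reduction.* $(C,S)$ is a quantum fully black-box reduction if, for every implementation $I$, $C^I$ is a key agreement, and, for every implementation $I$ and every eavesdropper $E$, if $E$ breaks $C^I$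 then $S^{E,I}$ breaks $I$. -/

import Mathlib

open Matrix MeasureTheory Filter
open scoped Kronecker

noncomputable section

namespace QCCC

/-! ### Asymptotics -/

/-- Negligible functions of the security parameter: `f` is eventually smaller than every inverse
polynomial. -/
def Negligible (f : ℕ → ℝ) : Prop :=
  Asymptotics.SuperpolynomialDecay atTop (fun l : ℕ => (l : ℝ)) f

/-- `f` is bounded by a polynomial in the security parameter. -/
def PolyBounded (f : ℕ → ℕ) : Prop :=
  ∃ p : Polynomial ℕ, ∀ l, f l ≤ p.eval l

/-- `n l = ω(log l)`. -/
def SuperLog (n : ℕ → ℕ) : Prop :=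
  (fun l : ℕ => Real.log (l : ℝ)) =o[atTop] (fun l : ℕ => (n l : ℝ))

/-! ### Finite-dimensional quantum operations -/

abbrev BitString (m : ℕ) : Type := Fin m → Bool

/-- Pure states of `m` qubits: unit vectors of `(ℂ²)^{⊗ m}`, in the computational basis. -/
abbrev PureState (m : ℕ) : Type :=
  Metric.sphere (0 : EuclideanSpace ℂ (BitString m)) 1

/-- The Haar distribution on `m`-qubit pure states: the normalized (unitarily invariant) surface
measure of the unit sphere. -/
def haarState (m : ℕ) : Measure (PureState m) :=
  ((volume : Measure (EuclideanSpace ℂ (BitString m))).toSphere Set.univ)⁻¹ •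
    (volume : Measure (EuclideanSpace ℂ (BitString m))).toSphere

/-- A quantum instrument with classical outcomes in `Ω`, from the quantum system with basis `X` to
the one with basis `Y`, in Kraus form.  On outcome `o` the (subnormalized) post-measurement state
of `ρ` is `∑ i, K o i * ρ * (K o i)ᴴ`; the sum over all outcomes is trace preserving. -/
structure Instrument (Ω X Y : Type) [Fintype Ω] [Fintype X] [DecidableEq X] [Fintype Y] where
  size : ℕ
  K : Ω → Fin size → Matrix Y X ℂ
  complete : ∑ o, ∑ i, (K o i)ᴴ * K o i = 1

/-- Subnormalized state after observing outcome `o`. -/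
def Instrument.apply {Ω X Y : Type} [Fintype Ω] [Fintype X] [DecidableEq X] [Fintype Y]
    (E : Instrument Ω X Y) (o : Ω) (ρ : Matrix X X ℂ) : Matrix Y Y ℂ :=
  ∑ i, E.K o i * ρ * (E.K o i)ᴴ

/-- The density matrix `|v⟩⟨v|`. -/
def ketbra {X : Type} (v : X → ℂ) : Matrix X X ℂ := vecMulVec v (star v)

/-! ### Pseudorandom state generators as oracles -/

/-- The (not necessarily efficient) implementations of a state generator with `l`-bit keys and
`n l`-qubit outputs: on key `k` of length `l` the generator outputs a pure `n l`-qubit state. -/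
abbrev Generator (n : ℕ → ℕ) : Type := ∀ l : ℕ, BitString l → PureState (n l)

/-- Keys of length at most `L`. -/
abbrev Key (L : ℕ) : Type := Σ i : Fin (L + 1), BitString i

instance (L : ℕ) : DecidableEq (Key L) := instDecidableEqSigma

/-- Basis of the register that holds a key together with the generator's answer to it. -/
abbrev Answer (n : ℕ → ℕ) (L : ℕ) : Type := Σ x : Key L, BitString (n x.1)

instance (n : ℕ → ℕ) (L : ℕ) : DecidableEq (Answer n L) := instDecidableEqSigma

/-- A quantum query to the generator `I`: the isometry `|k⟩ ↦ |k⟩ |I k⟩`. -/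
def genIsometry {n : ℕ → ℕ} (I : Generator n) (L : ℕ) : Matrix (Answer n L) (Key L) ℂ :=
  fun s x => if s.1 = x then (I s.1.1 s.1.2 : EuclideanSpace ℂ (BitString (n s.1.1))) s.2 else 0

/-- The answer to a classical query `x`, handed to a party with memory basis `X`: the isometry
`|a⟩ ↦ |a⟩ |x⟩ |I x⟩`. -/
def answerIsometry {n : ℕ → ℕ} (I : Generator n) (L : ℕ) (X : Type) [DecidableEq X] (x : Key L) :
    Matrix (X × Answer n L) X ℂ :=
  fun s a => if s.1 = a then genIsometry I L s.2 x else 0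

/-! ### Two-party protocols with classical communication and classical queries -/

/-- One party of a protocol with `r` rounds, message alphabet `M`, and oracle access to a generator
on keys of length at most `L`.  In each round, depending on the messages `h` exchanged in the
previous rounds (both parties' messages), the party
measures its memory to obtain a classical key, receives the state that the generator outputs on this
key, and then measures to obtain its (classical) message of this round.  After the last
round it measures to obtain its output bit.  Messages and queries may be dummies, so that
protocols with alternating messages, or with several queries between messages, are covered. -/
structure Party (n : ℕ → ℕ) (L : ℕ) (M : Type) [Fintype M] (r : ℕ) where
  dim : ℕ
  start : Fin dim
  query : ∀ j : ℕ, (Fin j → M × M) → Instrument (Key L) (Fin dim) (Fin dim)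
  send : ∀ j : ℕ, (Fin j → M × M) → Instrument M (Fin dim × Answer n L) (Fin dim)
  out : (Fin r → M × M) → Instrument Bool (Fin dim) Unit

/-- Kraus operators of one round of a party, on the events that it asks the key `x` and sends the
message `m`. -/
def Party.roundKraus {n : ℕ → ℕ} {L : ℕ} {M : Type} [Fintype M] {r : ℕ} (P : Party n L M r)
    (I : Generator n) {j : ℕ} (h : Fin j → M × M) (m : M) (x : Key L)
    (a : Fin (P.query j h).size) (b : Fin (P.send j h).size) :
    Matrix (Fin P.dim) (Fin P.dim) ℂ :=
  (P.send j h).K m b * answerIsometry I L (Fin P.dim) x * (P.query j h).K x a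

/-- The subnormalized joint state of the two parties after `j` rounds with transcript `h`; its trace
is the probability of this transcript.  The parties start in a product state, and in
each round both act locally on their own memory. -/
def jointState {n : ℕ → ℕ} {L : ℕ} {M : Type} [Fintype M] {r : ℕ} (A B : Party n L M r)
    (I : Generator n) : ∀ j : ℕ, (Fin j → M × M) →
      Matrix (Fin A.dim × Fin B.dim) (Fin A.dim × Fin B.dim) ℂ
  | 0, _ => ketbra (Pi.single (A.start, B.start) 1)
  | j + 1, h =>
    ∑ x, ∑ a, ∑ b, ∑ x', ∑ a', ∑ b',
      (A.roundKraus I (Fin.init h) (h (Fin.last j)).1 x a b ⊗ₖ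
        B.roundKraus I (Fin.init h) (h (Fin.last j)).2 x' a' b') *
      jointState A B I j (Fin.init h) *
      (A.roundKraus I (Fin.init h) (h (Fin.last j)).1 x a b ⊗ₖ
        B.roundKraus I (Fin.init h) (h (Fin.last j)).2 x' a' b')ᴴ

/-- The probability that the execution yields transcript `τ` and output bits `kA`, `kB`. -/
def outcomeProb {n : ℕ → ℕ} {L : ℕ} {M : Type} [Fintype M] {r : ℕ} (A B : Party n L M r)
    (I : Generator n) (τ : Fin r → M × M) (kA kB : Bool) : ℝ :=
  (trace (∑ a, ∑ b,
    ((A.out τ).K kA a ⊗ₖ (B.out τ).K kB b) * jointState A B I r τ *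
      ((A.out τ).K kA a ⊗ₖ (B.out τ).K kB b)ᴴ)).re

/-- An oracle construction of a (bit) key agreement with classical communication from a generator,
with classical queries only: for each security parameter `l`, two parties that exchange, in each of
`rounds l` rounds, messages from an alphabet of size `alphabet l`. -/
structure Construction (n : ℕ → ℕ) where
  rounds : ℕ → ℕ
  keyLen : ℕ → ℕ
  alphabet : ℕ → ℕ
  alice : ∀ l, Party n (keyLen l) (Fin (alphabet l)) (rounds l)
  bob : ∀ l, Party n (keyLen l) (Fin (alphabet l)) (rounds l)

namespace Construction

variable {n : ℕ → ℕ}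

/-- Query efficiency: polynomially many rounds, hence queries (one per party and round), on keys of
polynomial length.  Local computation is not restricted. -/
def Efficient (C : Construction n) : Prop := PolyBounded C.rounds ∧ PolyBounded C.keyLen

/-- Transcripts at security parameter `l`. -/
abbrev Transcript (C : Construction n) (l : ℕ) : Type :=
  Fin (C.rounds l) → Fin (C.alphabet l) × Fin (C.alphabet l)

/-- `Pr[k_A = k_B]` in the key agreement built from the generator `I`. -/
def agreeProb (C : Construction n) (I : Generator n) (l : ℕ) : ℝ :=
  ∑ τ : C.Transcript l, ∑ k : Bool, outcomeProb (C.alice l) (C.bob l) I τ k k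

/-- The construction, run with the generator `I`, is a key agreement: negligible completeness
error. -/
def IsComplete (C : Construction n) (I : Generator n) : Prop :=
  ∃ ε : ℕ → ℝ, Negligible ε ∧ ∀ l, 1 - ε l ≤ C.agreeProb I l

/-- Registers of an eavesdropper: transcript, output bit and `w l + 1`-dimensional ancilla. -/
abbrev EveReg (C : Construction n) (w : ℕ → ℕ) (l : ℕ) : Type :=
  C.Transcript l × Bool × Fin (w l + 1)

/-- An eavesdropper: an arbitrary quantum algorithm, that is, a family of unitaries. -/
abbrev Eavesdropper (C : Construction n) (w : ℕ → ℕ) : Type :=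
  ∀ l, Matrix.unitaryGroup (C.EveReg w l) ℂ

/-- The probability that the eavesdropper outputs `k` on transcript `τ`: its unitary is applied to
`|τ⟩|0⟩|0⟩` and the output bit is measured. -/
def eveProb (C : Construction n) {w : ℕ → ℕ} (E : C.Eavesdropper w) (l : ℕ)
    (τ : C.Transcript l) (k : Bool) : ℝ :=
  ∑ σ : C.Transcript l, ∑ c : Fin (w l + 1),
    ‖(E l : Matrix (C.EveReg w l) (C.EveReg w l) ℂ) (σ, k, c) (τ, false, 0)‖ ^ 2

/-- `Pr[k_E = k_B]`. -/
def eveWinProb (C : Construction n) (I : Generator n) {w : ℕ → ℕ} (E : C.Eavesdropper w)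
    (l : ℕ) : ℝ :=
  ∑ τ : C.Transcript l, ∑ kA : Bool, ∑ kB : Bool,
    outcomeProb (C.alice l) (C.bob l) I τ kA kB * C.eveProb E l τ kB

/-- The eavesdropper breaks the key agreement built from `I`: its probability of finding Bob's key
is not bounded by `1/2` plus a negligible function. -/
def IsBrokenBy (C : Construction n) (I : Generator n) {w : ℕ → ℕ} (E : C.Eavesdropper w) : Prop :=
  ¬ ∃ δ : ℕ → ℝ, Negligible δ ∧ ∀ l, C.eveWinProb I E l ≤ 1 / 2 + δ l

end Construction

/-! ### Security reductions -/

/-- Basis of the eavesdropper's registers for all security parameters at most `N`. -/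
abbrev EveRegs {n : ℕ → ℕ} (C : Construction n) (w : ℕ → ℕ) (N : ℕ) : Type :=
  Σ l : Fin (N + 1), C.EveReg w l

instance {n : ℕ → ℕ} (C : Construction n) (w : ℕ → ℕ) (N : ℕ) : DecidableEq (EveRegs C w N) :=
  instDecidableEqSigma

/-- Basis of the query register of the security reduction.  A query goes to the generator (keys of
length at most `L`), to the eavesdropper, or to the inverse of the eavesdropper's unitary (for
security parameters at most `N`), possibly in superposition. -/
abbrev RedQuery {n : ℕ → ℕ} (C : Construction n) (w : ℕ → ℕ) (L N : ℕ) : Type :=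
  Key L ⊕ (EveRegs C w N ⊕ EveRegs C w N)

/-- Basis of the register that holds the answer to such a query. -/
abbrev RedAnswer {n : ℕ → ℕ} (C : Construction n) (w : ℕ → ℕ) (L N : ℕ) : Type :=
  Answer n L ⊕ (EveRegs C w N ⊕ EveRegs C w N)

/-- The joint oracle: generator, eavesdropper and inverse of the eavesdropper. -/
def redOracle {n : ℕ → ℕ} (C : Construction n) {w : ℕ → ℕ} (I : Generator n)
    (E : C.Eavesdropper w) (L N : ℕ) : Matrix (RedAnswer C w L N) (RedQuery C w L N) ℂ :=
  fromBlocks (genIsometry I L) 0 0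
    (fromBlocks
      (blockDiagonal' fun l : Fin (N + 1) => (E l : Matrix (C.EveReg w l) (C.EveReg w l) ℂ)) 0 0
      (blockDiagonal' fun l : Fin (N + 1) => (E l : Matrix (C.EveReg w l) (C.EveReg w l) ℂ)ᴴ))

/-- A distinguisher with quantum oracle access to the generator and to the eavesdropper (whose
ancilla sizes are `w`).  At security parameter `l` it takes `copies l` copies of an `n l`-qubit
state, makes `queries l` oracle queries with arbitrary quantum operations in between, and outputs
a bit. -/
structure Distinguisher {n : ℕ → ℕ} (C : Construction n) (w : ℕ → ℕ) where
  copies : ℕ → ℕ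
  queries : ℕ → ℕ
  keyLen : ℕ → ℕ
  eveLen : ℕ → ℕ
  work : ℕ → ℕ
  prepare : ∀ l, Instrument Unit (Fin (copies l) → BitString (n l))
    (Fin (work l) × RedQuery C w (keyLen l) (eveLen l))
  step : ∀ l : ℕ, ℕ → Instrument Unit
    (Fin (work l) × RedAnswer C w (keyLen l) (eveLen l))
    (Fin (work l) × RedQuery C w (keyLen l) (eveLen l))
  out : ∀ l, Instrument Bool (Fin (work l) × RedQuery C w (keyLen l) (eveLen l)) Unit

namespace Distinguisher

variable {n : ℕ → ℕ} {C : Construction n} {w : ℕ → ℕ}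

/-- Query efficiency: polynomially many copies and queries, the queries being on keys of polynomial
length and on polynomial security parameters.  Local computation is not restricted. -/
def Efficient (S : Distinguisher C w) : Prop :=
  PolyBounded S.copies ∧ PolyBounded S.queries ∧ PolyBounded S.keyLen ∧ PolyBounded S.eveLen

/-- The state after `j` queries, on input `φ^{⊗ copies}`. -/
def state (S : Distinguisher C w) (I : Generator n) (E : C.Eavesdropper w) (l : ℕ)
    (φ : PureState (n l)) : ℕ →
      Matrix (Fin (S.work l) × RedQuery C w (S.keyLen l) (S.eveLen l))
        (Fin (S.work l) × RedQuery C w (S.keyLen l) (S.eveLen l)) ℂ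
  | 0 => (S.prepare l).apply ()
      (ketbra fun y => ∏ i, (φ : EuclideanSpace ℂ (BitString (n l))) (y i))
  | j + 1 => (S.step l j).apply ()
      (((1 : Matrix (Fin (S.work l)) (Fin (S.work l)) ℂ) ⊗ₖ
          redOracle C I E (S.keyLen l) (S.eveLen l)) *
        S.state I E l φ j *
        ((1 : Matrix (Fin (S.work l)) (Fin (S.work l)) ℂ) ⊗ₖ
          redOracle C I E (S.keyLen l) (S.eveLen l))ᴴ)

/-- The probability of output `1` on input `φ^{⊗ copies}`. -/
def acceptProb (S : Distinguisher C w) (I : Generator n) (E : C.Eavesdropper w) (l : ℕ)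
    (φ : PureState (n l)) : ℝ :=
  (trace ((S.out l).apply true (S.state I E l φ (S.queries l)))).re

/-- The advantage in distinguishing copies of the generator's output on a uniform key from
copies of a Haar random state. -/
def advantage (S : Distinguisher C w) (I : Generator n) (E : C.Eavesdropper w) (l : ℕ) : ℝ :=
  |(∑ k : BitString l, S.acceptProb I E l (I l k)) / 2 ^ l -
    ∫ φ, S.acceptProb I E l φ ∂(haarState (n l))|

/-- The distinguisher breaks the pseudorandomness of `I`. -/
def Breaks (S : Distinguisher C w) (I : Generator n) (E : C.Eavesdropper w) : Prop :=
  ¬ Negligible (S.advantage I E)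

end Distinguisher

/-- `(C, S)` is a quantum fully black-box reduction from key agreements with classical communication
to state generators with output length `n`, where `C` makes only classical queries.  The security
reduction has access to the eavesdropper's ancilla, so its format depends on the ancilla sizes `w`. -/
structure IsFullyBlackBoxReduction {n : ℕ → ℕ} (C : Construction n)
    (S : ∀ w : ℕ → ℕ, Distinguisher C w) : Prop where
  efficient_construction : C.Efficient
  efficient_reduction : ∀ w, (S w).Efficient
  correctness : ∀ I : Generator n, C.IsComplete I
  security : ∀ (I : Generator n) (w : ℕ → ℕ) (E : C.Eavesdropper w),
    C.IsBrokenBy I E → (S w).Breaks I E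

end QCCC

end

/-!
Assign to every key an independent Haar random state.  The eavesdropper knows the states of
dimension polynomial in `l` and guesses the likelier value of Bob's key given these states and the
transcript.  For a fixed transcript and fixed keys, the contributions of Alice and of Bob to the
outcome probability are sums of squared moduli `|P|²`, `|Q|²` of polynomials that are homogeneous in
each of the remaining, high-dimensional states.  By Bombieri's inequality `[P]² [Q]² ≤ [P Q]²` for
the Fischer norm, such functions are almost positively correlated under the Haar measure, so every
joint outcome is at least nearly as likely as if the parties were independent given what the
eavesdropper knows.  Hence `Pr[k_E = k_B] + Pr[k_A ≠ k_B] ≥ 7 / 8`.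

The random generator nevertheless stays pseudorandom relative to this eavesdropper: once `2 ^ n l`
exceeds the polynomial threshold, reprogramming a key of length `l` does not change the guess, and
few quantum queries do not notice that a uniformly random key has been reprogrammed.  A second
moment bound and the Borel–Cantelli argument give one generator that is secure at all `l` at once.
-/

noncomputable section

namespace QCCC

section Wick

open scoped ComplexConjugate

lemma sum_neg_one_pow_mul_choose_mul_choose {p a : ℕ} (h : a ≤ p) (b : ℕ) :
    ∑ k ∈ Finset.range (p + 1), (-1 : ℤ) ^ k * p.choose k * (b + p - k).choose a =
      if a = p then 1 else 0 := by
  have hΔ : (fwdDiff 1)^[p] (fun x : ℕ => (x.choose a : ℤ)) b = if a = p then 1 else 0 := by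
    have ha : (fwdDiff 1)^[a] (fun x : ℕ => (x.choose a : ℤ)) = fun _ => 1 := by
      simpa only [add_zero, Nat.choose_zero_right, Nat.cast_one] using fwdDiff_iter_choose 0 a
    obtain ⟨d, rfl⟩ := Nat.exists_eq_add_of_le' h
    rw [Function.iterate_add_apply, ha]
    cases d with
    | zero => simp
    | succ d =>
      rw [Function.iterate_succ_apply, fwdDiff_const, fwdDiff_iter_eq_sum_shift, if_neg (by omega)]
      simp
  rw [← hΔ, fwdDiff_iter_eq_sum_shift, ← Finset.sum_range_reflect]
  refine Finset.sum_congr rfl fun k hk => ?_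
  have hkp : k ≤ p := Nat.lt_succ_iff.1 (Finset.mem_range.1 hk)
  simp only [Nat.add_sub_cancel, Nat.choose_symm hkp, smul_eq_mul, mul_one]
  rw [show b + p - (p - k) = b + k by omega]

lemma integrable_complex_pow_mul_exp (a : ℕ) :
    Integrable fun z : ℂ => ‖z‖ ^ a * Real.exp (-‖z‖ ^ 2) := by
  have h := Complex.integral_rpow_mul_exp_neg_rpow (p := 2) (q := a) (by norm_num)
    (by linarith [Nat.cast_nonneg (α := ℝ) a])
  simp only [Real.rpow_natCast, Real.rpow_ofNat] at h
  refine not_imp_comm.1 integral_undef ?_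
  rw [h]
  have : 0 < Real.Gamma ((a + 2) / 2) := Real.Gamma_pos_of_pos (by positivity)
  positivity

lemma integrable_gaussian_monomial (a b : ℕ) :
    Integrable fun z : ℂ => z ^ a * conj z ^ b * Real.exp (-‖z‖ ^ 2) := by
  refine (integrable_complex_pow_mul_exp (a + b)).mono' (by fun_prop) (.of_forall fun z => ?_)
  simp only [norm_mul, norm_pow, RCLike.norm_conj, Complex.norm_real, Real.norm_eq_abs,
    Real.abs_exp, pow_add, le_refl]

lemma integral_gaussian_normSq_pow (a : ℕ) :
    ∫ z : ℂ, z ^ a * conj z ^ a * Real.exp (-‖z‖ ^ 2) = Real.pi * a.factorial := by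
  have h := Complex.integral_rpow_mul_exp_neg_rpow (p := 2) (q := (2 * a : ℕ)) (by norm_num)
    (by linarith [Nat.cast_nonneg (α := ℝ) (2 * a)])
  have hΓ : ((2 * a : ℕ) + 2 : ℝ) / 2 = a + 1 := by push_cast; ring
  simp only [Real.rpow_natCast, Real.rpow_ofNat] at h
  rw [hΓ, Real.Gamma_nat_eq_factorial] at h
  convert integral_ofReal.trans (congrArg (fun r : ℝ => (r : ℂ)) h) using 1
  · refine integral_congr_ae (.of_forall fun z => ?_)
    dsimp only
    rw [← mul_pow, Complex.mul_conj', ← pow_mul]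
    exact ((Complex.ofReal_mul _ _).trans (by rw [Complex.ofReal_pow])).symm
  · push_cast; ring

lemma integral_gaussian_monomial_of_ne {a b : ℕ} (h : a ≠ b) :
    ∫ z : ℂ, z ^ a * conj z ^ b * Real.exp (-‖z‖ ^ 2) = 0 := by
  set f : ℂ → ℂ := fun z => z ^ a * conj z ^ b * Real.exp (-‖z‖ ^ 2)
  -- A rotation by the angle `π / (a - b)` changes the sign of the integrand.
  let w : Circle := Circle.exp (Real.pi / (a - b))
  have hw : (w : ℂ) ^ a * conj (w : ℂ) ^ b = -1 := by
    rw [← Circle.coe_inv_eq_conj]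
    simp only [w, ← Circle.exp_neg, Circle.coe_exp, ← Complex.exp_nat_mul, ← Complex.exp_add]
    rw [← Complex.exp_pi_mul_I]
    congr 1
    have : (a : ℂ) - b ≠ 0 := sub_ne_zero.2 (by exact_mod_cast h)
    push_cast
    field_simp
    ring
  have hf : ∀ z, f (rotation w z) = -f z := fun z => by
    simp only [f, rotation_apply, map_mul, norm_mul, Circle.norm_coe, one_mul, mul_pow]
    linear_combination (z ^ a * conj z ^ b * Real.exp (-‖z‖ ^ 2)) * hw
  have hint := (rotation w).measurePreserving.integral_comp
    (rotation w).toHomeomorph.measurableEmbedding f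
  simp only [hf, integral_neg] at hint
  exact self_eq_neg.1 hint.symm

lemma integral_gaussian_monomial (a b : ℕ) :
    ∫ z : ℂ, z ^ a * conj z ^ b * Real.exp (-‖z‖ ^ 2) =
      if a = b then (Real.pi : ℂ) * a.factorial else 0 := by
  split_ifs with h
  · rw [← h, integral_gaussian_normSq_pow]
  · exact integral_gaussian_monomial_of_ne h

/-- The Wick power `:zᵖ z̄ᵠ:`, also known as a complex Hermite polynomial. It is obtained from
`zᵖ z̄ᵠ` by subtracting all contractions of a factor `z` with a factor `z̄`, which makes it
orthogonal to monomials of lower degree under the standard complex Gaussian distribution. -/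
def wickPow (p q : ℕ) (z : ℂ) : ℂ :=
  ∑ k ∈ Finset.range (p + 1), ((-1) ^ k * p.choose k * q.choose k * k.factorial : ℤ) *
    (z ^ (p - k) * conj z ^ (q - k))

lemma mul_conj_wickPow (a b p q : ℕ) (z : ℂ) :
    z ^ a * conj z ^ b * conj (wickPow p q z) * Real.exp (-‖z‖ ^ 2) =
      ∑ k ∈ Finset.range (p + 1), ((-1) ^ k * p.choose k * q.choose k * k.factorial : ℤ) *
        (z ^ (a + (q - k)) * conj z ^ (b + (p - k)) * Real.exp (-‖z‖ ^ 2)) := by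
  simp only [wickPow, map_sum, map_mul, map_pow, map_intCast, Complex.conj_conj, Finset.mul_sum,
    Finset.sum_mul]
  exact Finset.sum_congr rfl fun k _ => by ring

lemma wickPow_mul_conj_wickPow (a b p q : ℕ) (z : ℂ) :
    wickPow a b z * conj (wickPow p q z) * Real.exp (-‖z‖ ^ 2) =
      ∑ k ∈ Finset.range (a + 1), ((-1) ^ k * a.choose k * b.choose k * k.factorial : ℤ) *
        (z ^ (a - k) * conj z ^ (b - k) * conj (wickPow p q z) * Real.exp (-‖z‖ ^ 2)) := by
  rw [wickPow, Finset.sum_mul, Finset.sum_mul]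
  exact Finset.sum_congr rfl fun k _ => by ring

lemma integrable_monomial_mul_conj_wickPow (a b p q : ℕ) :
    Integrable fun z : ℂ => z ^ a * conj z ^ b * conj (wickPow p q z) * Real.exp (-‖z‖ ^ 2) := by
  simp only [mul_conj_wickPow]
  exact integrable_finsetSum _ fun k _ => (integrable_gaussian_monomial _ _).const_mul _

lemma integrable_wickPow_mul_conj_wickPow (a b p q : ℕ) :
    Integrable fun z : ℂ => wickPow a b z * conj (wickPow p q z) * Real.exp (-‖z‖ ^ 2) := by
  simp only [wickPow_mul_conj_wickPow]
  exact integrable_finsetSum _ fun k _ => (integrable_monomial_mul_conj_wickPow _ _ _ _).const_mul _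

lemma integral_monomial_mul_conj_wickPow {a b p q : ℕ} (h : a ≤ p ∨ b < q) :
    ∫ z : ℂ, z ^ a * conj z ^ b * conj (wickPow p q z) * Real.exp (-‖z‖ ^ 2) =
      if a = p ∧ b = q then (Real.pi : ℂ) * (p.factorial * q.factorial) else 0 := by
  simp only [mul_conj_wickPow]
  rw [integral_finsetSum _ fun k _ => (integrable_gaussian_monomial _ _).const_mul _]
  simp only [integral_const_mul, integral_gaussian_monomial]
  by_cases hc : a + q = b + p
  · have hap : a ≤ p := by omega
    have hterm : ∀ k ∈ Finset.range (p + 1),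
        ((-1) ^ k * p.choose k * q.choose k * k.factorial : ℤ) *
          (if a + (q - k) = b + (p - k) then (Real.pi : ℂ) * (a + (q - k)).factorial else 0) =
        (Real.pi : ℂ) * (a.factorial * q.factorial) *
          ((-1) ^ k * p.choose k * (b + p - k).choose a : ℤ) := fun k hk => by
      have hkp : k ≤ p := Nat.lt_succ_iff.1 (Finset.mem_range.1 hk)
      rcases le_or_gt k q with hkq | hkq
      · have hfac : q.choose k * k.factorial * (a + (q - k)).factorial =
            a.factorial * q.factorial * (b + p - k).choose a := by
          rw [show b + p - k = a + (q - k) by omega, ← Nat.choose_mul_factorial_mul_factorial hkq,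
            ← Nat.add_choose_mul_factorial_mul_factorial a (q - k), Nat.choose_symm_add]
          ring
        have hfac' := congrArg (Nat.cast (R := ℂ)) hfac
        push_cast at hfac'
        rw [if_pos (by omega)]
        push_cast
        linear_combination ((-1) ^ k * p.choose k * Real.pi : ℂ) * hfac'
      · rw [Nat.choose_eq_zero_of_lt hkq, Nat.choose_eq_zero_of_lt (show b + p - k < a by omega)]
        simp
    rw [Finset.sum_congr rfl hterm, ← Finset.mul_sum, ← Int.cast_sum,
      sum_neg_one_pow_mul_choose_mul_choose hap]
    by_cases ha : a = p
    · simp [ha, show b = q by omega]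
    · simp [ha]
  · rw [if_neg (by omega)]
    refine Finset.sum_eq_zero fun k hk => ?_
    have hkp : k ≤ p := Nat.lt_succ_iff.1 (Finset.mem_range.1 hk)
    rcases le_or_gt k q with hkq | hkq
    · rw [if_neg (by omega), mul_zero]
    · simp [Nat.choose_eq_zero_of_lt hkq]

lemma integral_wickPow_mul_conj_wickPow {a b p q : ℕ} (h : a ≤ p ∨ b < q) :
    ∫ z : ℂ, wickPow a b z * conj (wickPow p q z) * Real.exp (-‖z‖ ^ 2) =
      if a = p ∧ b = q then (Real.pi : ℂ) * (p.factorial * q.factorial) else 0 := by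
  simp only [wickPow_mul_conj_wickPow]
  rw [integral_finsetSum _ fun k _ => (integrable_monomial_mul_conj_wickPow _ _ _ _).const_mul _,
    Finset.sum_eq_single_of_mem 0 (by simp)]
  · rw [integral_const_mul, Nat.sub_zero, Nat.sub_zero, integral_monomial_mul_conj_wickPow h]
    simp
  · intro k hk hk0
    have hka : k ≤ a := Nat.lt_succ_iff.1 (Finset.mem_range.1 hk)
    rw [integral_const_mul, integral_monomial_mul_conj_wickPow (by omega), if_neg (by omega),
      mul_zero]

end Wick

section Bombieri

open scoped ComplexConjugate

lemma integral_sum_mul_conj_sum_of_biorthogonal {Ω ι : Type*} [MeasurableSpace Ω]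
    [DecidableEq ι] {μ : Measure Ω} {s : Finset ι} {f g : ι → Ω → ℂ} {w : Ω → ℝ} {m : ι → ℝ}
    (c : ι → ℂ) (hint : ∀ i ∈ s, ∀ j ∈ s, Integrable (fun x => f i x * conj (g j x) * w x) μ)
    (h : ∀ i ∈ s, ∀ j ∈ s, ∫ x, f i x * conj (g j x) * w x ∂μ = if i = j then (m i : ℂ) else 0) :
    Integrable (fun x => (∑ i ∈ s, c i * f i x) * conj (∑ j ∈ s, c j * g j x) * w x) μ ∧
    ∫ x, (∑ i ∈ s, c i * f i x) * conj (∑ j ∈ s, c j * g j x) * w x ∂μ =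
      ((∑ i ∈ s, m i * ‖c i‖ ^ 2 : ℝ) : ℂ) := by
  have hexp : ∀ x, (∑ i ∈ s, c i * f i x) * conj (∑ j ∈ s, c j * g j x) * w x =
      ∑ i ∈ s, ∑ j ∈ s, c i * conj (c j) * (f i x * conj (g j x) * w x) := fun x => by
    rw [map_sum, Finset.sum_mul_sum, Finset.sum_mul]
    refine Finset.sum_congr rfl fun i _ => ?_
    rw [Finset.sum_mul]
    exact Finset.sum_congr rfl fun j _ => by rw [map_mul]; ring
  have hint' : ∀ i ∈ s, ∀ j ∈ s,
      Integrable (fun x => c i * conj (c j) * (f i x * conj (g j x) * w x)) μ :=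
    fun i hi j hj => (hint i hi j hj).const_mul _
  have hint'' := fun i hi => integrable_finsetSum s (hint' i hi)
  simp only [hexp]
  refine ⟨integrable_finsetSum s hint'', ?_⟩
  rw [integral_finsetSum _ hint'']
  push_cast
  refine Finset.sum_congr rfl fun i hi => ?_
  rw [integral_finsetSum _ (hint' i hi), Finset.sum_eq_single_of_mem i hi]
  · rw [integral_const_mul, h i hi i hi, if_pos rfl, Complex.mul_conj', mul_comm]
  · intro j hj hji
    rw [integral_const_mul, h i hi j hj, if_neg hji.symm, mul_zero]

/-- `F - W` is orthogonal to `W`, so `‖F - W‖² ≥ 0` says that `‖W‖² ≤ ‖F‖²`. -/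
lemma le_integral_normSq_of_integral_mul_conj_eq {Ω : Type*} [MeasurableSpace Ω] {μ : Measure Ω}
    {F W : Ω → ℂ} {w : Ω → ℝ} {N : ℝ} (hw : ∀ x, 0 ≤ w x)
    (hF : Integrable (fun x => ‖F x‖ ^ 2 * w x) μ)
    (hFW : Integrable (fun x => F x * conj (W x) * w x) μ)
    (hW : Integrable (fun x => W x * conj (W x) * w x) μ)
    (h : ∫ x, F x * conj (W x) * w x ∂μ = N) (h' : ∫ x, W x * conj (W x) * w x ∂μ = N) :
    N ≤ ∫ x, ‖F x‖ ^ 2 * w x ∂μ := by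
  have hre : ∀ {f : Ω → ℂ}, Integrable f μ → ∫ x, f x ∂μ = (N : ℂ) → ∫ x, (f x).re ∂μ = N :=
    fun hf hfN => (integral_re hf).trans (by rw [hfN]; rfl)
  calc N = ∫ x, 2 * (F x * conj (W x) * w x).re - (W x * conj (W x) * w x).re ∂μ := by
        refine .symm <| (integral_sub (hFW.re.const_mul 2) hW.re).trans ?_
        rw [integral_const_mul]
        exact (congrArg₂ (2 * · - ·) (hre hFW h) (hre hW h')).trans (by ring)
    _ ≤ ∫ x, ‖F x‖ ^ 2 * w x ∂μ := by
        refine integral_mono ((hFW.re.const_mul 2).sub hW.re) hF fun x => ?_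
        have hsq := mul_nonneg (hw x) (sq_nonneg ‖F x - W x‖)
        rw [Complex.sq_norm, Complex.normSq_sub] at hsq
        simp only [Complex.re_mul_ofReal, Complex.mul_conj, Complex.ofReal_re, Complex.sq_norm]
        linarith

variable {X : Type*} [Fintype X]

lemma prod_mul_exp_neg_sum_sq (f : X → ℂ → ℂ) (z : X → ℂ) :
    (∏ i, f i (z i)) * Real.exp (-∑ i, ‖z i‖ ^ 2) =
      ∏ i, (f i (z i) * Real.exp (-‖z i‖ ^ 2)) := by
  rw [← Finset.sum_neg_distrib, Real.exp_sum, Complex.ofReal_prod, Finset.prod_mul_distrib]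

lemma integrable_prod_mul_exp_neg_sum_sq {f : X → ℂ → ℂ}
    (hf : ∀ i, Integrable fun z : ℂ => f i z * Real.exp (-‖z‖ ^ 2)) :
    Integrable fun z : X → ℂ => (∏ i, f i (z i)) * Real.exp (-∑ i, ‖z i‖ ^ 2) := by
  simp only [prod_mul_exp_neg_sum_sq]
  exact Integrable.fintype_prod hf

lemma integral_prod_mul_exp_neg_sum_sq (f : X → ℂ → ℂ) :
    ∫ z : X → ℂ, (∏ i, f i (z i)) * Real.exp (-∑ i, ‖z i‖ ^ 2) =
      ∏ i, ∫ z : ℂ, f i z * Real.exp (-‖z‖ ^ 2) := by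
  simp only [prod_mul_exp_neg_sum_sq]
  exact integral_fintype_prod_volume_eq_prod fun i (z : ℂ) => f i z * Real.exp (-‖z‖ ^ 2)

lemma integrable_prod_pow_mul_conj_prod_pow (α β : X → ℕ) :
    Integrable fun z : X → ℂ =>
      (∏ i, z i ^ α i) * conj (∏ i, z i ^ β i) * Real.exp (-∑ i, ‖z i‖ ^ 2) := by
  simp only [map_prod, map_pow, ← Finset.prod_mul_distrib]
  exact integrable_prod_mul_exp_neg_sum_sq (f := fun i z => z ^ α i * conj z ^ β i)
    fun i => integrable_gaussian_monomial (α i) (β i)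

lemma integral_prod_pow_mul_conj_prod_pow (α β : X → ℕ) :
    ∫ z : X → ℂ, (∏ i, z i ^ α i) * conj (∏ i, z i ^ β i) * Real.exp (-∑ i, ‖z i‖ ^ 2) =
      if α = β then ((Real.pi ^ Fintype.card X * ∏ i, ((α i).factorial : ℝ) : ℝ) : ℂ) else 0 := by
  simp only [map_prod, map_pow, ← Finset.prod_mul_distrib]
  rw [integral_prod_mul_exp_neg_sum_sq fun i z => z ^ α i * conj z ^ β i]
  simp only [integral_gaussian_monomial, Finset.prod_ite_zero, funext_iff, Finset.mem_univ,
    true_imp_iff, Finset.prod_mul_distrib, Finset.prod_const, Finset.card_univ]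
  push_cast
  rfl

lemma exists_lt_of_sum_eq {α β : X → ℕ} (h : ∑ i, α i = ∑ i, β i) (hne : α ≠ β) :
    ∃ i, α i < β i := by
  by_contra! hle
  exact hne (funext fun i =>
    ((Finset.sum_eq_sum_iff_of_le fun i _ => hle i).1 h.symm i (Finset.mem_univ i)).symm)

lemma integrable_prod_mul_conj_prod_wickPow {f : ℕ → ℕ → ℂ → ℂ}
    (hf : ∀ a b p q, Integrable fun z => f a b z * conj (wickPow p q z) * Real.exp (-‖z‖ ^ 2))
    (α β α' β' : X → ℕ) :
    Integrable fun z : X → ℂ => (∏ i, f (α i) (β i) (z i)) *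
      conj (∏ i, wickPow (α' i) (β' i) (z i)) * Real.exp (-∑ i, ‖z i‖ ^ 2) := by
  simp only [map_prod, ← Finset.prod_mul_distrib]
  exact integrable_prod_mul_exp_neg_sum_sq
    (f := fun i z => f (α i) (β i) z * conj (wickPow (α' i) (β' i) z)) fun i => hf _ _ _ _

lemma integral_prod_mul_conj_prod_wickPow {f : ℕ → ℕ → ℂ → ℂ}
    (hf : ∀ {a b p q}, a ≤ p ∨ b < q →
      ∫ z, f a b z * conj (wickPow p q z) * Real.exp (-‖z‖ ^ 2) =
        if a = p ∧ b = q then (Real.pi : ℂ) * (p.factorial * q.factorial) else 0)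
    {α β α' β' : X → ℕ} (hα : ∑ i, α i = ∑ i, α' i) (hβ : ∑ i, β i = ∑ i, β' i) :
    ∫ z : X → ℂ, (∏ i, f (α i) (β i) (z i)) * conj (∏ i, wickPow (α' i) (β' i) (z i)) *
        Real.exp (-∑ i, ‖z i‖ ^ 2) =
      if α = α' ∧ β = β' then
        (Real.pi : ℂ) ^ Fintype.card X * ∏ i, ((α' i).factorial * (β' i).factorial : ℂ)
      else 0 := by
  simp only [map_prod, ← Finset.prod_mul_distrib]
  rw [integral_prod_mul_exp_neg_sum_sq
    fun i z => f (α i) (β i) z * conj (wickPow (α' i) (β' i) z)]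
  split_ifs with h
  · obtain ⟨rfl, rfl⟩ := h
    simp only [hf (.inl le_rfl), and_self, if_true, Finset.prod_mul_distrib, Finset.prod_const,
      Finset.card_univ]
  · obtain ⟨i, hi⟩ : ∃ i, α i < α' i ∨ β i < β' i := by
      by_cases hαα' : α = α'
      · exact (exists_lt_of_sum_eq hβ fun hββ' => h ⟨hαα', hββ'⟩).imp fun _ => .inr
      · exact (exists_lt_of_sum_eq hα hαα').imp fun _ => .inl
    refine Finset.prod_eq_zero (Finset.mem_univ i) ?_
    rw [hf (hi.imp_left le_of_lt), if_neg (by omega)]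

/-- The square of the Fischer (or Bombieri) norm of a polynomial, in which the monomials `zᵅ` are
orthogonal with squared norms `α!`. -/
def fischerNormSq (P : MvPolynomial X ℂ) : ℝ :=
  ∑ α ∈ P.support, (∏ i, ((α i).factorial : ℝ)) * ‖P.coeff α‖ ^ 2

lemma integrable_and_integral_gaussian_normSq (P : MvPolynomial X ℂ) :
    Integrable (fun z : X → ℂ =>
      ‖MvPolynomial.eval z P‖ ^ 2 * Real.exp (-∑ i, ‖z i‖ ^ 2)) ∧
    ∫ z : X → ℂ, ‖MvPolynomial.eval z P‖ ^ 2 * Real.exp (-∑ i, ‖z i‖ ^ 2) =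
      Real.pi ^ Fintype.card X * fischerNormSq P := by
  classical
  obtain ⟨hint, h⟩ := integral_sum_mul_conj_sum_of_biorthogonal (Ω := X → ℂ)
    (μ := volume) (s := P.support) (f := fun α z => ∏ i, z i ^ α i) (g := fun α z => ∏ i, z i ^ α i)
    (w := fun z => Real.exp (-∑ i, ‖z i‖ ^ 2))
    (m := fun α => Real.pi ^ Fintype.card X * ∏ i, ((α i).factorial : ℝ)) P.coeff
    (fun α _ β _ => integrable_prod_pow_mul_conj_prod_pow α β)
    (fun α _ β _ => (integral_prod_pow_mul_conj_prod_pow α β).trans <|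
      if_congr DFunLike.coe_fn_eq rfl rfl)
  have hnorm : ∀ z : X → ℂ, (∑ α ∈ P.support, P.coeff α * ∏ i, z i ^ α i) *
      conj (∑ α ∈ P.support, P.coeff α * ∏ i, z i ^ α i) * Real.exp (-∑ i, ‖z i‖ ^ 2) =
        ((‖MvPolynomial.eval z P‖ ^ 2 * Real.exp (-∑ i, ‖z i‖ ^ 2) : ℝ) : ℂ) := fun z => by
    rw [← MvPolynomial.eval_eq', Complex.mul_conj', ← Complex.ofReal_pow, ← Complex.ofReal_mul]
  simp only [hnorm] at hint h
  refine ⟨hint.re, Complex.ofReal_injective ?_⟩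
  rw [← integral_complex_ofReal, h, fischerNormSq, Finset.mul_sum]
  simp only [mul_assoc]

lemma sum_eq_of_isHomogeneous {a : ℕ} {P : MvPolynomial X ℂ} (hP : P.IsHomogeneous a)
    {α : X →₀ ℕ} (hα : α ∈ P.support) : ∑ i, α i = a := by
  rw [← Finsupp.degree_eq_sum, Finsupp.degree_eq_weight_one]
  exact hP (MvPolynomial.mem_support_iff.1 hα)

/-- The function obtained from the sesquilinear product `P · Q̄` by replacing each power `zᵃ z̄ᵇ` of
a single variable with `f a b z`. -/
def sesquiEval (f : ℕ → ℕ → ℂ → ℂ) (P Q : MvPolynomial X ℂ) (z : X → ℂ) : ℂ :=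
  ∑ γ ∈ P.support ×ˢ Q.support,
    P.coeff γ.1 * conj (Q.coeff γ.2) * ∏ i, f (γ.1 i) (γ.2 i) (z i)

lemma sesquiEval_monomial (P Q : MvPolynomial X ℂ) (z : X → ℂ) :
    sesquiEval (fun a b z => z ^ a * conj z ^ b) P Q z =
      MvPolynomial.eval z P * conj (MvPolynomial.eval z Q) := by
  simp only [sesquiEval, MvPolynomial.eval_eq', map_sum, map_mul, map_prod, map_pow,
    Finset.sum_mul_sum, Finset.sum_product, Finset.prod_mul_distrib]
  exact Finset.sum_congr rfl fun α _ => Finset.sum_congr rfl fun β _ => by ring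

lemma integrable_and_integral_sesquiEval_mul_conj_sesquiEval_wickPow {f : ℕ → ℕ → ℂ → ℂ}
    (hint : ∀ a b p q, Integrable fun z => f a b z * conj (wickPow p q z) * Real.exp (-‖z‖ ^ 2))
    (hf : ∀ {a b p q}, a ≤ p ∨ b < q →
      ∫ z, f a b z * conj (wickPow p q z) * Real.exp (-‖z‖ ^ 2) =
        if a = p ∧ b = q then (Real.pi : ℂ) * (p.factorial * q.factorial) else 0)
    {a b : ℕ} {P Q : MvPolynomial X ℂ} (hP : P.IsHomogeneous a) (hQ : Q.IsHomogeneous b) :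
    Integrable (fun z => sesquiEval f P Q z * conj (sesquiEval wickPow P Q z) *
      Real.exp (-∑ i, ‖z i‖ ^ 2)) ∧
    ∫ z, sesquiEval f P Q z * conj (sesquiEval wickPow P Q z) * Real.exp (-∑ i, ‖z i‖ ^ 2) =
      ((Real.pi ^ Fintype.card X * (fischerNormSq P * fischerNormSq Q) : ℝ) : ℂ) := by
  classical
  let m : (X →₀ ℕ) × (X →₀ ℕ) → ℝ := fun γ =>
    Real.pi ^ Fintype.card X * ∏ i, ((γ.1 i).factorial * (γ.2 i).factorial : ℝ)
  have hnorm : ∑ γ ∈ P.support ×ˢ Q.support, m γ * ‖P.coeff γ.1 * conj (Q.coeff γ.2)‖ ^ 2 =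
      Real.pi ^ Fintype.card X * (fischerNormSq P * fischerNormSq Q) := by
    rw [fischerNormSq, fischerNormSq, Finset.sum_mul_sum, Finset.mul_sum, Finset.sum_product]
    refine Finset.sum_congr rfl fun α _ => ?_
    rw [Finset.mul_sum]
    refine Finset.sum_congr rfl fun β _ => ?_
    simp only [m, norm_mul, RCLike.norm_conj, Finset.prod_mul_distrib]
    ring
  rw [← hnorm]
  refine integral_sum_mul_conj_sum_of_biorthogonal (Ω := X → ℂ) (μ := volume)
    (s := P.support ×ˢ Q.support) (f := fun γ z => ∏ i, f (γ.1 i) (γ.2 i) (z i))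
    (g := fun γ z => ∏ i, wickPow (γ.1 i) (γ.2 i) (z i))
    (w := fun z => Real.exp (-∑ i, ‖z i‖ ^ 2)) (m := m)
    (fun γ => P.coeff γ.1 * conj (Q.coeff γ.2))
    (fun γ _ γ' _ => integrable_prod_mul_conj_prod_wickPow hint γ.1 γ.2 γ'.1 γ'.2)
    (fun γ hγ γ' hγ' => ?_)
  rw [Finset.mem_product] at hγ hγ'
  refine (integral_prod_mul_conj_prod_wickPow hf
    ((sum_eq_of_isHomogeneous hP hγ.1).trans (sum_eq_of_isHomogeneous hP hγ'.1).symm)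
    ((sum_eq_of_isHomogeneous hQ hγ.2).trans (sum_eq_of_isHomogeneous hQ hγ'.2).symm)).trans ?_
  simp only [DFunLike.coe_fn_eq, ← Prod.ext_iff]
  split_ifs with h
  · subst h
    simp only [m]
    push_cast
    rfl
  · rfl

/-- Bombieri's inequality. Under the Gaussian measure the Wick product of `P` and `Q̄` is an
orthogonal projection of `P Q̄`, and `|P Q̄| = |P Q|`. -/
lemma fischerNormSq_mul_le {a b : ℕ} {P Q : MvPolynomial X ℂ} (hP : P.IsHomogeneous a)
    (hQ : Q.IsHomogeneous b) : fischerNormSq P * fischerNormSq Q ≤ fischerNormSq (P * Q) := by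
  obtain ⟨hFW, hFW'⟩ := integrable_and_integral_sesquiEval_mul_conj_sesquiEval_wickPow
    integrable_monomial_mul_conj_wickPow integral_monomial_mul_conj_wickPow hP hQ
  obtain ⟨hW, hW'⟩ := integrable_and_integral_sesquiEval_mul_conj_sesquiEval_wickPow
    integrable_wickPow_mul_conj_wickPow integral_wickPow_mul_conj_wickPow hP hQ
  obtain ⟨hPQ, hPQ'⟩ := integrable_and_integral_gaussian_normSq (P * Q)
  have hnorm : ∀ z, ‖sesquiEval (fun a b z => z ^ a * conj z ^ b) P Q z‖ =
      ‖MvPolynomial.eval z (P * Q)‖ := fun z => by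
    rw [sesquiEval_monomial, map_mul, norm_mul, norm_mul, RCLike.norm_conj]
  have hle := le_integral_normSq_of_integral_mul_conj_eq (Ω := X → ℂ)
    (w := fun z => Real.exp (-∑ i, ‖z i‖ ^ 2)) (fun z => (Real.exp_pos _).le)
    (by simpa only [hnorm] using hPQ) hFW hW hFW' hW'
  simp only [hnorm, hPQ'] at hle
  exact le_of_mul_le_mul_left hle (by positivity)

end Bombieri

section Sphere

lemma eval_smul_of_isHomogeneous {σ R : Type*} [CommSemiring R] {a : ℕ} {P : MvPolynomial σ R}
    (hP : P.IsHomogeneous a) (r : R) (z : σ → R) :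
    MvPolynomial.eval (r • z) P = r ^ a * MvPolynomial.eval z P := by
  rw [MvPolynomial.eval_eq, MvPolynomial.eval_eq, Finset.mul_sum]
  refine Finset.sum_congr rfl fun α hα => ?_
  have hdeg : ∑ i ∈ α.support, α i = a := by
    simpa [Finsupp.weight_apply, Finsupp.sum] using hP (MvPolynomial.mem_support_iff.1 hα)
  simp only [Pi.smul_apply, smul_eq_mul, mul_pow, Finset.prod_mul_distrib]
  rw [Finset.prod_pow_eq_pow_sum, hdeg]
  ring

variable {X : Type*} [Fintype X]

lemma norm_eval_eq_norm_pow_mul_norm_eval_sphere {a : ℕ} {P : MvPolynomial X ℂ}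
    (hP : P.IsHomogeneous a) (z : ({0}ᶜ : Set (EuclideanSpace ℂ X))) :
    ‖MvPolynomial.eval (z : EuclideanSpace ℂ X) P‖ = ‖(z : EuclideanSpace ℂ X)‖ ^ a *
      ‖MvPolynomial.eval ((homeomorphUnitSphereProd _ z).1 : EuclideanSpace ℂ X) P‖ := by
  have hz : (z : EuclideanSpace ℂ X) = (‖(z : EuclideanSpace ℂ X)‖ : ℂ) •
      ((homeomorphUnitSphereProd _ z).1 : EuclideanSpace ℂ X) := by
    rw [homeomorphUnitSphereProd_apply_fst_coe, Complex.coe_smul, smul_smul,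
      mul_inv_cancel₀ (norm_ne_zero_iff.2 z.2), one_smul]
  conv_lhs => rw [hz]
  rw [WithLp.ofLp_smul, eval_smul_of_isHomogeneous hP, norm_mul, norm_pow, Complex.norm_real,
    norm_norm]

lemma integral_volumeIoiPow_gaussian {d : ℕ} (hd : 0 < d) (a : ℕ) :
    ∫ r : Set.Ioi (0 : ℝ), (r : ℝ) ^ (2 * a) * Real.exp (-(r : ℝ) ^ 2)
      ∂(Measure.volumeIoiPow (2 * d - 1)) = 1 / 2 * Real.Gamma (d + a) := by
  simp only [Measure.volumeIoiPow, ENNReal.ofReal]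
  rw [integral_withDensity_eq_integral_smul (measurable_subtype_coe.pow_const _).real_toNNReal,
    integral_subtype_comap measurableSet_Ioi fun r : ℝ => Real.toNNReal (r ^ (2 * d - 1)) •
      (r ^ (2 * a) * Real.exp (-r ^ 2))]
  have h := integral_rpow_mul_exp_neg_rpow (p := 2) (q := (2 * d - 1 + 2 * a : ℕ)) (by norm_num)
    (by linarith [Nat.cast_nonneg (α := ℝ) (2 * d - 1 + 2 * a)])
  have hexponent : (((2 * d - 1 + 2 * a : ℕ) : ℝ) + 1) / 2 = d + a := by
    rw [← Nat.cast_add_one, show 2 * d - 1 + 2 * a + 1 = 2 * d + 2 * a by omega]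
    push_cast
    ring
  rw [hexponent] at h
  rw [← h]
  refine setIntegral_congr_fun measurableSet_Ioi fun r hr => ?_
  simp only [NNReal.smul_def, Real.coe_toNNReal _ (pow_nonneg (Set.mem_Ioi.1 hr).le _),
    Real.rpow_natCast, Real.rpow_ofNat, smul_eq_mul, pow_add]
  ring

lemma integral_gaussian_polar [Nonempty X] {a : ℕ} {P : MvPolynomial X ℂ}
    (hP : P.IsHomogeneous a) :
    ∫ z : EuclideanSpace ℂ X, ‖MvPolynomial.eval z P‖ ^ 2 * Real.exp (-‖z‖ ^ 2) =
      (∫ φ : Metric.sphere (0 : EuclideanSpace ℂ X) 1,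
        ‖MvPolynomial.eval (φ : EuclideanSpace ℂ X) P‖ ^ 2
          ∂(volume : Measure (EuclideanSpace ℂ X)).toSphere) *
      (1 / 2 * Real.Gamma (Fintype.card X + a)) := by
  set μ := (volume : Measure (EuclideanSpace ℂ X))
  have hdim : Module.finrank ℝ (EuclideanSpace ℂ X) = 2 * Fintype.card X := by
    rw [finrank_real_of_complex, finrank_euclideanSpace]
  set f : EuclideanSpace ℂ X → ℝ := fun z => ‖MvPolynomial.eval z P‖ ^ 2 * Real.exp (-‖z‖ ^ 2)
  calc ∫ z, f z ∂μ = ∫ z : ({(0)}ᶜ : Set (EuclideanSpace ℂ X)), f z ∂(μ.comap (↑)) := by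
        rw [integral_subtype_comap (measurableSet_singleton _).compl f,
          restrict_compl_singleton]
    _ = ∫ x, ‖MvPolynomial.eval (x.1 : EuclideanSpace ℂ X) P‖ ^ 2 *
          ((x.2 : ℝ) ^ (2 * a) * Real.exp (-(x.2 : ℝ) ^ 2))
          ∂μ.toSphere.prod (.volumeIoiPow (Module.finrank ℝ (EuclideanSpace ℂ X) - 1)) := by
        rw [← μ.measurePreserving_homeomorphUnitSphereProd.integral_comp
          (Homeomorph.measurableEmbedding _)]
        refine integral_congr_ae (.of_forall fun z => ?_)
        simp only [f, norm_eval_eq_norm_pow_mul_norm_eval_sphere hP,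
          homeomorphUnitSphereProd_apply_snd_coe]
        ring
    _ = _ := by
        refine (integral_prod_mul
          (fun φ : Metric.sphere (0 : EuclideanSpace ℂ X) 1 =>
            ‖MvPolynomial.eval (φ : EuclideanSpace ℂ X) P‖ ^ 2)
          (fun r : Set.Ioi (0 : ℝ) => (r : ℝ) ^ (2 * a) * Real.exp (-(r : ℝ) ^ 2))).trans ?_
        rw [hdim, integral_volumeIoiPow_gaussian Fintype.card_pos]

lemma exists_integral_gaussian_eq_mul_fischerNormSq (X : Type*) [Fintype X] :
    ∃ κ : ℝ, 0 < κ ∧ ∀ P : MvPolynomial X ℂ,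
      ∫ z : EuclideanSpace ℂ X, ‖MvPolynomial.eval z P‖ ^ 2 * Real.exp (-‖z‖ ^ 2) =
        κ * fischerNormSq P := by
  let e : EuclideanSpace ℂ X ≃L[ℝ] (X → ℂ) := PiLp.continuousLinearEquiv 2 ℝ fun _ => ℂ
  let μ := (volume : Measure (EuclideanSpace ℂ X)).map e
  have : μ.IsAddHaarMeasure := e.isAddHaarMeasure_map _
  have hμ := Measure.isAddLeftInvariant_eq_smul μ (volume : Measure (X → ℂ))
  set c := μ.addHaarScalarFactor (volume : Measure (X → ℂ))
  have hc : 0 < c := Measure.addHaarScalarFactor_pos_of_isAddHaarMeasure _ _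
  refine ⟨c * Real.pi ^ Fintype.card X, by positivity, fun P => ?_⟩
  rw [mul_assoc, ← (integrable_and_integral_gaussian_normSq P).2]
  have hmap : ∫ y, ‖MvPolynomial.eval y P‖ ^ 2 * Real.exp (-∑ i, ‖y i‖ ^ 2) ∂μ =
      ∫ z : EuclideanSpace ℂ X, ‖MvPolynomial.eval z P‖ ^ 2 * Real.exp (-‖z‖ ^ 2) := by
    refine (e.toHomeomorph.measurableEmbedding.integral_map _).trans ?_
    refine integral_congr_ae (.of_forall fun z => ?_)
    simp only [EuclideanSpace.norm_sq_eq]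
    rfl
  rw [← hmap, hμ, integral_smul_nnreal_measure]
  rfl

end Sphere

section Haar

instance isProbabilityMeasure_haarState (m : ℕ) : IsProbabilityMeasure (haarState m) where
  measure_univ := by
    rw [haarState, Measure.smul_apply, smul_eq_mul]
    refine ENNReal.inv_mul_cancel ?_ (measure_ne_top _ _)
    rw [Measure.measure_univ_ne_zero]
    exact Measure.toSphere_ne_zero _

lemma integral_haarState_of_isHomogeneous {m a : ℕ} {P : MvPolynomial (BitString m) ℂ}
    (hP : P.IsHomogeneous a) :
    (∫ φ : PureState m, ‖MvPolynomial.eval (φ : EuclideanSpace ℂ (BitString m)) P‖ ^ 2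
      ∂(haarState m)) * Real.Gamma ((2 : ℝ) ^ m + a) =
      Real.Gamma ((2 : ℝ) ^ m) * fischerNormSq P := by
  obtain ⟨κ, hκ, hgauss⟩ := exists_integral_gaussian_eq_mul_fischerNormSq (BitString m)
  have hcard : (Fintype.card (BitString m) : ℝ) = 2 ^ m := by simp
  have hpolar := integral_gaussian_polar hP
  have hvolume := integral_gaussian_polar (MvPolynomial.isHomogeneous_one (BitString m) ℂ)
  have hone : fischerNormSq (1 : MvPolynomial (BitString m) ℂ) = 1 := by
    simp [fischerNormSq, MvPolynomial.support_one]
  rw [hgauss, hcard] at hpolar hvolume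
  simp only [map_one, norm_one, one_pow, integral_const, smul_eq_mul, mul_one, CharP.cast_eq_zero,
    add_zero, hone] at hvolume
  rw [haarState, integral_smul_measure, smul_eq_mul, ENNReal.toReal_inv]
  change κ = (_ : Measure _).real Set.univ * _ at hvolume
  rw [Measure.real] at hvolume
  set s := ((volume : Measure (EuclideanSpace ℂ (BitString m))).toSphere Set.univ).toReal
  have hs : s ≠ 0 := fun h0 => hκ.ne' (by rw [hvolume, h0, zero_mul])
  field_simp
  linear_combination 2 * (-hpolar) + 2 * fischerNormSq P * hvolume

lemma gamma_ratio_ge {d : ℝ} (hd : 0 < d) (a b : ℕ) :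
    (d / (d + a)) ^ b * (Real.Gamma d * Real.Gamma (d + (a + b : ℕ))) ≤
      Real.Gamma (d + a) * Real.Gamma (d + b) := by
  induction b with
  | zero => simp [mul_comm]
  | succ b ih =>
    have hb : Real.Gamma (d + (b + 1 : ℕ)) = (d + b) * Real.Gamma (d + b) := by
      push_cast; rw [← add_assoc, Real.Gamma_add_one (by positivity)]
    have hab : Real.Gamma (d + (a + (b + 1) : ℕ)) =
        (d + (a + b : ℕ)) * Real.Gamma (d + (a + b : ℕ)) := by
      push_cast
      rw [← add_assoc, ← add_assoc, Real.Gamma_add_one (by positivity), add_assoc d]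
    have hratio : d / (d + a) * (d + (a + b : ℕ)) ≤ d + b := by
      rw [div_mul_eq_mul_div, div_le_iff₀ (by positivity)]
      push_cast
      nlinarith [mul_nonneg (Nat.cast_nonneg (α := ℝ) a) (Nat.cast_nonneg (α := ℝ) b)]
    rw [hb, hab, pow_succ]
    calc _ = ((d / (d + a)) ^ b * (Real.Gamma d * Real.Gamma (d + (a + b : ℕ)))) *
          (d / (d + a) * (d + (a + b : ℕ))) := by ring
      _ ≤ (Real.Gamma (d + a) * Real.Gamma (d + b)) * (d + b) := by
          have := Real.Gamma_pos_of_pos (show 0 < d + a by positivity)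
          have := Real.Gamma_pos_of_pos (show 0 < d + b by positivity)
          gcongr
      _ = _ := by ring

lemma integral_haarState_mul_ge {m a b : ℕ} {P Q : MvPolynomial (BitString m) ℂ}
    (hP : P.IsHomogeneous a) (hQ : Q.IsHomogeneous b) :
    ((2 : ℝ) ^ m / ((2 : ℝ) ^ m + a)) ^ b *
      ((∫ φ : PureState m, ‖MvPolynomial.eval (φ : EuclideanSpace ℂ (BitString m)) P‖ ^ 2
        ∂(haarState m)) *
      ∫ φ : PureState m, ‖MvPolynomial.eval (φ : EuclideanSpace ℂ (BitString m)) Q‖ ^ 2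
        ∂(haarState m)) ≤
    ∫ φ : PureState m, ‖MvPolynomial.eval (φ : EuclideanSpace ℂ (BitString m)) P‖ ^ 2 *
      ‖MvPolynomial.eval (φ : EuclideanSpace ℂ (BitString m)) Q‖ ^ 2 ∂(haarState m) := by
  have hd : (0 : ℝ) < 2 ^ m := by positivity
  have hIP := integral_haarState_of_isHomogeneous hP
  have hIQ := integral_haarState_of_isHomogeneous hQ
  have hIPQ := integral_haarState_of_isHomogeneous (hP.mul hQ)
  simp only [map_mul, norm_mul, mul_pow] at hIPQ
  have hB := fischerNormSq_mul_le hP hQ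
  have hG := gamma_ratio_ge hd a b
  set d : ℝ := 2 ^ m
  have := Real.Gamma_pos_of_pos hd
  have := Real.Gamma_pos_of_pos (show 0 < d + (a + b : ℕ) by positivity)
  set x := ∫ φ : PureState m, ‖MvPolynomial.eval (φ : EuclideanSpace ℂ (BitString m)) P‖ ^ 2
        ∂(haarState m)
  set y := ∫ φ : PureState m, ‖MvPolynomial.eval (φ : EuclideanSpace ℂ (BitString m)) Q‖ ^ 2
        ∂(haarState m)
  have : 0 ≤ x := integral_nonneg fun _ => by positivity
  have : 0 ≤ y := integral_nonneg fun _ => by positivity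
  rw [← mul_le_mul_iff_left₀ (show 0 < Real.Gamma d * Real.Gamma (d + (a + b : ℕ)) by positivity)]
  calc _ = ((d / (d + a)) ^ b * (Real.Gamma d * Real.Gamma (d + (a + b : ℕ)))) * (x * y) := by ring
    _ ≤ (Real.Gamma (d + a) * Real.Gamma (d + b)) * (x * y) := by gcongr
    _ = Real.Gamma d ^ 2 * (fischerNormSq P * fischerNormSq Q) := by
        linear_combination y * Real.Gamma (d + b) * hIP + Real.Gamma d * fischerNormSq P * hIQ
    _ ≤ Real.Gamma d ^ 2 * fischerNormSq (P * Q) := by gcongr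
    _ = _ := by linear_combination -Real.Gamma d * hIPQ

lemma continuous_eval_pureState {m : ℕ} (P : MvPolynomial (BitString m) ℂ) :
    Continuous fun φ : PureState m =>
      MvPolynomial.eval (φ : EuclideanSpace ℂ (BitString m)) P := by
  have := MvPolynomial.continuous_eval P
  fun_prop

lemma lintegral_haarState_eq {m : ℕ} {f : PureState m → ℝ} (hf : Continuous f)
    (h0 : ∀ φ, 0 ≤ f φ) :
    ∫⁻ φ, ENNReal.ofReal (f φ) ∂(haarState m) = ENNReal.ofReal (∫ φ, f φ ∂(haarState m)) :=
  (ofReal_integral_eq_lintegral_ofReal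
    (hf.integrable_of_hasCompactSupport (HasCompactSupport.of_compactSpace _))
    (.of_forall h0)).symm

lemma lintegral_haarState_mul_ge {m a b : ℕ} {P Q : MvPolynomial (BitString m) ℂ}
    (hP : P.IsHomogeneous a) (hQ : Q.IsHomogeneous b) :
    ENNReal.ofReal (((2 : ℝ) ^ m / ((2 : ℝ) ^ m + a)) ^ b) *
      ((∫⁻ φ : PureState m, ENNReal.ofReal
        (‖MvPolynomial.eval (φ : EuclideanSpace ℂ (BitString m)) P‖ ^ 2) ∂(haarState m)) *
      ∫⁻ φ : PureState m, ENNReal.ofReal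
        (‖MvPolynomial.eval (φ : EuclideanSpace ℂ (BitString m)) Q‖ ^ 2) ∂(haarState m)) ≤
    ∫⁻ φ : PureState m, ENNReal.ofReal
      (‖MvPolynomial.eval (φ : EuclideanSpace ℂ (BitString m)) P‖ ^ 2) * ENNReal.ofReal
      (‖MvPolynomial.eval (φ : EuclideanSpace ℂ (BitString m)) Q‖ ^ 2) ∂(haarState m) := by
  have hc : ∀ R : MvPolynomial (BitString m) ℂ, Continuous fun φ : PureState m =>
      ‖MvPolynomial.eval (φ : EuclideanSpace ℂ (BitString m)) R‖ ^ 2 := fun R =>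
    (continuous_eval_pureState R).norm.pow 2
  have hPQ : Continuous fun φ : PureState m =>
      ‖MvPolynomial.eval (φ : EuclideanSpace ℂ (BitString m)) P‖ ^ 2 *
      ‖MvPolynomial.eval (φ : EuclideanSpace ℂ (BitString m)) Q‖ ^ 2 := (hc P).mul (hc Q)
  simp_rw [← ENNReal.ofReal_mul (sq_nonneg _)]
  rw [lintegral_haarState_eq (hc P) (fun _ => sq_nonneg _),
    lintegral_haarState_eq (hc Q) (fun _ => sq_nonneg _),
    lintegral_haarState_eq hPQ (fun _ => by positivity),
    ← ENNReal.ofReal_mul (integral_nonneg fun _ => sq_nonneg _),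
    ← ENNReal.ofReal_mul (by positivity)]
  exact ENNReal.ofReal_le_ofReal (integral_haarState_mul_ge hP hQ)

end Haar

section ProductMeasure

variable {ι : Type*} {E : ι → Type*}

open Classical in
/-- The family that agrees with `ω` on `s` and with `ω'` elsewhere: `Set.piecewise` with classical
decidability, used to keep the coordinates in `s` and resample the others. -/
def splice (s : Set ι) (ω ω' : ∀ i, E i) : ∀ i, E i := s.piecewise ω ω'

variable {s : Set ι} {x : ι}

lemma splice_of_mem (hx : x ∈ s) (ω ω' : ∀ i, E i) : splice s ω ω' x = ω x := by
  simp [splice, hx]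

lemma splice_of_notMem (hx : x ∉ s) (ω ω' : ∀ i, E i) : splice s ω ω' x = ω' x := by
  simp [splice, hx]

lemma splice_empty (ω ω' : ∀ i, E i) : splice ∅ ω ω' = ω' :=
  funext fun _ => splice_of_notMem (Set.notMem_empty _) ω ω'

lemma splice_splice (s : Set ι) (ω ω' ω'' : ∀ i, E i) :
    splice s (splice s ω ω') ω'' = splice s ω ω'' := by
  funext x
  by_cases hx : x ∈ s <;> simp [splice, hx]

section Update

variable [DecidableEq ι]

lemma splice_compl_singleton (x : ι) (ω ω' : ∀ i, E i) :
    splice {x}ᶜ ω ω' = Function.update ω x (ω' x) := by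
  funext y
  by_cases hy : y = x
  · subst hy; simp [splice]
  · simp [splice, hy]

lemma splice_update_of_notMem (hx : x ∉ s) (ω ω' : ∀ i, E i) (φ : E x) :
    splice s (Function.update ω x φ) ω' = splice s ω ω' := by
  funext y
  by_cases hs : y ∈ s
  · simp [splice, hs, ne_of_mem_of_not_mem hs hx]
  · simp [splice, hs]

lemma splice_update_right_of_notMem (hx : x ∉ s) (ω ω' : ∀ i, E i) (φ : E x) :
    splice s ω (Function.update ω' x φ) = Function.update (splice s ω ω') x φ := by
  funext y
  by_cases hy : y = x
  · subst hy; simp [splice, hx]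
  · by_cases hs : y ∈ s <;> simp [splice, hs, hy]

lemma splice_insert_update (s : Set ι) (x : ι) (ω ω' : ∀ i, E i) (φ : E x) :
    splice (insert x s) (Function.update ω x φ) ω' = Function.update (splice s ω ω') x φ := by
  funext y
  by_cases hy : y = x
  · subst hy; simp [splice]
  · by_cases hs : y ∈ s <;> simp [splice, hs, hy]

end Update

variable [∀ i, MeasurableSpace (E i)]

lemma measurable_splice (s : Set ι) :
    Measurable fun p : (∀ i, E i) × (∀ i, E i) => splice s p.1 p.2 := by
  refine measurable_pi_lambda _ fun x => ?_
  by_cases hx : x ∈ s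
  · simp only [splice_of_mem hx]; fun_prop
  · simp only [splice_of_notMem hx]; fun_prop

lemma measurable_splice_right (s : Set ι) (ω : ∀ i, E i) :
    Measurable fun ω' : ∀ i, E i => splice s ω ω' :=
  (measurable_splice s).comp measurable_prodMk_left

variable (μ : ∀ i, Measure (E i)) [∀ i, IsProbabilityMeasure (μ i)]

lemma measurePreserving_splice (s : Set ι) :
    MeasurePreserving (fun p : (∀ i, E i) × (∀ i, E i) => splice s p.1 p.2)
      ((Measure.infinitePi μ).prod (Measure.infinitePi μ)) (Measure.infinitePi μ) := by
  classical
  refine ⟨measurable_splice s, Measure.eq_infinitePi _ fun F t ht => ?_⟩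
  have hpre : (fun p : (∀ i, E i) × (∀ i, E i) => splice s p.1 p.2) ⁻¹' ((F : Set ι).pi t) =
      ((F.filter (· ∈ s) : Finset ι) : Set ι).pi t ×ˢ
        ((F.filter (· ∉ s) : Finset ι) : Set ι).pi t := by
    ext p
    simp only [Set.mem_preimage, Set.mem_pi, Set.mem_prod, Finset.coe_filter, Finset.mem_coe,
      Set.mem_ofPred_eq, and_imp, ← forall_and]
    refine forall₂_congr fun x _ => ?_
    by_cases hx : x ∈ s <;> simp [splice, hx]
  rw [Measure.map_apply (measurable_splice s)
    (MeasurableSet.pi F.countable_toSet fun i _ => ht i), hpre, Measure.prod_prod,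
    Measure.infinitePi_pi _ fun i _ => ht i, Measure.infinitePi_pi _ fun i _ => ht i,
    Finset.prod_filter_mul_prod_filter_not]

lemma lintegral_splice (s : Set ι) {f : (∀ i, E i) → ENNReal} (hf : Measurable f) :
    ∫⁻ ω, f ω ∂(Measure.infinitePi μ) =
      ∫⁻ ω, ∫⁻ ω', f (splice s ω ω') ∂(Measure.infinitePi μ) ∂(Measure.infinitePi μ) := by
  rw [← (measurePreserving_splice μ s).lintegral_comp hf, lintegral_prod]
  exact (hf.comp (measurable_splice s)).aemeasurable

variable [DecidableEq ι]

lemma measurePreserving_update (x : ι) :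
    MeasurePreserving (fun p : (∀ i, E i) × E x => Function.update p.1 x p.2)
      ((Measure.infinitePi μ).prod (μ x)) (Measure.infinitePi μ) := by
  refine ⟨measurable_update', ?_⟩
  have heval := (MeasurePreserving.id (Measure.infinitePi μ)).prod
    (measurePreserving_eval_infinitePi μ x)
  calc ((Measure.infinitePi μ).prod (μ x)).map (fun p => Function.update p.1 x p.2)
      = ((Measure.infinitePi μ).prod (Measure.infinitePi μ)).map
          (fun p => splice {x}ᶜ p.1 p.2) := by
        rw [← heval.map_eq, Measure.map_map measurable_update' heval.measurable]
        congr 1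
        funext p
        exact (splice_compl_singleton x p.1 p.2).symm
    _ = Measure.infinitePi μ := (measurePreserving_splice μ {x}ᶜ).map_eq

lemma lintegral_update (x : ι) {f : (∀ i, E i) → ENNReal} (hf : Measurable f) :
    ∫⁻ ω, f ω ∂(Measure.infinitePi μ) =
      ∫⁻ ω, ∫⁻ φ, f (Function.update ω x φ) ∂(μ x) ∂(Measure.infinitePi μ) := by
  rw [← (measurePreserving_update μ x).lintegral_comp hf, lintegral_prod]
  exact (hf.comp measurable_update').aemeasurable

end ProductMeasure

section Decoupling

variable {ι : Type*} {E : ι → Type*} [∀ i, MeasurableSpace (E i)]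
  (μ : ∀ i, Measure (E i)) {f g : (∀ i, E i) → ENNReal}

/-- The correlation of `f` and `g` under a product measure when the coordinates in `J` are sampled
independently for `f` and for `g`, and the other coordinates are shared. -/
def crossMoment (f g : (∀ i, E i) → ENNReal) (J : Set ι) : ENNReal :=
  ∫⁻ ω, ∫⁻ ω', f ω * g (splice J ω' ω) ∂(Measure.infinitePi μ) ∂(Measure.infinitePi μ)

lemma crossMoment_of_dependsOn (hf : Measurable f) (hg : Measurable g) {J : Set ι}
    (hJ : DependsOn g J) :
    crossMoment μ f g J =
      (∫⁻ ω, f ω ∂(Measure.infinitePi μ)) * ∫⁻ ω, g ω ∂(Measure.infinitePi μ) := by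
  have hsplice : ∀ ω ω', g (splice J ω' ω) = g ω' := fun ω ω' =>
    hJ fun x hx => splice_of_mem hx ω' ω
  simp only [crossMoment, hsplice, lintegral_const_mul _ hg, lintegral_mul_const _ hf]

variable [∀ i, IsProbabilityMeasure (μ i)]

lemma crossMoment_empty : crossMoment μ f g ∅ = ∫⁻ ω, f ω * g ω ∂(Measure.infinitePi μ) := by
  simp only [crossMoment, splice_empty, lintegral_const, measure_univ, mul_one]

variable [DecidableEq ι]

lemma crossMoment_eq_lintegral_update (hf : Measurable f) (hg : Measurable g) {J : Set ι} {x : ι}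
    (hxJ : x ∉ J) :
    crossMoment μ f g J = ∫⁻ ω, ∫⁻ ω', ∫⁻ φ, f (Function.update ω x φ) *
      g (Function.update (splice J ω' ω) x φ)
      ∂(μ x) ∂(Measure.infinitePi μ) ∂(Measure.infinitePi μ) := by
  have hmeas : Measurable fun z : (∀ i, E i) × (∀ i, E i) => f z.1 * g (splice J z.2 z.1) :=
    (hf.comp measurable_fst).mul (hg.comp ((measurable_splice _).comp measurable_swap))
  simp only [crossMoment]
  rw [lintegral_update μ x hmeas.lintegral_prod_right']
  refine lintegral_congr fun ω => ?_
  rw [lintegral_lintegral_swap]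
  · simp only [splice_update_right_of_notMem hxJ]
  · exact (hmeas.comp (f := fun z : E x × (∀ i, E i) => (Function.update ω x z.1, z.2))
      (((measurable_update ω).comp measurable_fst).prodMk measurable_snd)).aemeasurable

lemma crossMoment_insert (hf : Measurable f) (hg : Measurable g) {J : Set ι} {x : ι}
    (hxJ : x ∉ J) :
    crossMoment μ f g (insert x J) =
      ∫⁻ ω, ∫⁻ ω', (∫⁻ φ, f (Function.update ω x φ) ∂(μ x)) *
        (∫⁻ φ, g (Function.update (splice J ω' ω) x φ) ∂(μ x))
        ∂(Measure.infinitePi μ) ∂(Measure.infinitePi μ) := by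
  let G : (∀ i, E i) → ENNReal := fun ω => ∫⁻ ω', ∫⁻ φ,
    g (Function.update (splice J ω' ω) x φ) ∂(μ x) ∂(Measure.infinitePi μ)
  have hinner : Measurable fun z : (∀ i, E i) × (∀ i, E i) =>
      ∫⁻ φ, g (Function.update (splice J z.2 z.1) x φ) ∂(μ x) :=
    Measurable.lintegral_prod_right' (f := fun z : ((∀ i, E i) × (∀ i, E i)) × E x =>
        g (Function.update (splice J z.1.2 z.1.1) x z.2))
      (hg.comp (measurable_update'.comp
        (((measurable_splice _).comp (measurable_swap.comp measurable_fst)).prodMk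
          measurable_snd)))
  have hG : Measurable G := hinner.lintegral_prod_right'
  have hG_update : ∀ ω φ, G (Function.update ω x φ) = G ω := fun ω φ => by
    simp only [G, splice_update_right_of_notMem hxJ, Function.update_idem]
  calc crossMoment μ f g (insert x J) = ∫⁻ ω, f ω * G ω ∂(Measure.infinitePi μ) := by
        refine lintegral_congr fun ω => ?_
        have hm : Measurable fun ω' : ∀ i, E i => g (splice (insert x J) ω' ω) :=
          hg.comp ((measurable_splice _).comp measurable_prodMk_right)
        rw [lintegral_const_mul _ hm, lintegral_update μ x hm]
        simp only [splice_insert_update, G]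
    _ = ∫⁻ ω, (∫⁻ φ, f (Function.update ω x φ) ∂(μ x)) * G ω ∂(Measure.infinitePi μ) := by
        rw [lintegral_update μ x (f := fun ω => f ω * G ω) (hf.mul hG)]
        refine lintegral_congr fun ω => ?_
        simp only [hG_update]
        exact lintegral_mul_const _ (hf.comp (measurable_update ω))
    _ = _ := lintegral_congr fun ω =>
        (lintegral_const_mul _ (hinner.comp measurable_prodMk_left)).symm

lemma mul_crossMoment_insert_le (hf : Measurable f) (hg : Measurable g) {J : Set ι} {x : ι}
    (hxJ : x ∉ J) {c : ENNReal} (hc : c ≠ ⊤)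
    (h : ∀ ω ω', c * ((∫⁻ φ, f (Function.update ω x φ) ∂(μ x)) *
        ∫⁻ φ, g (Function.update ω' x φ) ∂(μ x)) ≤
      ∫⁻ φ, f (Function.update ω x φ) * g (Function.update ω' x φ) ∂(μ x)) :
    c * crossMoment μ f g (insert x J) ≤ crossMoment μ f g J := by
  rw [crossMoment_insert μ hf hg hxJ, crossMoment_eq_lintegral_update μ hf hg hxJ,
    ← lintegral_const_mul' _ _ hc]
  refine lintegral_mono fun ω => ?_
  rw [← lintegral_const_mul' _ _ hc]
  exact lintegral_mono fun ω' => h ω (splice J ω' ω)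

lemma prod_mul_lintegral_mul_lintegral_le (hf : Measurable f) (hg : Measurable g)
    {K : Finset ι} (hK : DependsOn g K) {c : ι → ENNReal} (hc : ∀ x ∈ K, c x ≠ ⊤)
    (h : ∀ x ∈ K, ∀ ω ω', c x * ((∫⁻ φ, f (Function.update ω x φ) ∂(μ x)) *
        ∫⁻ φ, g (Function.update ω' x φ) ∂(μ x)) ≤
      ∫⁻ φ, f (Function.update ω x φ) * g (Function.update ω' x φ) ∂(μ x)) :
    (∏ x ∈ K, c x) *
      ((∫⁻ ω, f ω ∂(Measure.infinitePi μ)) * ∫⁻ ω, g ω ∂(Measure.infinitePi μ)) ≤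
    ∫⁻ ω, f ω * g ω ∂(Measure.infinitePi μ) := by
  have hcross : ∀ J ⊆ K, (∏ x ∈ J, c x) * crossMoment μ f g J ≤ crossMoment μ f g ∅ := by
    intro J
    induction J using Finset.induction_on with
    | empty => simp
    | insert x J hx ih =>
      intro hJ
      have hxK : x ∈ K := hJ (Finset.mem_insert_self x J)
      rw [Finset.prod_insert hx, mul_assoc, mul_left_comm, Finset.coe_insert]
      refine le_trans ?_ (ih ((Finset.subset_insert x J).trans hJ))
      gcongr
      exact mul_crossMoment_insert_le μ hf hg hx (hc x hxK) (h x hxK)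
  rw [← crossMoment_empty, ← crossMoment_of_dependsOn μ hf hg hK]
  exact hcross K subset_rfl

end Decoupling

section RandomGenerator

/-- Keys of all lengths: the index set of the states of a generator. -/
abbrev AnyKey : Type := Σ l : ℕ, BitString l

variable {n : ℕ → ℕ}

/-- Generators as families indexed by all keys. -/
abbrev GenTable (n : ℕ → ℕ) : Type := ∀ x : AnyKey, PureState (n x.1)

/-- The generator with a given table. -/
def GenTable.gen (ω : GenTable n) : Generator n := fun l k => ω ⟨l, k⟩

/-- The distribution of a generator whose outputs are independent Haar random states. -/
abbrev randomTable (n : ℕ → ℕ) : Measure (GenTable n) :=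
  Measure.infinitePi fun x : AnyKey => haarState (n x.1)

/-- `p` is a homogeneous polynomial of degree `a` in the state of the key `x`. -/
def HomogeneousAt (x : AnyKey) (a : ℕ) (p : GenTable n → ℂ) : Prop :=
  ∀ ω, ∃ P : MvPolynomial (BitString (n x.1)) ℂ, P.IsHomogeneous a ∧ ∀ φ : PureState (n x.1),
    p (Function.update ω x φ) =
      MvPolynomial.eval (φ : EuclideanSpace ℂ (BitString (n x.1))) P

/-- The squared modulus, as an extended nonnegative real. -/
def sqMod (p : GenTable n → ℂ) (ω : GenTable n) : ENNReal := ENNReal.ofReal (‖p ω‖ ^ 2)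

lemma measurable_sqMod {p : GenTable n → ℂ} (hp : Measurable p) : Measurable (sqMod p) := by
  unfold sqMod; fun_prop

lemma lintegral_sqMod_mul_ge {p q : GenTable n → ℂ} (hp : Measurable p) (hq : Measurable q)
    {K : Finset AnyKey} {a b : AnyKey → ℕ} (hpK : ∀ x ∈ K, HomogeneousAt x (a x) p)
    (hqK : ∀ x ∈ K, HomogeneousAt x (b x) q) (hK : DependsOn q K) :
    (∏ x ∈ K, ENNReal.ofReal (((2 : ℝ) ^ n x.1 / ((2 : ℝ) ^ n x.1 + a x)) ^ b x)) *
      ((∫⁻ ω, sqMod p ω ∂(randomTable n)) * ∫⁻ ω, sqMod q ω ∂(randomTable n)) ≤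
    ∫⁻ ω, sqMod p ω * sqMod q ω ∂(randomTable n) := by
  refine prod_mul_lintegral_mul_lintegral_le _ (measurable_sqMod hp) (measurable_sqMod hq)
    (fun ω ω' h => by simp only [sqMod, hK h]) (fun _ _ => ENNReal.ofReal_ne_top)
    fun x hx ω ω' => ?_
  obtain ⟨P, hP, hpP⟩ := hpK x hx ω
  obtain ⟨Q, hQ, hqQ⟩ := hqK x hx ω'
  simp only [sqMod, hpP, hqQ]
  exact lintegral_haarState_mul_ge hP hQ

end RandomGenerator

section Instruments

open scoped ComplexOrder

variable {Ω X Y : Type} [Fintype Ω] [Fintype X] [DecidableEq X] [Fintype Y]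

lemma mul_ketbra_mul_conjTranspose {X Y : Type} [Fintype X] (R : Matrix Y X ℂ) (v : X → ℂ) :
    R * ketbra v * Rᴴ = ketbra (R *ᵥ v) := by
  rw [ketbra, mul_vecMulVec, vecMulVec_mul, ketbra, star_mulVec]

lemma ketbra_single_prod {X Y : Type} [DecidableEq X] [DecidableEq Y] (x : X) (y : Y) :
    ketbra (Pi.single (x, y) 1 : X × Y → ℂ) =
      ketbra (Pi.single x 1 : X → ℂ) ⊗ₖ ketbra (Pi.single y 1 : Y → ℂ) := by
  ext ⟨a, b⟩ ⟨a', b'⟩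
  simp only [ketbra, vecMulVec_apply, kroneckerMap_apply, Pi.star_apply, Pi.single_apply,
    Prod.mk.injEq]
  by_cases ha : a = x <;> by_cases hb : b = y <;> by_cases ha' : a' = x <;>
    by_cases hb' : b' = y <;> simp [ha, hb, ha', hb']

lemma posSemidef_ketbra {X : Type} [Finite X] (v : X → ℂ) : (ketbra v).PosSemidef :=
  posSemidef_vecMulVec_self_star v

lemma Instrument.posSemidef_apply (E : Instrument Ω X Y) (o : Ω) {ρ : Matrix X X ℂ}
    (hρ : ρ.PosSemidef) : (E.apply o ρ).PosSemidef :=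
  posSemidef_sum _ fun i _ => hρ.mul_mul_conjTranspose_same (E.K o i)

lemma Instrument.sum_trace_apply (E : Instrument Ω X Y) (ρ : Matrix X X ℂ) :
    ∑ o, trace (E.apply o ρ) = trace ρ := by
  have hcyclic : ∀ o i, trace (E.K o i * ρ * (E.K o i)ᴴ) = trace ((E.K o i)ᴴ * E.K o i * ρ) :=
    fun o i => by rw [trace_mul_comm, ← Matrix.mul_assoc]
  simp only [Instrument.apply, trace_sum, hcyclic]
  simp only [← trace_sum, ← Matrix.sum_mul, E.complete, Matrix.one_mul]

lemma genIsometry_isometry {n : ℕ → ℕ} (I : Generator n) (L : ℕ) :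
    (genIsometry I L)ᴴ * genIsometry I L = 1 := by
  ext x x'
  rw [mul_apply, Fintype.sum_sigma, Finset.sum_eq_single x]
  · by_cases hx : x = x'
    · subst hx
      have hnorm : ‖(I x.1 x.2 : EuclideanSpace ℂ (BitString (n x.1)))‖ ^ 2 = 1 := by
        rw [norm_eq_of_mem_sphere, one_pow]
      rw [EuclideanSpace.norm_sq_eq] at hnorm
      simp only [genIsometry, conjTranspose_apply, if_true, one_apply_eq, RCLike.star_def,
        Complex.conj_mul']
      exact_mod_cast hnorm
    · simp [genIsometry, hx]
  · intro y _ hy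
    simp [genIsometry, hy]
  · simp

lemma answerIsometry_isometry {n : ℕ → ℕ} (I : Generator n) (L : ℕ) (X : Type) [Fintype X]
    [DecidableEq X] (x : Key L) :
    (answerIsometry I L X x)ᴴ * answerIsometry I L X x = 1 := by
  have hgen := congrFun (congrFun (genIsometry_isometry I L) x) x
  simp only [mul_apply, conjTranspose_apply, one_apply_eq] at hgen
  ext a a'
  rw [mul_apply, Fintype.sum_prod_type, Finset.sum_eq_single a]
  · by_cases ha : a = a'
    · subst ha
      simpa [answerIsometry] using hgen
    · simp [answerIsometry, ha]
  · intro y _ hy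
    simp [answerIsometry, hy]
  · simp

end Instruments

section Parties

open scoped ComplexOrder

lemma sum_kronecker {ι X X' Y Y' R : Type*} [NonUnitalNonAssocSemiring R] (s : Finset ι)
    (f : ι → Matrix X X' R) (B : Matrix Y Y' R) : (∑ i ∈ s, f i) ⊗ₖ B = ∑ i ∈ s, f i ⊗ₖ B := by
  ext ⟨a, b⟩ ⟨a', b'⟩
  simp [Matrix.sum_apply, kroneckerMap_apply, Finset.sum_mul]

lemma kronecker_sum {ι X X' Y Y' R : Type*} [NonUnitalNonAssocSemiring R] (s : Finset ι)
    (A : Matrix X X' R) (f : ι → Matrix Y Y' R) : A ⊗ₖ (∑ i ∈ s, f i) = ∑ i ∈ s, A ⊗ₖ f i := by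
  ext ⟨a, b⟩ ⟨a', b'⟩
  simp [Matrix.sum_apply, kroneckerMap_apply, Finset.mul_sum]

lemma sum_init_last {V T : Type*} [AddCommMonoid V] [Fintype T] {j : ℕ} (f : (Fin j → T) → T → V) :
    ∑ h : Fin (j + 1) → T, f (Fin.init h) (h (Fin.last j)) = ∑ h, ∑ t, f h t := by
  rw [← Fintype.sum_prod_type']
  symm
  refine Fintype.sum_equiv ((Equiv.prodComm _ _).trans (Fin.snocEquiv fun _ => T)) _ _ fun p => ?_
  simp [Fin.snocEquiv]

variable {n : ℕ → ℕ} {L : ℕ} {M : Type} [Fintype M] {r : ℕ}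

/-- The effect of one round on the memory of a party that sends the message `m`. -/
def Party.round (P : Party n L M r) (I : Generator n) {j : ℕ} (h : Fin j → M × M) (m : M)
    (ρ : Matrix (Fin P.dim) (Fin P.dim) ℂ) : Matrix (Fin P.dim) (Fin P.dim) ℂ :=
  ∑ x, ∑ a, ∑ b, P.roundKraus I h m x a b * ρ * (P.roundKraus I h m x a b)ᴴ

/-- The subnormalized memory of one party after `j` rounds with transcript `h`, where `own` selects
the message that this party sent. -/
def Party.memory (P : Party n L M r) (I : Generator n) (own : M × M → M) :
    ∀ j : ℕ, (Fin j → M × M) → Matrix (Fin P.dim) (Fin P.dim) ℂ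
  | 0, _ => ketbra (Pi.single P.start 1)
  | j + 1, h => P.round I (Fin.init h) (own (h (Fin.last j))) (P.memory I own j (Fin.init h))

lemma jointState_eq_kronecker (A B : Party n L M r) (I : Generator n) (j : ℕ)
    (h : Fin j → M × M) :
    jointState A B I j h = A.memory I Prod.fst j h ⊗ₖ B.memory I Prod.snd j h := by
  induction j with
  | zero => exact ketbra_single_prod _ _
  | succ j ih =>
    simp only [jointState, Party.memory, Party.round, ih]
    simp only [sum_kronecker]
    simp only [kronecker_sum, conjTranspose_kronecker, ← mul_kronecker_mul]

lemma posSemidef_memory (P : Party n L M r) (I : Generator n) (own : M × M → M) (j : ℕ)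
    (h : Fin j → M × M) : (P.memory I own j h).PosSemidef := by
  induction j with
  | zero => exact posSemidef_ketbra _
  | succ j ih =>
    exact posSemidef_sum _ fun x _ => posSemidef_sum _ fun a _ => posSemidef_sum _ fun b _ =>
      (ih _).mul_mul_conjTranspose_same _

lemma sum_trace_round (P : Party n L M r) (I : Generator n) {j : ℕ} (h : Fin j → M × M)
    (ρ : Matrix (Fin P.dim) (Fin P.dim) ℂ) : ∑ m, trace (P.round I h m ρ) = trace ρ := by
  have hround : ∀ m, trace (P.round I h m ρ) = ∑ x, trace ((P.send j h).apply m
      (answerIsometry I L (Fin P.dim) x * (P.query j h).apply x ρ *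
        (answerIsometry I L (Fin P.dim) x)ᴴ)) := by
    intro m
    simp only [Party.round, Instrument.apply, Matrix.mul_sum, Matrix.sum_mul, trace_sum]
    refine Finset.sum_congr rfl fun x _ => ?_
    rw [Finset.sum_comm]
    refine Finset.sum_congr rfl fun b _ => Finset.sum_congr rfl fun a _ => ?_
    simp only [Party.roundKraus, conjTranspose_mul, Matrix.mul_assoc]
  simp only [hround]
  rw [Finset.sum_comm]
  simp only [Instrument.sum_trace_apply]
  rw [← (P.query j h).sum_trace_apply ρ]
  refine Finset.sum_congr rfl fun x _ => ?_
  rw [trace_mul_comm, ← Matrix.mul_assoc, answerIsometry_isometry, Matrix.one_mul]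

lemma sum_trace_memory (A B : Party n L M r) (I I' : Generator n) (j : ℕ) :
    ∑ h, trace (A.memory I Prod.fst j h) * trace (B.memory I' Prod.snd j h) = 1 := by
  induction j with
  | zero => simp [Party.memory, ketbra, trace_vecMulVec]
  | succ j ih =>
    calc _ = ∑ h : Fin j → M × M, ∑ t : M × M,
          trace (A.round I h t.1 (A.memory I Prod.fst j h)) *
            trace (B.round I' h t.2 (B.memory I' Prod.snd j h)) := sum_init_last (V := ℂ) _
      _ = ∑ h, trace (A.memory I Prod.fst j h) * trace (B.memory I' Prod.snd j h) := by
        refine Finset.sum_congr rfl fun h _ => ?_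
        rw [Fintype.sum_prod_type, ← sum_trace_round A I h, ← sum_trace_round B I' h,
          Finset.sum_mul_sum]
      _ = 1 := ih

/-- The factor that a party contributes to the probability of transcript `τ` and its output `k`. -/
def Party.weight (P : Party n L M r) (I : Generator n) (own : M × M → M) (τ : Fin r → M × M)
    (k : Bool) : ℝ :=
  (trace ((P.out τ).apply k (P.memory I own r τ))).re

lemma trace_out_nonneg (P : Party n L M r) (I : Generator n) (own : M × M → M)
    (τ : Fin r → M × M) (k : Bool) : 0 ≤ trace ((P.out τ).apply k (P.memory I own r τ)) :=
  ((P.out τ).posSemidef_apply k (posSemidef_memory P I own r τ)).trace_nonneg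

lemma weight_nonneg (P : Party n L M r) (I : Generator n) (own : M × M → M) (τ : Fin r → M × M)
    (k : Bool) : 0 ≤ P.weight I own τ k :=
  (Complex.nonneg_iff.1 (trace_out_nonneg P I own τ k)).1

lemma ofReal_weight (P : Party n L M r) (I : Generator n) (own : M × M → M) (τ : Fin r → M × M)
    (k : Bool) : (P.weight I own τ k : ℂ) = trace ((P.out τ).apply k (P.memory I own r τ)) :=
  (Complex.eq_re_of_ofReal_le (trace_out_nonneg P I own τ k)).symm

lemma outcomeProb_eq_mul (A B : Party n L M r) (I : Generator n) (τ : Fin r → M × M)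
    (kA kB : Bool) :
    outcomeProb A B I τ kA kB = A.weight I Prod.fst τ kA * B.weight I Prod.snd τ kB := by
  have htrace : trace (∑ a, ∑ b, ((A.out τ).K kA a ⊗ₖ (B.out τ).K kB b) * jointState A B I r τ *
      ((A.out τ).K kA a ⊗ₖ (B.out τ).K kB b)ᴴ) =
      (A.weight I Prod.fst τ kA * B.weight I Prod.snd τ kB : ℝ) := by
    rw [Complex.ofReal_mul, ofReal_weight, ofReal_weight, ← trace_kronecker, Instrument.apply,
      Instrument.apply, sum_kronecker]
    simp only [kronecker_sum, jointState_eq_kronecker, conjTranspose_kronecker,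
      ← mul_kronecker_mul]
  rw [outcomeProb, htrace, Complex.ofReal_re]

lemma outcomeProb_nonneg (A B : Party n L M r) (I : Generator n) (τ : Fin r → M × M)
    (kA kB : Bool) : 0 ≤ outcomeProb A B I τ kA kB := by
  rw [outcomeProb_eq_mul]
  exact mul_nonneg (weight_nonneg ..) (weight_nonneg ..)

lemma sum_weight_mul_weight (A B : Party n L M r) (I I' : Generator n) :
    ∑ τ, ∑ kA, ∑ kB, A.weight I Prod.fst τ kA * B.weight I' Prod.snd τ kB = 1 := by
  apply Complex.ofReal_injective
  rw [Complex.ofReal_one, ← sum_trace_memory A B I I' r]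
  push_cast
  refine Finset.sum_congr rfl fun τ _ => ?_
  simp only [← Finset.sum_mul_sum, ofReal_weight, Instrument.sum_trace_apply]

lemma sum_outcomeProb (A B : Party n L M r) (I : Generator n) :
    ∑ τ, ∑ kA, ∑ kB, outcomeProb A B I τ kA kB = 1 := by
  simp only [outcomeProb_eq_mul, sum_weight_mul_weight]

end Parties

section MultiHomogeneous

variable {n : ℕ → ℕ}

/-- `p` is a polynomial in the states of keys of length at most `L`, homogeneous of degree `deg x`
in the state of each key `x`. -/
structure MultiHomogeneous (L : ℕ) (deg : AnyKey → ℕ) (p : GenTable n → ℂ) : Prop where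
  measurable : Measurable p
  homogeneousAt : ∀ x, HomogeneousAt x (deg x) p
  dependsOn : DependsOn p {x : AnyKey | x.1 ≤ L}

namespace MultiHomogeneous

variable {L : ℕ} {deg deg' : AnyKey → ℕ} {p q : GenTable n → ℂ}

lemma const (L : ℕ) (c : ℂ) : MultiHomogeneous (n := n) L 0 fun _ => c where
  measurable := measurable_const
  homogeneousAt _ _ := ⟨MvPolynomial.C c, MvPolynomial.isHomogeneous_C _ _, fun _ => by simp⟩
  dependsOn _ _ _ := rfl

lemma mul (hp : MultiHomogeneous L deg p) (hq : MultiHomogeneous L deg' q) :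
    MultiHomogeneous L (deg + deg') fun ω => p ω * q ω where
  measurable := hp.measurable.mul hq.measurable
  homogeneousAt x ω := by
    obtain ⟨P, hP, hpP⟩ := hp.homogeneousAt x ω
    obtain ⟨Q, hQ, hqQ⟩ := hq.homogeneousAt x ω
    exact ⟨P * Q, hP.mul hQ, fun φ => by simp only [hpP, hqQ, map_mul]⟩
  dependsOn _ _ h := congrArg₂ (· * ·) (hp.dependsOn h) (hq.dependsOn h)

lemma const_mul (c : ℂ) (hp : MultiHomogeneous L deg p) :
    MultiHomogeneous L deg fun ω => c * p ω := by
  simpa using (const L c).mul hp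

lemma sum {ι : Type*} [Fintype ι] {p : ι → GenTable n → ℂ}
    (hp : ∀ i, MultiHomogeneous L deg (p i)) :
    MultiHomogeneous L deg fun ω => ∑ i, p i ω where
  measurable := Finset.measurable_sum _ fun i _ => (hp i).measurable
  homogeneousAt x ω := by
    choose P hP hpP using fun i => (hp i).homogeneousAt x ω
    exact ⟨∑ i, P i, MvPolynomial.IsHomogeneous.sum _ _ _ fun i _ => hP i,
      fun φ => by simp only [hpP, map_sum]⟩
  dependsOn _ _ h := Finset.sum_congr rfl fun i _ => (hp i).dependsOn h

lemma coordinate {x : AnyKey} (hx : x.1 ≤ L) (y : BitString (n x.1)) :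
    MultiHomogeneous L (Pi.single x 1) fun ω : GenTable n =>
      (ω x : EuclideanSpace ℂ (BitString (n x.1))) y where
  measurable := by fun_prop
  homogeneousAt z ω := by
    by_cases h : z = x
    · subst h
      exact ⟨MvPolynomial.X y, by simpa using MvPolynomial.isHomogeneous_X _ _,
        fun φ => by simp⟩
    · refine ⟨MvPolynomial.C ((ω x : EuclideanSpace ℂ (BitString (n x.1))) y), ?_, fun φ => ?_⟩
      · simpa [h] using MvPolynomial.isHomogeneous_C _ _
      · simp [Function.update_of_ne (Ne.symm h)]
  dependsOn ω ω' h := by simp only [h x hx]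

lemma homogeneousAt_splice (hp : MultiHomogeneous L deg p) {s : Set AnyKey} {x : AnyKey}
    (hx : x ∉ s) (ω : GenTable n) :
    HomogeneousAt x (deg x) fun ω' => p (splice s ω ω') := fun ω' => by
  obtain ⟨P, hP, hpP⟩ := hp.homogeneousAt x (splice s ω ω')
  exact ⟨P, hP, fun φ => by simp only [splice_update_right_of_notMem hx, hpP]⟩

end MultiHomogeneous

variable {L : ℕ} {M : Type} [Fintype M] {r : ℕ}

/-- A bounded-length key as a key. -/
abbrev Key.toAny (x : Key L) : AnyKey := ⟨x.1, x.2⟩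

lemma roundKraus_apply (P : Party n L M r) (ω : GenTable n) {j : ℕ} (h : Fin j → M × M) (m : M)
    (x : Key L) (a : Fin (P.query j h).size) (b : Fin (P.send j h).size) (i i' : Fin P.dim) :
    P.roundKraus ω.gen h m x a b i i' =
      ∑ y : BitString (n x.1), (∑ d, (P.send j h).K m b i (d, ⟨x, y⟩) * (P.query j h).K x a d i') *
        (ω x.toAny : EuclideanSpace ℂ (BitString (n x.1))) y := by
  have hanswer : ∀ d, ((P.send j h).K m b * answerIsometry ω.gen L (Fin P.dim) x) i d =
      ∑ y : BitString (n x.1), (P.send j h).K m b i (d, ⟨x, y⟩) *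
        (ω x.toAny : EuclideanSpace ℂ (BitString (n x.1))) y := by
    intro d
    rw [mul_apply, Fintype.sum_prod_type, Finset.sum_eq_single d, Fintype.sum_sigma,
      Finset.sum_eq_single x]
    · refine Finset.sum_congr rfl fun y _ => ?_
      simp [answerIsometry, genIsometry, GenTable.gen]
    · intro x' _ hx'
      simp [answerIsometry, genIsometry, hx']
    · simp
    · intro d' _ hd'
      simp [answerIsometry, hd']
    · simp
  rw [Party.roundKraus, mul_apply]
  simp only [hanswer, Finset.sum_mul]
  rw [Finset.sum_comm]
  exact Finset.sum_congr rfl fun y _ => Finset.sum_congr rfl fun d _ => by ring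

lemma multiHomogeneous_roundKraus (P : Party n L M r) {j : ℕ} (h : Fin j → M × M) (m : M)
    (x : Key L) (a : Fin (P.query j h).size) (b : Fin (P.send j h).size) (i i' : Fin P.dim) :
    MultiHomogeneous L (Pi.single x.toAny 1) fun ω : GenTable n =>
      P.roundKraus ω.gen h m x a b i i' := by
  simp only [roundKraus_apply]
  exact MultiHomogeneous.sum fun y =>
    (MultiHomogeneous.coordinate (x := x.toAny) (Fin.is_le x.1) y).const_mul _

lemma exists_memory_eq_sum_ketbra (P : Party n L M r) (own : M × M → M) (j : ℕ)
    (h : Fin j → M × M) :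
    ∃ (ι : Type) (_ : Fintype ι) (v : ι → GenTable n → Fin P.dim → ℂ) (deg : ι → AnyKey → ℕ),
      (∀ ω : GenTable n, P.memory ω.gen own j h = ∑ u, ketbra (v u ω)) ∧
      (∀ u i, MultiHomogeneous L (deg u) fun ω => v u ω i) ∧
      ∀ u (K : Finset AnyKey), ∑ x ∈ K, deg u x ≤ j := by
  induction j with
  | zero =>
    exact ⟨Unit, inferInstance, fun _ _ => Pi.single P.start 1, fun _ => 0,
      fun ω => by simp [Party.memory], fun _ i => MultiHomogeneous.const L _, by simp⟩
  | succ j ih =>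
    obtain ⟨ι, _, v, deg, hmemory, hhom, hdeg⟩ := ih (Fin.init h)
    set g := Fin.init h
    set m := own (h (Fin.last j))
    refine ⟨(Key L × Fin (P.query j g).size × Fin (P.send j g).size) × ι, inferInstance,
      fun u ω => P.roundKraus ω.gen g m u.1.1 u.1.2.1 u.1.2.2 *ᵥ v u.2 ω,
      fun u => Pi.single u.1.1.toAny 1 + deg u.2, fun ω => ?_, fun u i => ?_, fun u K => ?_⟩
    · simp only [Party.memory, Party.round]
      rw [hmemory ω]
      simp only [Fintype.sum_prod_type, Matrix.mul_sum, Matrix.sum_mul,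
        mul_ketbra_mul_conjTranspose]
      rfl
    · exact MultiHomogeneous.sum fun i' =>
        (multiHomogeneous_roundKraus P g m _ _ _ i i').mul (hhom u.2 i')
    · simp only [Pi.add_apply, Finset.sum_add_distrib]
      have hquery : ∑ x ∈ K, (Pi.single u.1.1.toAny 1 : AnyKey → ℕ) x ≤ 1 := by
        rw [Finset.sum_pi_single']; split_ifs <;> simp
      have := hdeg u.2 K
      omega

lemma exists_weight_eq_sum_normSq (P : Party n L M r) (own : M × M → M) (τ : Fin r → M × M)
    (k : Bool) :
    ∃ (ι : Type) (_ : Fintype ι) (p : ι → GenTable n → ℂ) (deg : ι → AnyKey → ℕ),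
      (∀ ω : GenTable n, P.weight ω.gen own τ k = ∑ u, ‖p u ω‖ ^ 2) ∧
      (∀ u, MultiHomogeneous L (deg u) (p u)) ∧
      ∀ u (K : Finset AnyKey), ∑ x ∈ K, deg u x ≤ r := by
  obtain ⟨ι, _, v, deg, hmemory, hhom, hdeg⟩ := exists_memory_eq_sum_ketbra P own r τ
  refine ⟨Fin (P.out τ).size × ι, inferInstance,
    fun u ω => ((P.out τ).K k u.1 *ᵥ v u.2 ω) (), fun u => deg u.2, fun ω => ?_, fun u => ?_,
    fun u => hdeg u.2⟩
  · rw [Party.weight, Instrument.apply, hmemory]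
    simp only [Matrix.mul_sum, Matrix.sum_mul, mul_ketbra_mul_conjTranspose, trace_sum,
      Fintype.sum_prod_type, Complex.re_sum]
    refine Finset.sum_congr rfl fun a _ => Finset.sum_congr rfl fun u _ => ?_
    simp [ketbra, trace, vecMulVec_apply, ← Complex.normSq_eq_norm_sq, Complex.normSq_apply]
  · exact MultiHomogeneous.sum fun i => (hhom u.2 i).const_mul _

end MultiHomogeneous

section Weights

lemma ofReal_sum_sum {ι κ : Type*} [Fintype ι] [Fintype κ] {f : ι → κ → ℝ}
    (hf : ∀ i j, 0 ≤ f i j) :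
    ENNReal.ofReal (∑ i, ∑ j, f i j) = ∑ i, ∑ j, ENNReal.ofReal (f i j) := by
  rw [ENNReal.ofReal_sum_of_nonneg fun i _ => Finset.sum_nonneg fun j _ => hf i j]
  exact Finset.sum_congr rfl fun i _ => ENNReal.ofReal_sum_of_nonneg fun j _ => hf i j

lemma measurable_apply_of_bool {α β : Type*} [MeasurableSpace α] [MeasurableSpace β]
    {f : Bool → α → β} {g : α → Bool} (hf : ∀ k, Measurable (f k)) (hg : Measurable g) :
    Measurable fun x => f (g x) x :=
  (measurable_from_prod_countable_right (f := fun z : Bool × α => f z.1 z.2) hf).comp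
    (hg.prodMk measurable_id)

lemma pow_le_prod_div_add_pow {ι : Type*} {K : Finset ι} {N : ι → ℝ} {D : ℝ} (hD : 0 < D)
    (hN : ∀ x ∈ K, D ≤ N x) {a b : ι → ℕ} {r : ℕ} (ha : ∀ x ∈ K, a x ≤ r)
    (hb : ∑ x ∈ K, b x ≤ r) :
    (D / (D + r)) ^ r ≤ ∏ x ∈ K, (N x / (N x + a x)) ^ b x := by
  have hbase : ∀ x ∈ K, D / (D + r) ≤ N x / (N x + a x) := by
    intro x hx
    have hNx := hN x hx
    have hNpos : 0 < N x := hD.trans_le hNx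
    have hax : (a x : ℝ) ≤ r := by exact_mod_cast ha x hx
    have hcross : D * a x ≤ N x * r := by gcongr
    rw [div_le_div_iff₀ (by positivity) (by positivity)]
    linarith
  calc (D / (D + r)) ^ r
      ≤ (D / (D + r)) ^ (∑ x ∈ K, b x) :=
        pow_le_pow_of_le_one (by positivity) (div_le_one_of_le₀ (by simp) (by positivity)) hb
    _ = ∏ x ∈ K, (D / (D + r)) ^ b x := (Finset.prod_pow_eq_pow_sum ..).symm
    _ ≤ _ := Finset.prod_le_prod (fun _ _ => by positivity) fun x hx =>
        pow_le_pow_left₀ (by positivity) (hbase x hx) _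

lemma mul_lintegral_sum_mul_lintegral_sum_le {α ι κ : Type*} [MeasurableSpace α] {μ : Measure α}
    [Fintype ι] [Fintype κ] {f : ι → α → ENNReal} {g : κ → α → ENNReal}
    (hf : ∀ u, Measurable (f u)) (hg : ∀ v, Measurable (g v)) {c : ENNReal}
    (h : ∀ u v, c * ((∫⁻ x, f u x ∂μ) * ∫⁻ x, g v x ∂μ) ≤ ∫⁻ x, f u x * g v x ∂μ) :
    c * ((∫⁻ x, ∑ u, f u x ∂μ) * ∫⁻ x, ∑ v, g v x ∂μ) ≤
      ∫⁻ x, (∑ u, f u x) * ∑ v, g v x ∂μ := by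
  have hfg : ∀ u v, Measurable fun x => f u x * g v x := fun u v => (hf u).mul (hg v)
  rw [lintegral_finsetSum _ fun u _ => hf u, lintegral_finsetSum _ fun v _ => hg v]
  simp only [Finset.sum_mul_sum]
  simp only [Finset.mul_sum]
  rw [lintegral_finsetSum _ fun u _ => Finset.measurable_sum _ fun v _ => hfg u v]
  simp only [lintegral_finsetSum _ fun v _ => hfg _ v]
  exact Finset.sum_le_sum fun u _ => Finset.sum_le_sum fun v _ => h u v

variable {n : ℕ → ℕ} {L : ℕ} {M : Type} [Fintype M] {r : ℕ}

/-- The weight of a party as a function of the table of the generator. -/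
def Party.wt (P : Party n L M r) (own : M × M → M) (τ : Fin r → M × M) (k : Bool)
    (ω : GenTable n) : ENNReal :=
  ENNReal.ofReal (P.weight ω.gen own τ k)

lemma exists_wt_eq_sum_sqMod (P : Party n L M r) (own : M × M → M) (τ : Fin r → M × M)
    (k : Bool) :
    ∃ (ι : Type) (_ : Fintype ι) (p : ι → GenTable n → ℂ) (deg : ι → AnyKey → ℕ),
      (∀ ω : GenTable n, P.wt own τ k ω = ∑ u, sqMod (p u) ω) ∧
      (∀ u, MultiHomogeneous L (deg u) (p u)) ∧
      ∀ u (K : Finset AnyKey), ∑ x ∈ K, deg u x ≤ r := by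
  obtain ⟨ι, _, p, deg, hweight, hhom, hdeg⟩ := exists_weight_eq_sum_normSq P own τ k
  refine ⟨ι, inferInstance, p, deg, fun ω => ?_, hhom, hdeg⟩
  rw [Party.wt, hweight, ENNReal.ofReal_sum_of_nonneg fun _ _ => sq_nonneg _]
  rfl

lemma measurable_wt (P : Party n L M r) (own : M × M → M) (τ : Fin r → M × M) (k : Bool) :
    Measurable (P.wt own τ k) := by
  obtain ⟨ι, _, p, deg, hwt, hhom, -⟩ := exists_wt_eq_sum_sqMod P own τ k
  rw [funext hwt]
  exact Finset.measurable_sum _ fun u _ => measurable_sqMod (hhom u).measurable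

lemma measurable_wt_splice (P : Party n L M r) (own : M × M → M) (τ : Fin r → M × M) (k : Bool)
    (s : Set AnyKey) (ω : GenTable n) : Measurable fun ω' => P.wt own τ k (splice s ω ω') :=
  (measurable_wt P own τ k).comp (measurable_splice_right s ω)

lemma ofReal_outcomeProb (A B : Party n L M r) (ω : GenTable n) (τ : Fin r → M × M)
    (kA kB : Bool) :
    ENNReal.ofReal (outcomeProb A B ω.gen τ kA kB) =
      A.wt Prod.fst τ kA ω * B.wt Prod.snd τ kB ω := by
  rw [outcomeProb_eq_mul, ENNReal.ofReal_mul (weight_nonneg ..), Party.wt, Party.wt]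

lemma measurable_outcomeProb (A B : Party n L M r) (τ : Fin r → M × M) (kA kB : Bool) :
    Measurable fun ω : GenTable n => outcomeProb A B ω.gen τ kA kB := by
  have htoReal : (fun ω : GenTable n => outcomeProb A B ω.gen τ kA kB) =
      fun ω => (A.wt Prod.fst τ kA ω * B.wt Prod.snd τ kB ω).toReal := by
    funext ω
    rw [← ofReal_outcomeProb, ENNReal.toReal_ofReal (outcomeProb_nonneg ..)]
  rw [htoReal]
  exact ((measurable_wt A ..).mul (measurable_wt B ..)).ennreal_toReal

lemma sum_wt_mul_wt (A B : Party n L M r) (ω ω' : GenTable n) :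
    ∑ τ, ∑ kA, ∑ kB, A.wt Prod.fst τ kA ω * B.wt Prod.snd τ kB ω' = 1 := by
  have hnonneg : ∀ τ kA kB, 0 ≤ A.weight ω.gen Prod.fst τ kA * B.weight ω'.gen Prod.snd τ kB :=
    fun τ kA kB => mul_nonneg (weight_nonneg ..) (weight_nonneg ..)
  rw [← ENNReal.ofReal_one, ← sum_weight_mul_weight A B ω.gen ω'.gen,
    ofReal_sum_sum fun _ _ => Finset.sum_nonneg fun _ _ => hnonneg ..]
  refine Finset.sum_congr rfl fun τ _ => Finset.sum_congr rfl fun kA _ => ?_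
  rw [ENNReal.ofReal_sum_of_nonneg fun _ _ => hnonneg ..]
  exact Finset.sum_congr rfl fun kB _ => (ENNReal.ofReal_mul (weight_nonneg ..)).symm

/-- The weight of a party, averaged over the states of the keys outside `s`. -/
def Party.avgWt (P : Party n L M r) (own : M × M → M) (s : Set AnyKey) (τ : Fin r → M × M)
    (k : Bool) (ω : GenTable n) : ENNReal :=
  ∫⁻ ω', P.wt own τ k (splice s ω ω') ∂(randomTable n)

lemma measurable_avgWt (P : Party n L M r) (own : M × M → M) (s : Set AnyKey)
    (τ : Fin r → M × M) (k : Bool) : Measurable (P.avgWt own s τ k) :=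
  ((measurable_wt P own τ k).comp (measurable_splice s)).lintegral_prod_right'

lemma avgWt_splice (P : Party n L M r) (own : M × M → M) (s : Set AnyKey) (τ : Fin r → M × M)
    (k : Bool) (ω ω' : GenTable n) : P.avgWt own s τ k (splice s ω ω') = P.avgWt own s τ k ω := by
  simp only [Party.avgWt, splice_splice]

lemma avgWt_update (P : Party n L M r) (own : M × M → M) {s : Set AnyKey} (τ : Fin r → M × M)
    (k : Bool) (ω : GenTable n) {x : AnyKey} (hx : x ∉ s) (φ : PureState (n x.1)) :
    P.avgWt own s τ k (Function.update ω x φ) = P.avgWt own s τ k ω := by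
  simp only [Party.avgWt, splice_update_of_notMem hx]

lemma MultiHomogeneous.lintegral_sqMod_splice_mul_ge {p q : GenTable n → ℂ}
    {a b : AnyKey → ℕ} (hp : MultiHomogeneous L a p) (hq : MultiHomogeneous L b q)
    {s : Set AnyKey} {D : ℝ} (hD : 0 < D) (hs : ∀ x ∉ s, D ≤ 2 ^ n x.1) (ha : ∀ x, a x ≤ r)
    (hb : ∀ K : Finset AnyKey, ∑ x ∈ K, b x ≤ r) (ω : GenTable n) :
    ENNReal.ofReal ((D / (D + r)) ^ r) *
      ((∫⁻ ω', sqMod p (splice s ω ω') ∂(randomTable n)) *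
        ∫⁻ ω', sqMod q (splice s ω ω') ∂(randomTable n)) ≤
      ∫⁻ ω', sqMod p (splice s ω ω') * sqMod q (splice s ω ω') ∂(randomTable n) := by
  classical
  let K : Finset AnyKey := (Finset.univ.image (Key.toAny (L := L))).filter (· ∉ s)
  have hKs : ∀ x ∈ K, x ∉ s := fun x hx => (Finset.mem_filter.1 hx).2
  have hdep : DependsOn (fun ω' => q (splice s ω ω')) K := by
    refine fun ω₁ ω₂ hω => hq.dependsOn fun x (hx : x.1 ≤ L) => ?_
    by_cases hxs : x ∈ s
    · rw [splice_of_mem hxs, splice_of_mem hxs]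
    · rw [splice_of_notMem hxs, splice_of_notMem hxs]
      refine hω x (Finset.mem_filter.2 ⟨Finset.mem_image.2 ?_, hxs⟩)
      exact ⟨⟨⟨x.1, Nat.lt_succ_iff.2 hx⟩, x.2⟩, Finset.mem_univ _, rfl⟩
  refine le_trans (mul_le_mul_left ?_ _) (lintegral_sqMod_mul_ge
    (hp.measurable.comp (measurable_splice_right s ω))
    (hq.measurable.comp (measurable_splice_right s ω))
    (fun x hx => hp.homogeneousAt_splice (hKs x hx) ω)
    (fun x hx => hq.homogeneousAt_splice (hKs x hx) ω) hdep)
  rw [← ENNReal.ofReal_prod_of_nonneg fun _ _ => by positivity]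
  exact ENNReal.ofReal_le_ofReal (pow_le_prod_div_add_pow hD (fun x hx => hs x (hKs x hx))
    (fun x _ => ha x) (hb K))

lemma avgWt_mul_avgWt_le (A B : Party n L M r) {s : Set AnyKey} {D : ℝ} (hD : 0 < D)
    (hs : ∀ x ∉ s, D ≤ 2 ^ n x.1) (τ : Fin r → M × M) (kA kB : Bool) (ω : GenTable n) :
    ENNReal.ofReal ((D / (D + r)) ^ r) *
      (A.avgWt Prod.fst s τ kA ω * B.avgWt Prod.snd s τ kB ω) ≤
    ∫⁻ ω', A.wt Prod.fst τ kA (splice s ω ω') * B.wt Prod.snd τ kB (splice s ω ω')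
      ∂(randomTable n) := by
  obtain ⟨ι, _, p, a, hA, hp, ha⟩ := exists_wt_eq_sum_sqMod A Prod.fst τ kA
  obtain ⟨κ, _, q, b, hB, hq, hb⟩ := exists_wt_eq_sum_sqMod B Prod.snd τ kB
  have hsplice := measurable_splice_right s ω
  simp only [Party.avgWt, hA, hB]
  exact mul_lintegral_sum_mul_lintegral_sum_le
    (fun u => (measurable_sqMod (hp u).measurable).comp hsplice)
    (fun v => (measurable_sqMod (hq v).measurable).comp hsplice)
    fun u v => (hp u).lintegral_sqMod_splice_mul_ge (hq v) hD hs
      (fun x => by simpa only [Finset.sum_singleton] using ha u {x}) (hb v) ω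

lemma sum_avgWt_mul_avgWt (A B : Party n L M r) (s : Set AnyKey) (ω : GenTable n) :
    ∑ τ, ∑ kA, ∑ kB, A.avgWt Prod.fst s τ kA ω * B.avgWt Prod.snd s τ kB ω = 1 := by
  have hmeas : ∀ τ kA kB, Measurable fun z : GenTable n × GenTable n =>
      A.wt Prod.fst τ kA (splice s ω z.1) * B.wt Prod.snd τ kB (splice s ω z.2) :=
    fun τ kA kB => ((measurable_wt_splice A ..).comp measurable_fst).mul
      ((measurable_wt_splice B ..).comp measurable_snd)
  have hprod : ∀ τ kA kB, A.avgWt Prod.fst s τ kA ω * B.avgWt Prod.snd s τ kB ω =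
      ∫⁻ z, A.wt Prod.fst τ kA (splice s ω z.1) * B.wt Prod.snd τ kB (splice s ω z.2)
        ∂((randomTable n).prod (randomTable n)) := fun τ kA kB =>
    (lintegral_prod_mul (measurable_wt_splice A ..).aemeasurable
      (measurable_wt_splice B ..).aemeasurable).symm
  simp only [hprod]
  simp_rw [← lintegral_finsetSum _ fun kB _ => hmeas _ _ kB]
  simp_rw [← lintegral_finsetSum _ fun kA _ => Finset.measurable_sum _ fun kB _ => hmeas _ kA kB]
  rw [← lintegral_finsetSum _ fun τ _ => Finset.measurable_sum _ fun kA _ =>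
    Finset.measurable_sum _ fun kB _ => hmeas τ kA kB]
  simp only [sum_wt_mul_wt, lintegral_const, measure_univ, mul_one]

open Classical in
/-- The more likely output of a party on transcript `τ`, given the states of the keys in `s`. -/
def Party.guess (P : Party n L M r) (own : M × M → M) (s : Set AnyKey) (ω : GenTable n)
    (τ : Fin r → M × M) : Bool :=
  decide (P.avgWt own s τ false ω ≤ P.avgWt own s τ true ω)

lemma guess_splice (P : Party n L M r) (own : M × M → M) (s : Set AnyKey) (ω ω' : GenTable n)
    (τ : Fin r → M × M) : P.guess own s (splice s ω ω') τ = P.guess own s ω τ := by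
  simp only [Party.guess, avgWt_splice]

lemma avgWt_le_guess (P : Party n L M r) (own : M × M → M) (s : Set AnyKey) (ω : GenTable n)
    (τ : Fin r → M × M) (k : Bool) :
    P.avgWt own s τ k ω ≤ P.avgWt own s τ (P.guess own s ω τ) ω := by
  unfold Party.guess
  by_cases h : P.avgWt own s τ false ω ≤ P.avgWt own s τ true ω
  · rw [decide_eq_true h]
    cases k
    exacts [h, le_rfl]
  · rw [decide_eq_false h]
    cases k
    exacts [le_rfl, (not_le.1 h).le]

lemma sum_avgWt_le_guess_add_not (P : Party n L M r) (own : M × M → M) (s : Set AnyKey)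
    (ω : GenTable n) (τ : Fin r → M × M) (k : Bool) :
    ∑ k', P.avgWt own s τ k' ω ≤
      P.avgWt own s τ (P.guess own s ω τ) ω + P.avgWt own s τ (!k) ω := by
  rw [Fintype.sum_bool]
  cases k
  · rw [add_comm]
    exact add_le_add_left (avgWt_le_guess ..) _
  · exact add_le_add_left (avgWt_le_guess ..) _

lemma measurable_guess (P : Party n L M r) (own : M × M → M) (s : Set AnyKey)
    (τ : Fin r → M × M) : Measurable fun ω => P.guess own s ω τ := by
  refine measurable_to_bool ?_
  have hpreimage : (fun ω => P.guess own s ω τ) ⁻¹' {true} =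
      {ω | P.avgWt own s τ false ω ≤ P.avgWt own s τ true ω} := by
    ext ω
    simp [Party.guess]
  rw [hpreimage]
  exact measurableSet_le (measurable_avgWt ..) (measurable_avgWt ..)

lemma le_lintegral_splice_guess_add_disagree (A B : Party n L M r) {s : Set AnyKey} {D : ℝ}
    (hD : 0 < D) (hs : ∀ x ∉ s, D ≤ 2 ^ n x.1) (ω : GenTable n) :
    ENNReal.ofReal ((D / (D + r)) ^ r) ≤
      ∫⁻ ω', ∑ τ, ∑ k, (A.wt Prod.fst τ k (splice s ω ω') *
          B.wt Prod.snd τ (B.guess Prod.snd s ω τ) (splice s ω ω') +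
        A.wt Prod.fst τ k (splice s ω ω') * B.wt Prod.snd τ (!k) (splice s ω ω'))
        ∂(randomTable n) := by
  have hmul : ∀ τ k k', Measurable fun ω' => A.wt Prod.fst τ k (splice s ω ω') *
      B.wt Prod.snd τ k' (splice s ω ω') := fun τ k k' =>
    (measurable_wt_splice A ..).mul (measurable_wt_splice B ..)
  have hadd : ∀ τ k, Measurable fun ω' => A.wt Prod.fst τ k (splice s ω ω') *
        B.wt Prod.snd τ (B.guess Prod.snd s ω τ) (splice s ω ω') +
      A.wt Prod.fst τ k (splice s ω ω') * B.wt Prod.snd τ (!k) (splice s ω ω') :=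
    fun τ k => (hmul τ k _).add (hmul τ k _)
  rw [lintegral_finsetSum _ fun τ _ => Finset.measurable_sum _ fun k _ => hadd τ k,
    ← mul_one (ENNReal.ofReal _), ← sum_avgWt_mul_avgWt A B s ω, Finset.mul_sum]
  refine Finset.sum_le_sum fun τ _ => ?_
  rw [lintegral_finsetSum _ fun k _ => hadd τ k, Finset.mul_sum]
  refine Finset.sum_le_sum fun k _ => ?_
  rw [lintegral_add_left (hmul τ k _), ← Finset.mul_sum]
  calc _ ≤ ENNReal.ofReal ((D / (D + r)) ^ r) * (A.avgWt Prod.fst s τ k ω *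
        (B.avgWt Prod.snd s τ (B.guess Prod.snd s ω τ) ω + B.avgWt Prod.snd s τ (!k) ω)) := by
        gcongr
        exact sum_avgWt_le_guess_add_not ..
    _ ≤ _ := by
        rw [mul_add, mul_add]
        exact add_le_add (avgWt_mul_avgWt_le A B hD hs ..) (avgWt_mul_avgWt_le A B hD hs ..)

lemma le_lintegral_guess_add_disagree (A B : Party n L M r) {s : Set AnyKey} {D : ℝ} (hD : 0 < D)
    (hs : ∀ x ∉ s, D ≤ 2 ^ n x.1) :
    ENNReal.ofReal ((D / (D + r)) ^ r) ≤
      ∫⁻ ω, ∑ τ, ∑ k, (A.wt Prod.fst τ k ω * B.wt Prod.snd τ (B.guess Prod.snd s ω τ) ω +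
        A.wt Prod.fst τ k ω * B.wt Prod.snd τ (!k) ω) ∂(randomTable n) := by
  have hguess : ∀ τ, Measurable fun ω => B.wt Prod.snd τ (B.guess Prod.snd s ω τ) ω := fun τ =>
    measurable_apply_of_bool (fun k => measurable_wt B _ τ k) (measurable_guess ..)
  have hadd : ∀ τ k, Measurable fun ω =>
      A.wt Prod.fst τ k ω * B.wt Prod.snd τ (B.guess Prod.snd s ω τ) ω +
        A.wt Prod.fst τ k ω * B.wt Prod.snd τ (!k) ω := fun τ k =>
    ((measurable_wt A ..).mul (hguess τ)).add ((measurable_wt A ..).mul (measurable_wt B ..))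
  rw [lintegral_splice _ s
    (Finset.measurable_sum _ fun τ _ => Finset.measurable_sum _ fun k _ => hadd τ k)]
  simp only [guess_splice]
  calc _ = ∫⁻ _ω : GenTable n, ENNReal.ofReal ((D / (D + r)) ^ r) ∂(randomTable n) := by simp
    _ ≤ _ := lintegral_mono fun ω => le_lintegral_splice_guess_add_disagree A B hD hs ω

end Weights

section Eve

variable {n : ℕ → ℕ} (C : Construction n)

/-- The dimension from which on a state counts as long at security parameter `l`. The choice keeps
the correlation lost over the at most `C.rounds l` queries of a party below `1 / 8`. -/
def Construction.longDim (l : ℕ) : ℝ := 8 * ((C.rounds l : ℝ) + 1) ^ 2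

/-- The keys whose states have low dimension. -/
def Construction.shortKeys (l : ℕ) : Set AnyKey := {x | (2 : ℝ) ^ n x.1 < C.longDim l}

/-- The guess of Bob's key from the transcript, given the states of the short keys. -/
def Construction.eveGuess (ω : GenTable n) (l : ℕ) (τ : C.Transcript l) : Bool :=
  (C.bob l).guess Prod.snd (C.shortKeys l) ω τ

/-- The unitary `|τ⟩|b⟩|c⟩ ↦ |τ⟩|b ⊕ g τ⟩|c⟩`. -/
def Construction.guessMatrix {l : ℕ} (g : C.Transcript l → Bool) :
    Matrix (C.EveReg (fun _ => 0) l) (C.EveReg (fun _ => 0) l) ℂ :=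
  fun i j => if i = (j.1, xor j.2.1 (g j.1), j.2.2) then 1 else 0

lemma Construction.guessMatrix_mem_unitaryGroup {l : ℕ} (g : C.Transcript l → Bool) :
    C.guessMatrix g ∈ Matrix.unitaryGroup (C.EveReg (fun _ => 0) l) ℂ := by
  rw [Matrix.mem_unitaryGroup_iff']
  ext ⟨τ, b, c⟩ ⟨τ', b', c'⟩
  simp only [mul_apply, star_apply, Construction.guessMatrix, apply_ite star, star_one, star_zero,
    one_apply, ite_mul, one_mul, zero_mul, Finset.sum_ite_eq', Finset.mem_univ, if_true,
    Prod.mk.injEq]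
  congr 1
  rw [eq_iff_iff]
  constructor
  · rintro ⟨rfl, hb, rfl⟩
    exact ⟨rfl, by simpa using hb, rfl⟩
  · rintro ⟨rfl, rfl, rfl⟩
    exact ⟨rfl, rfl, rfl⟩

/-- The eavesdropper that guesses Bob's key from the transcript and the states of the short keys. -/
def Construction.eve (ω : GenTable n) : C.Eavesdropper fun _ => 0 :=
  fun l => ⟨C.guessMatrix (C.eveGuess ω l), C.guessMatrix_mem_unitaryGroup _⟩

lemma Construction.eveProb_eve (ω : GenTable n) (l : ℕ) (τ : C.Transcript l) (k : Bool) :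
    C.eveProb (C.eve ω) l τ k = if k = C.eveGuess ω l τ then 1 else 0 := by
  simp only [Construction.eveProb, Construction.eve, Construction.guessMatrix, Prod.mk.injEq,
    Bool.false_xor]
  rw [Finset.sum_eq_single τ (fun σ _ hσ => by simp [hσ]) (by simp)]
  refine (Fintype.sum_unique (ι := Fin 1) _).trans ?_
  by_cases hk : k = C.eveGuess ω l τ <;> simp [hk]

lemma Construction.eveWinProb_eve (I : Generator n) (ω : GenTable n) (l : ℕ) :
    C.eveWinProb I (C.eve ω) l =
      ∑ τ, ∑ k, outcomeProb (C.alice l) (C.bob l) I τ k (C.eveGuess ω l τ) := by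
  simp only [Construction.eveWinProb, C.eveProb_eve, mul_ite, mul_one, mul_zero,
    Finset.sum_ite_eq', Finset.mem_univ, if_true]

lemma Construction.eveWinProb_eve_le_one (I : Generator n) (ω : GenTable n) (l : ℕ) :
    C.eveWinProb I (C.eve ω) l ≤ 1 := by
  rw [C.eveWinProb_eve, ← sum_outcomeProb (C.alice l) (C.bob l) I]
  refine Finset.sum_le_sum fun τ _ => Finset.sum_le_sum fun k _ => ?_
  exact Finset.single_le_sum (fun k' _ => outcomeProb_nonneg (C.alice l) (C.bob l) I τ k k')
    (Finset.mem_univ _)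

lemma Construction.agreeProb_nonneg (I : Generator n) (l : ℕ) : 0 ≤ C.agreeProb I l :=
  Finset.sum_nonneg fun _ _ => Finset.sum_nonneg fun _ _ => outcomeProb_nonneg ..

lemma Construction.one_sub_agreeProb (I : Generator n) (l : ℕ) :
    1 - C.agreeProb I l = ∑ τ, ∑ k, outcomeProb (C.alice l) (C.bob l) I τ k (!k) := by
  rw [← sum_outcomeProb (C.alice l) (C.bob l) I, Construction.agreeProb, ← Finset.sum_sub_distrib]
  refine Finset.sum_congr rfl fun τ _ => ?_
  simp only [Fintype.sum_bool, Bool.not_true, Bool.not_false]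
  ring

lemma Construction.measurable_eveGuess (l : ℕ) (τ : C.Transcript l) :
    Measurable fun ω => C.eveGuess ω l τ :=
  measurable_guess ..

lemma Construction.measurable_eveWinProb_eve (l : ℕ) :
    Measurable fun ω : GenTable n => C.eveWinProb ω.gen (C.eve ω) l := by
  have houtcome : ∀ τ k, Measurable fun ω : GenTable n =>
      outcomeProb (C.alice l) (C.bob l) ω.gen τ k (C.eveGuess ω l τ) := fun τ k =>
    measurable_apply_of_bool
      (f := fun k' (ω : GenTable n) => outcomeProb (C.alice l) (C.bob l) ω.gen τ k k')
      (measurable_outcomeProb _ _ τ k) (C.measurable_eveGuess l τ)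
  simp only [C.eveWinProb_eve]
  exact Finset.measurable_sum _ fun τ _ => Finset.measurable_sum _ fun k _ => houtcome τ k

lemma Construction.measurable_agreeProb (l : ℕ) :
    Measurable fun ω : GenTable n => C.agreeProb ω.gen l :=
  Finset.measurable_sum _ fun _ _ => Finset.measurable_sum _ fun _ _ => measurable_outcomeProb ..

/-- The probability that the eavesdropper finds Bob's key, plus the probability that the parties
disagree. -/
def Construction.winAddDisagree (ω : GenTable n) (l : ℕ) : ℝ :=
  C.eveWinProb ω.gen (C.eve ω) l + (1 - C.agreeProb ω.gen l)

lemma Construction.winAddDisagree_le_two (ω : GenTable n) (l : ℕ) : C.winAddDisagree ω l ≤ 2 := by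
  rw [winAddDisagree]
  linarith [C.eveWinProb_eve_le_one ω.gen ω l, C.agreeProb_nonneg ω.gen l]

lemma Construction.measurable_winAddDisagree (l : ℕ) :
    Measurable fun ω => C.winAddDisagree ω l :=
  (C.measurable_eveWinProb_eve l).add ((C.measurable_agreeProb l).const_sub 1)

lemma Construction.ofReal_winAddDisagree (ω : GenTable n) (l : ℕ) :
    ENNReal.ofReal (C.winAddDisagree ω l) = ∑ τ, ∑ k,
      ((C.alice l).wt Prod.fst τ k ω * (C.bob l).wt Prod.snd τ (C.eveGuess ω l τ) ω +
        (C.alice l).wt Prod.fst τ k ω * (C.bob l).wt Prod.snd τ (!k) ω) := by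
  simp only [winAddDisagree, C.eveWinProb_eve, C.one_sub_agreeProb, ← Finset.sum_add_distrib]
  rw [ofReal_sum_sum fun _ _ => add_nonneg (outcomeProb_nonneg ..) (outcomeProb_nonneg ..)]
  refine Finset.sum_congr rfl fun τ _ => Finset.sum_congr rfl fun k _ => ?_
  rw [ENNReal.ofReal_add (outcomeProb_nonneg ..) (outcomeProb_nonneg ..), ofReal_outcomeProb,
    ofReal_outcomeProb]

lemma Construction.longDim_ratio_pow_ge (l : ℕ) :
    7 / 8 ≤ (C.longDim l / (C.longDim l + C.rounds l)) ^ C.rounds l := by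
  set r := C.rounds l
  set D : ℝ := C.longDim l with hD_def
  have hD : 0 < D := by rw [hD_def, longDim]; positivity
  have hratio : D / (D + r) = 1 + -(r / (D + r)) := by field_simp; ring
  have hle_one : (r : ℝ) / (D + r) ≤ 1 := div_le_one_of_le₀ (by linarith) (by positivity)
  have hloss : (r : ℝ) * (r / (D + r)) ≤ 1 / 8 := by
    rw [mul_div_assoc', div_le_div_iff₀ (by positivity) (by norm_num), hD_def, longDim]
    nlinarith [(Nat.cast_nonneg r : (0 : ℝ) ≤ r)]
  calc (7 / 8 : ℝ) ≤ 1 + r * -(r / (D + r)) := by linarith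
    _ ≤ (1 + -(r / (D + r))) ^ r := one_add_mul_le_pow (by linarith) r
    _ = _ := by rw [hratio]

lemma Construction.lintegral_winAddDisagree_ge (l : ℕ) :
    ENNReal.ofReal (7 / 8) ≤ ∫⁻ ω, ENNReal.ofReal (C.winAddDisagree ω l) ∂(randomTable n) := by
  have hD : 0 < C.longDim l := by unfold Construction.longDim; positivity
  simp only [C.ofReal_winAddDisagree]
  exact (ENNReal.ofReal_le_ofReal (C.longDim_ratio_pow_ge l)).trans
    (le_lintegral_guess_add_disagree (C.alice l) (C.bob l) hD fun _ hx => not_lt.1 hx)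

lemma Construction.eve_update {x : AnyKey} {l : ℕ} (hx : C.longDim l ≤ 2 ^ n x.1)
    (ω : GenTable n) (φ : PureState (n x.1)) :
    C.eve (Function.update ω x φ) l = C.eve ω l := by
  have hlong : x ∉ C.shortKeys l := fun h => absurd h (not_lt.2 hx)
  have hguess : C.eveGuess (Function.update ω x φ) l = C.eveGuess ω l := by
    funext τ
    simp only [Construction.eveGuess, Party.guess, avgWt_update _ _ _ _ _ hlong]
  simp only [Construction.eve, hguess]

end Eve

section DensityMatrices

open scoped ComplexOrder

variable {X Y : Type} [Fintype X]

/-- Density matrices, the states of a finite-dimensional quantum system. -/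
structure IsDensityMatrix (ρ : Matrix X X ℂ) : Prop where
  posSemidef : ρ.PosSemidef
  trace_eq_one : trace ρ = 1

lemma isDensityMatrix_ketbra {v : X → ℂ} (hv : v ⬝ᵥ star v = 1) : IsDensityMatrix (ketbra v) :=
  ⟨posSemidef_ketbra v, (trace_vecMulVec v (star v)).trans hv⟩

namespace IsDensityMatrix

variable {ρ : Matrix X X ℂ} (hρ : IsDensityMatrix ρ)

include hρ

lemma mul_mul_conjTranspose [Fintype Y] [DecidableEq X] {O : Matrix Y X ℂ} (hO : Oᴴ * O = 1) :
    IsDensityMatrix (O * ρ * Oᴴ) where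
  posSemidef := hρ.posSemidef.mul_mul_conjTranspose_same O
  trace_eq_one := by
    rw [trace_mul_comm, ← Matrix.mul_assoc, hO, Matrix.one_mul, hρ.trace_eq_one]

lemma instrument_apply [Fintype Y] [DecidableEq X] (E : Instrument Unit X Y) :
    IsDensityMatrix (E.apply () ρ) where
  posSemidef := E.posSemidef_apply () hρ.posSemidef
  trace_eq_one := by
    rw [← hρ.trace_eq_one, ← E.sum_trace_apply ρ, Fintype.sum_unique]

lemma re_trace_instrument_apply_mem [Fintype Y] [DecidableEq X] {Ω : Type} [Fintype Ω]
    (E : Instrument Ω X Y) (o : Ω) : (trace (E.apply o ρ)).re ∈ Set.Icc (0 : ℝ) 1 := by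
  have hnonneg : ∀ o, 0 ≤ (trace (E.apply o ρ)).re := fun o =>
    (Complex.nonneg_iff.1 (E.posSemidef_apply o hρ.posSemidef).trace_nonneg).1
  have hsum : ∑ o, (trace (E.apply o ρ)).re = 1 := by
    rw [← Complex.re_sum, E.sum_trace_apply, hρ.trace_eq_one, Complex.one_re]
  exact ⟨hnonneg o, hsum ▸ Finset.single_le_sum (fun o _ => hnonneg o) (Finset.mem_univ o)⟩

end IsDensityMatrix

lemma exists_eq_mul_conjTranspose_of_posSemidef {Z : Type*} [Finite Z] {ρ : Matrix Z Z ℂ}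
    (hρ : ρ.PosSemidef) :
    ∃ (m : ℕ) (V : Matrix Z (Fin m) ℂ), ρ = V * Vᴴ := by
  obtain ⟨m, v, rfl⟩ := Matrix.posSemidef_iff_eq_sum_vecMulVec.1 hρ
  refine ⟨m, Matrix.of fun x i => v i x, ?_⟩
  ext x x'
  simp [Matrix.sum_apply, vecMulVec_apply, mul_apply]

/-- The probability of finding a register in state `ρ` in one of the basis states in `s`. -/
def queryMass {Z : Type*} (s : Finset Z) (ρ : Matrix Z Z ℂ) : ℝ := ∑ x ∈ s, (ρ x x).re

lemma queryMass_nonneg {Z : Type*} {ρ : Matrix Z Z ℂ} (hρ : ρ.PosSemidef) (s : Finset Z) :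
    0 ≤ queryMass s ρ :=
  Finset.sum_nonneg fun _ _ => (Complex.nonneg_iff.1 hρ.diag_nonneg).1

lemma IsDensityMatrix.sum_queryMass_le {ρ : Matrix X X ℂ} (hρ : IsDensityMatrix ρ)
    {κ : Type*} [Fintype κ] {s : κ → Finset X}
    (hs : Pairwise fun k k' => Disjoint (s k) (s k')) : ∑ k, queryMass (s k) ρ ≤ 1 := by
  classical
  have htotal : queryMass Finset.univ ρ = 1 := by
    rw [queryMass, ← Complex.re_sum, ← Complex.one_re, ← hρ.trace_eq_one]
    rfl
  simp only [← htotal, queryMass]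
  rw [← Finset.sum_biUnion fun k _ k' _ hkk' => hs hkk']
  exact Finset.sum_le_sum_of_subset_of_nonneg (Finset.subset_univ _) fun x _ _ =>
    (Complex.nonneg_iff.1 hρ.posSemidef.diag_nonneg).1

end DensityMatrices

section OracleQueries

open scoped ComplexOrder

variable {X Y : Type} {U : Type*} [Fintype X] [Fintype Y] [Fintype U]

attribute [local instance] Matrix.frobeniusNormedAddCommGroup

lemma frobenius_norm_sq (V : Matrix X U ℂ) : ‖V‖ ^ 2 = ∑ x, ∑ u, ‖V x u‖ ^ 2 := by
  rw [frobenius_norm_def, ← Real.sqrt_eq_rpow, Real.sq_sqrt (by positivity)]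
  simp only [Real.rpow_ofNat]

omit [Fintype X] in
lemma re_mul_conjTranspose_self_apply (V : Matrix X U ℂ) (x : X) :
    ((V * Vᴴ) x x).re = ∑ u, ‖V x u‖ ^ 2 := by
  rw [mul_apply, Complex.re_sum]
  refine Finset.sum_congr rfl fun u _ => ?_
  rw [conjTranspose_apply, RCLike.star_def, Complex.mul_conj']
  norm_cast

lemma frobenius_norm_sq_eq_trace (V : Matrix X U ℂ) : ‖V‖ ^ 2 = (trace (V * Vᴴ)).re := by
  rw [frobenius_norm_sq, trace, Complex.re_sum]
  exact Finset.sum_congr rfl fun x _ => (re_mul_conjTranspose_self_apply V x).symm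

variable [DecidableEq X]

lemma frobenius_norm_isometry_mul {O : Matrix Y X ℂ} (hO : Oᴴ * O = 1) (V : Matrix X U ℂ) :
    ‖O * V‖ = ‖V‖ := by
  rw [← sq_eq_sq₀ (norm_nonneg _) (norm_nonneg _), frobenius_norm_sq_eq_trace,
    frobenius_norm_sq_eq_trace, conjTranspose_mul, Matrix.mul_assoc, trace_mul_comm,
    Matrix.mul_assoc, Matrix.mul_assoc, hO, Matrix.mul_one]

lemma norm_diagonal_mul_sq (s : Finset X) (V : Matrix X U ℂ) :
    ‖diagonal (fun x => if x ∈ s then (1 : ℂ) else 0) * V‖ ^ 2 = queryMass s (V * Vᴴ) := by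
  simp only [frobenius_norm_sq, queryMass, re_mul_conjTranspose_self_apply, diagonal_mul]
  rw [← Finset.sum_filter_add_sum_filter_not Finset.univ (· ∈ s),
    Finset.sum_eq_zero (s := Finset.univ.filter (· ∉ s)), add_zero, Finset.filter_univ_mem]
  · exact Finset.sum_congr rfl fun x hx => by simp [hx]
  · exact fun x hx => by simp [(Finset.mem_filter.1 hx).2]

section Dilation

variable {Ω : Type} [Fintype Ω] (E : Instrument Ω X Y)

/-- The purification of the post-measurement state on outcome `o`: the Kraus index becomes part of
the environment. -/
def Instrument.dilate (o : Ω) (V : Matrix X U ℂ) : Matrix Y (Fin E.size × U) ℂ :=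
  fun y p => (E.K o p.1 * V) y p.2

lemma Instrument.dilate_mul_conjTranspose (o : Ω) (V : Matrix X U ℂ) :
    E.dilate o V * (E.dilate o V)ᴴ = E.apply o (V * Vᴴ) := by
  ext y y'
  rw [mul_apply, Fintype.sum_prod_type, Instrument.apply, Matrix.sum_apply]
  refine Finset.sum_congr rfl fun i _ => ?_
  rw [← Matrix.mul_assoc, Matrix.mul_assoc (E.K o i * V), ← conjTranspose_mul, mul_apply]
  rfl

omit [Fintype U] in
lemma Instrument.dilate_sub (o : Ω) (V V' : Matrix X U ℂ) :
    E.dilate o (V - V') = E.dilate o V - E.dilate o V' := by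
  ext y p
  simp [Instrument.dilate, Matrix.mul_sub]

lemma Instrument.norm_dilate_sq (o : Ω) (V : Matrix X U ℂ) :
    ‖E.dilate o V‖ ^ 2 = (trace (E.apply o (V * Vᴴ))).re := by
  rw [frobenius_norm_sq_eq_trace, E.dilate_mul_conjTranspose]

lemma Instrument.norm_dilate_le (o : Ω) (V : Matrix X U ℂ) : ‖E.dilate o V‖ ≤ ‖V‖ := by
  have hsum : ∑ o, ‖E.dilate o V‖ ^ 2 = ‖V‖ ^ 2 := by
    simp only [E.norm_dilate_sq, frobenius_norm_sq_eq_trace]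
    rw [← Complex.re_sum, E.sum_trace_apply]
  rw [← sq_le_sq₀ (norm_nonneg _) (norm_nonneg _), ← hsum]
  exact Finset.single_le_sum (f := fun o => ‖E.dilate o V‖ ^ 2) (fun _ _ => sq_nonneg _)
    (Finset.mem_univ o)

lemma Instrument.abs_re_trace_apply_sub_le (o : Ω) {V V' : Matrix X U ℂ} (hV : ‖V‖ ≤ 1)
    (hV' : ‖V'‖ ≤ 1) :
    |(trace (E.apply o (V * Vᴴ))).re - (trace (E.apply o (V' * V'ᴴ))).re| ≤ 2 * ‖V - V'‖ := by
  rw [← E.norm_dilate_sq, ← E.norm_dilate_sq, sq_sub_sq, abs_mul,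
    abs_of_nonneg (a := _ + _) (by positivity)]
  refine mul_le_mul ?_ ?_ (abs_nonneg _) zero_le_two
  · linarith [E.norm_dilate_le o V, E.norm_dilate_le o V']
  · refine (abs_norm_sub_norm_le _ _).trans ?_
    rw [← E.dilate_sub]
    exact E.norm_dilate_le o _

end Dilation

lemma norm_mul_sub_mul_le {O O' : Matrix Y X ℂ} (hO : Oᴴ * O = 1) (hO' : O'ᴴ * O' = 1)
    {s : Finset X} (hs : ∀ y, ∀ x ∉ s, O y x = O' y x) (V V' : Matrix X U ℂ) :
    ‖O * V - O' * V'‖ ≤ ‖V - V'‖ + 2 * √(queryMass s (V * Vᴴ)) := by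
  set P : Matrix X X ℂ := diagonal fun x => if x ∈ s then (1 : ℂ) else 0 with hP_def
  have hP : O - O' = O * P - O' * P := by
    ext y x
    by_cases hx : x ∈ s
    · simp [P, mul_diagonal, hx]
    · simp [P, mul_diagonal, hx, hs y x hx]
  have hsplit : O * V - O' * V' = O' * (V - V') + (O * (P * V) - O' * (P * V)) := by
    rw [← Matrix.mul_assoc, ← Matrix.mul_assoc, ← Matrix.sub_mul (O * P), ← hP, Matrix.sub_mul,
      Matrix.mul_sub]
    abel
  calc ‖O * V - O' * V'‖ ≤ ‖O' * (V - V')‖ + (‖O * (P * V)‖ + ‖O' * (P * V)‖) :=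
        hsplit ▸ (norm_add_le _ _).trans (add_le_add_right (norm_sub_le _ _) _)
    _ = ‖V - V'‖ + 2 * ‖P * V‖ := by
        rw [frobenius_norm_isometry_mul hO', frobenius_norm_isometry_mul hO,
          frobenius_norm_isometry_mul hO', two_mul]
    _ = _ := by rw [← norm_diagonal_mul_sq, ← hP_def, Real.sqrt_sq (norm_nonneg _)]

variable [DecidableEq Y]

/-- The states of an algorithm that alternates between queries `O` and arbitrary operations. -/
def queryState (step : ℕ → Instrument Unit Y X) (O : Matrix Y X ℂ) (ρ : Matrix X X ℂ) :
    ℕ → Matrix X X ℂ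
  | 0 => ρ
  | j + 1 => (step j).apply () (O * queryState step O ρ j * Oᴴ)

variable (step : ℕ → Instrument Unit Y X) (out : Instrument Bool X Unit) {ρ : Matrix X X ℂ}

lemma IsDensityMatrix.queryState {O : Matrix Y X ℂ} (hO : Oᴴ * O = 1) (hρ : IsDensityMatrix ρ) :
    ∀ j, IsDensityMatrix (queryState step O ρ j)
  | 0 => hρ
  | j + 1 => ((hρ.queryState hO j).mul_mul_conjTranspose hO).instrument_apply (step j)

omit [DecidableEq X] in
lemma queryState_succ_eq_dilate {O : Matrix Y X ℂ} {j : ℕ} {V : Matrix X U ℂ}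
    (hV : queryState step O ρ j = V * Vᴴ) :
    queryState step O ρ (j + 1) =
      (step j).dilate () (O * V) * ((step j).dilate () (O * V))ᴴ := by
  rw [queryState, hV, Instrument.dilate_mul_conjTranspose, conjTranspose_mul]
  simp only [Matrix.mul_assoc]

section TwoOracles

variable {O O' : Matrix Y X ℂ} (hO : Oᴴ * O = 1) (hO' : O'ᴴ * O' = 1) {s : Finset X}
  (hs : ∀ y, ∀ x ∉ s, O y x = O' y x)

include hO hO' hs

lemma exists_purifications_queryState (hρ : ρ.PosSemidef) (j : ℕ) :
    ∃ (U : Type) (_ : Fintype U) (V V' : Matrix X U ℂ),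
      queryState step O ρ j = V * Vᴴ ∧ queryState step O' ρ j = V' * V'ᴴ ∧
      ‖V - V'‖ ≤ ∑ i ∈ Finset.range j, 2 * √(queryMass s (queryState step O ρ i)) := by
  induction j with
  | zero =>
    obtain ⟨m, V, rfl⟩ := exists_eq_mul_conjTranspose_of_posSemidef hρ
    exact ⟨Fin m, inferInstance, V, V, rfl, rfl, by simp⟩
  | succ j ih =>
    obtain ⟨U, hU, V, V', hV, hV', hclose⟩ := ih
    refine ⟨_, inferInstance, _, _, queryState_succ_eq_dilate step hV,
      queryState_succ_eq_dilate step hV', ?_⟩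
    rw [← Instrument.dilate_sub, Finset.sum_range_succ, hV]
    exact ((step j).norm_dilate_le () _).trans <|
      (norm_mul_sub_mul_le hO hO' hs V V').trans (add_le_add_left hclose _)

lemma abs_accept_sub_le (hρ : IsDensityMatrix ρ) (q : ℕ) :
    |(trace (out.apply true (queryState step O ρ q))).re -
      (trace (out.apply true (queryState step O' ρ q))).re| ≤
      4 * ∑ i ∈ Finset.range q, √(queryMass s (queryState step O ρ i)) := by
  obtain ⟨U, hU, V, V', hV, hV', hclose⟩ :=
    exists_purifications_queryState step hO hO' hs hρ.posSemidef q
  have norm_le_one : ∀ W : Matrix X U ℂ, IsDensityMatrix (W * Wᴴ) → ‖W‖ ≤ 1 := fun W hW => by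
    rw [← sq_le_one_iff₀ (norm_nonneg _), frobenius_norm_sq_eq_trace, hW.trace_eq_one,
      Complex.one_re]
  have hdist := out.abs_re_trace_apply_sub_le true
    (norm_le_one V (hV ▸ hρ.queryState step hO q))
    (norm_le_one V' (hV' ▸ hρ.queryState step hO' q))
  rw [← Finset.mul_sum] at hclose
  rw [hV, hV']
  linarith

end TwoOracles

/-- The factor `√(card κ)` comes from Cauchy–Schwarz: the query sets share a total mass of at most
one in each of the `q` queries. -/
lemma sum_abs_accept_sub_le {κ : Type*} [Fintype κ] {O : Matrix Y X ℂ} {O' : κ → Matrix Y X ℂ}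
    (hO : Oᴴ * O = 1) (hO' : ∀ k, (O' k)ᴴ * O' k = 1) {s : κ → Finset X}
    (hs : ∀ k, ∀ y, ∀ x ∉ s k, O y x = O' k y x)
    (hdisj : Pairwise fun k k' => Disjoint (s k) (s k')) (hρ : IsDensityMatrix ρ) (q : ℕ) :
    ∑ k, |(trace (out.apply true (queryState step O ρ q))).re -
      (trace (out.apply true (queryState step (O' k) ρ q))).re| ≤
      4 * (q * √(Fintype.card κ)) := by
  have hmass : ∀ i ∈ Finset.range q,
      ∑ k, √(queryMass (s k) (queryState step O ρ i)) ≤ √(Fintype.card κ) := by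
    intro i _
    have hdens := hρ.queryState step hO i
    refine Real.le_sqrt_of_sq_le (sq_sum_le_card_mul_sum_sq.trans ?_)
    simp only [Real.sq_sqrt (queryMass_nonneg hdens.posSemidef _), Finset.card_univ]
    exact mul_le_of_le_one_right (Nat.cast_nonneg _) (hdens.sum_queryMass_le hdisj)
  calc _ ≤ ∑ k, 4 * ∑ i ∈ Finset.range q, √(queryMass (s k) (queryState step O ρ i)) :=
        Finset.sum_le_sum fun k _ => abs_accept_sub_le step out hO (hO' k) (hs k) hρ q
    _ = 4 * ∑ i ∈ Finset.range q, ∑ k, √(queryMass (s k) (queryState step O ρ i)) := by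
        rw [← Finset.mul_sum, Finset.sum_comm]
    _ ≤ 4 * (q * √(Fintype.card κ)) := by
        refine mul_le_mul_of_nonneg_left ?_ zero_le_four
        simpa using Finset.sum_le_card_nsmul _ _ _ hmass

end OracleQueries

section Distinguishers

variable {n : ℕ → ℕ} {C : Construction n} {w : ℕ → ℕ}

lemma redOracle_isometry (I : Generator n) (E : C.Eavesdropper w) (L N : ℕ) :
    (redOracle C I E L N)ᴴ * redOracle C I E L N = 1 := by
  have conjTranspose_mul_eve : ∀ l, (E l : Matrix (C.EveReg w l) (C.EveReg w l) ℂ)ᴴ *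
      (E l : Matrix (C.EveReg w l) (C.EveReg w l) ℂ) = 1 :=
    fun l => Matrix.mem_unitaryGroup_iff'.1 (E l).2
  have eve_mul_conjTranspose : ∀ l, (E l : Matrix (C.EveReg w l) (C.EveReg w l) ℂ) *
      (E l : Matrix (C.EveReg w l) (C.EveReg w l) ℂ)ᴴ = 1 :=
    fun l => Matrix.mem_unitaryGroup_iff.1 (E l).2
  have blocks_one : (blockDiagonal' fun l : Fin (N + 1) =>
      (1 : Matrix (C.EveReg w l) (C.EveReg w l) ℂ)) = 1 := blockDiagonal'_one
  simp only [redOracle, fromBlocks_conjTranspose, fromBlocks_multiply, conjTranspose_zero,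
    Matrix.mul_zero, Matrix.zero_mul, add_zero, zero_add, genIsometry_isometry,
    blockDiagonal'_conjTranspose, conjTranspose_conjTranspose, ← blockDiagonal'_mul,
    conjTranspose_mul_eve, eve_mul_conjTranspose, blocks_one, fromBlocks_one]

lemma PureState.dotProduct_star {m : ℕ} (φ : PureState m) :
    (φ : EuclideanSpace ℂ (BitString m)).ofLp ⬝ᵥ
      star (φ : EuclideanSpace ℂ (BitString m)).ofLp = 1 := by
  rw [← EuclideanSpace.inner_eq_star_dotProduct, inner_self_eq_norm_sq_to_K,
    norm_eq_of_mem_sphere]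
  norm_num

lemma prod_dotProduct_star_prod {R β : Type*} [CommSemiring R] [StarRing R] [Fintype β]
    {v : β → R} (hv : v ⬝ᵥ star v = 1) (t : ℕ) :
    (fun y : Fin t → β => ∏ i, v (y i)) ⬝ᵥ star (fun y => ∏ i, v (y i)) = 1 := by
  classical
  simp only [dotProduct, Pi.star_apply, star_prod, ← Finset.prod_mul_distrib] at hv ⊢
  rw [← Fintype.prod_sum fun (_ : Fin t) b => v b * star (v b), hv, Finset.prod_const_one]

namespace Distinguisher

variable (S : Distinguisher C w)

/-- The oracle, acting on work and query registers. -/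
def oracle (I : Generator n) (E : C.Eavesdropper w) (l : ℕ) :
    Matrix (Fin (S.work l) × RedAnswer C w (S.keyLen l) (S.eveLen l))
      (Fin (S.work l) × RedQuery C w (S.keyLen l) (S.eveLen l)) ℂ :=
  (1 : Matrix (Fin (S.work l)) (Fin (S.work l)) ℂ) ⊗ₖ redOracle C I E (S.keyLen l) (S.eveLen l)

lemma oracle_isometry (I : Generator n) (E : C.Eavesdropper w) (l : ℕ) :
    (S.oracle I E l)ᴴ * S.oracle I E l = 1 := by
  rw [oracle, conjTranspose_kronecker, ← mul_kronecker_mul, redOracle_isometry,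
    conjTranspose_one, Matrix.one_mul, one_kronecker_one]

/-- The state in which the distinguisher starts on input `φ`. -/
def initial (l : ℕ) (φ : PureState (n l)) :
    Matrix (Fin (S.work l) × RedQuery C w (S.keyLen l) (S.eveLen l))
      (Fin (S.work l) × RedQuery C w (S.keyLen l) (S.eveLen l)) ℂ :=
  (S.prepare l).apply () (ketbra fun y => ∏ i, (φ : EuclideanSpace ℂ (BitString (n l))) (y i))

lemma isDensityMatrix_initial (l : ℕ) (φ : PureState (n l)) : IsDensityMatrix (S.initial l φ) :=
  (isDensityMatrix_ketbra (prod_dotProduct_star_prod φ.dotProduct_star _)).instrument_apply _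

lemma state_eq_queryState (I : Generator n) (E : C.Eavesdropper w) (l : ℕ) (φ : PureState (n l))
    (j : ℕ) :
    S.state I E l φ j = queryState (S.step l) (S.oracle I E l) (S.initial l φ) j := by
  induction j with
  | zero => rfl
  | succ j ih => rw [state, ih]; rfl

lemma acceptProb_eq (I : Generator n) (E : C.Eavesdropper w) (l : ℕ) (φ : PureState (n l)) :
    S.acceptProb I E l φ = (trace ((S.out l).apply true
      (queryState (S.step l) (S.oracle I E l) (S.initial l φ) (S.queries l)))).re := by
  rw [acceptProb, state_eq_queryState]

lemma acceptProb_mem (I : Generator n) (E : C.Eavesdropper w) (l : ℕ) (φ : PureState (n l)) :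
    S.acceptProb I E l φ ∈ Set.Icc (0 : ℝ) 1 := by
  rw [acceptProb_eq]
  exact ((S.isDensityMatrix_initial l φ).queryState (S.step l) (S.oracle_isometry I E l)
    (S.queries l)).re_trace_instrument_apply_mem _ _

lemma acceptProb_congr (I : Generator n) {E E' : C.Eavesdropper w} {l : ℕ}
    (h : ∀ l' ≤ S.eveLen l, E l' = E' l') (φ : PureState (n l)) :
    S.acceptProb I E l φ = S.acceptProb I E' l φ := by
  have hE : ∀ l' : Fin (S.eveLen l + 1), E l' = E' l' :=
    fun l' => h l' (Nat.lt_succ_iff.1 l'.2)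
  simp only [acceptProb_eq, oracle, redOracle, hE]

open scoped Classical in
/-- The basis states of the work and query registers in which the generator is queried on `x`. -/
def queriesTo (l : ℕ) (x : AnyKey) :
    Finset (Fin (S.work l) × RedQuery C w (S.keyLen l) (S.eveLen l)) :=
  Finset.univ.filter fun p =>
    Sum.elim (fun y : Key (S.keyLen l) => y.toAny = x) (fun _ => False) p.2

lemma disjoint_queriesTo (l : ℕ) {x x' : AnyKey} (h : x ≠ x') :
    Disjoint (S.queriesTo l x) (S.queriesTo l x') := by
  rw [Finset.disjoint_left]
  rintro ⟨a, y | y⟩ hx hx'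
  · simp only [queriesTo, Finset.mem_filter, Sum.elim_inl] at hx hx'
    exact h (hx.2.symm.trans hx'.2)
  · simp [queriesTo] at hx

lemma oracle_update_apply (ω : GenTable n) (E : C.Eavesdropper w) (l : ℕ) (x : AnyKey)
    (ψ : PureState (n x.1)) (y) {p} (hp : p ∉ S.queriesTo l x) :
    S.oracle ω.gen E l y p = S.oracle (GenTable.gen (Function.update ω x ψ)) E l y p := by
  obtain ⟨a, q | q⟩ := p <;> obtain ⟨b, z | z⟩ := y <;> try rfl
  simp only [oracle, kroneckerMap_apply, redOracle, fromBlocks_apply₁₁, genIsometry]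
  congr 1
  split_ifs with hz
  · have hne : q.toAny ≠ x := by simpa [queriesTo] using hp
    subst hz
    have hstate : Function.update ω x ψ z.1.toAny = ω z.1.toAny := Function.update_of_ne hne _ _
    simp only [GenTable.gen]
    exact congrArg (fun v : PureState _ => (v : EuclideanSpace ℂ _) z.2) hstate.symm
  · rfl

lemma sum_abs_acceptProb_update_sub_le (ω : GenTable n) (E : C.Eavesdropper w) (l : ℕ)
    (φ : PureState (n l)) (ψ : BitString l → PureState (n l)) :
    ∑ k, |S.acceptProb ω.gen E l φ -
      S.acceptProb (GenTable.gen (Function.update ω ⟨l, k⟩ (ψ k))) E l φ| ≤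
      4 * (S.queries l * √(2 ^ l)) := by
  have hcard : Fintype.card (BitString l) = 2 ^ l := by simp
  have hdisj : Pairwise fun k k' : BitString l =>
      Disjoint (S.queriesTo l ⟨l, k⟩) (S.queriesTo l ⟨l, k'⟩) :=
    fun k k' hk => S.disjoint_queriesTo l (by simpa using hk)
  simp only [acceptProb_eq]
  simpa only [hcard, Nat.cast_pow, Nat.cast_ofNat] using
    sum_abs_accept_sub_le (S.step l) (S.out l) (S.oracle_isometry ω.gen E l)
      (fun k => S.oracle_isometry _ E l)
      (fun k y p hp => S.oracle_update_apply ω E l ⟨l, k⟩ (ψ k) y hp) hdisj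
      (S.isDensityMatrix_initial l φ) (S.queries l)

end Distinguisher
end Distinguishers

section Measurability

variable {α X Y Z : Type*} [MeasurableSpace α]

/-- A random matrix with measurable entries. -/
def MeasurableEntries (A : α → Matrix X Y ℂ) : Prop := ∀ i j, Measurable fun a => A a i j

namespace MeasurableEntries

lemma const (A : Matrix X Y ℂ) : MeasurableEntries fun _ : α => A := fun _ _ => measurable_const

lemma mul [Fintype Y] {A : α → Matrix X Y ℂ} {B : α → Matrix Y Z ℂ} (hA : MeasurableEntries A)
    (hB : MeasurableEntries B) : MeasurableEntries fun a => A a * B a := by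
  intro i j
  simp only [mul_apply]
  exact Finset.measurable_sum _ fun k _ => (hA i k).mul (hB k j)

lemma conjTranspose {A : α → Matrix X Y ℂ} (hA : MeasurableEntries A) :
    MeasurableEntries fun a => (A a)ᴴ := fun i j => continuous_star.measurable.comp (hA j i)

lemma sum {ι : Type*} [Fintype ι] {A : ι → α → Matrix X Y ℂ} (hA : ∀ i, MeasurableEntries (A i)) :
    MeasurableEntries fun a => ∑ i, A i a := by
  intro i j
  simp only [Matrix.sum_apply]
  exact Finset.measurable_sum _ fun k _ => hA k i j

lemma trace [Fintype X] {A : α → Matrix X X ℂ} (hA : MeasurableEntries A) :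
    Measurable fun a => Matrix.trace (A a) :=
  Finset.measurable_sum _ fun i _ => hA i i

lemma const_kronecker {X' Y' : Type*} (B : Matrix X' Y' ℂ) {A : α → Matrix X Y ℂ}
    (hA : MeasurableEntries A) : MeasurableEntries fun a => B ⊗ₖ A a :=
  fun i j => measurable_const.mul (hA i.2 j.2)

lemma fromBlocks {X' Y' : Type*} {A : α → Matrix X Y ℂ} {B : α → Matrix X' Y' ℂ}
    (hA : MeasurableEntries A) (hB : MeasurableEntries B) :
    MeasurableEntries fun a => Matrix.fromBlocks (A a) 0 0 (B a) := by
  rintro (i | i) (j | j)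
  · exact hA i j
  · exact measurable_const
  · exact measurable_const
  · exact hB i j

lemma blockDiagonal' {ι : Type*} [DecidableEq ι] {X Y : ι → Type*}
    {A : ∀ i, α → Matrix (X i) (Y i) ℂ} (hA : ∀ i, MeasurableEntries (A i)) :
    MeasurableEntries fun a => Matrix.blockDiagonal' fun i => A i a := by
  rintro ⟨i, i'⟩ ⟨j, j'⟩
  by_cases h : i = j
  · subst h
    simp only [blockDiagonal'_apply_eq]
    exact hA i i' j'
  · simp only [blockDiagonal'_apply_ne _ _ _ h]
    exact measurable_const

lemma instrument_apply {Ω X Y : Type} [Fintype Ω] [Fintype X] [DecidableEq X]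
    [Fintype Y] (E : Instrument Ω X Y) (o : Ω) {ρ : α → Matrix X X ℂ} (hρ : MeasurableEntries ρ) :
    MeasurableEntries fun a => E.apply o (ρ a) :=
  .sum fun _ => ((MeasurableEntries.const _).mul hρ).mul (.const _)

lemma queryState {X Y : Type} [Fintype X] [Fintype Y]
    [DecidableEq Y] (step : ℕ → Instrument Unit Y X) {O : α → Matrix Y X ℂ} {ρ : α → Matrix X X ℂ}
    (hO : MeasurableEntries O) (hρ : MeasurableEntries ρ) :
    ∀ j, MeasurableEntries fun a => QCCC.queryState step (O a) (ρ a) j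
  | 0 => hρ
  | j + 1 => .instrument_apply _ _ ((hO.mul (queryState step hO hρ j)).mul hO.conjTranspose)

end MeasurableEntries

variable {n : ℕ → ℕ} (C : Construction n)

lemma Construction.measurableEntries_eve (l : ℕ) :
    MeasurableEntries fun ω : GenTable n =>
      (C.eve ω l : Matrix (C.EveReg (fun _ => 0) l) (C.EveReg (fun _ => 0) l) ℂ) := by
  intro i j
  have hentry : Measurable fun b : Bool =>
      if i = (j.1, xor j.2.1 b, j.2.2) then (1 : ℂ) else 0 := measurable_of_countable _
  exact hentry.comp (C.measurable_eveGuess l j.1)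

lemma measurableEntries_genIsometry (L : ℕ) :
    MeasurableEntries fun ω : GenTable n => genIsometry ω.gen L := by
  intro s x
  simp only [genIsometry]
  split_ifs
  · simp only [GenTable.gen]
    fun_prop
  · exact measurable_const

lemma Construction.measurableEntries_redOracle (L N : ℕ) :
    MeasurableEntries fun ω : GenTable n => redOracle C ω.gen (C.eve ω) L N :=
  (measurableEntries_genIsometry L).fromBlocks <| .fromBlocks
    (.blockDiagonal' fun l => C.measurableEntries_eve l)
    (.blockDiagonal' fun l => (C.measurableEntries_eve l).conjTranspose)

variable {C}

lemma Distinguisher.measurableEntries_initial {w : ℕ → ℕ} (S : Distinguisher C w) (l : ℕ) :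
    MeasurableEntries (S.initial l) := by
  refine .instrument_apply _ _ fun y y' => ?_
  simp only [ketbra, vecMulVec_apply, Pi.star_apply]
  fun_prop

lemma Distinguisher.measurable_acceptProb (S : Distinguisher C fun _ => 0) (l : ℕ) :
    Measurable fun p : GenTable n × PureState (n l) =>
      S.acceptProb p.1.gen (C.eve p.1) l p.2 := by
  simp only [acceptProb_eq]
  refine Complex.measurable_re.comp (MeasurableEntries.trace
    (.instrument_apply _ _ (.queryState _ ?_ ?_ _)))
  · exact .const_kronecker _ fun i j =>
      (C.measurableEntries_redOracle _ _ i j).comp measurable_fst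
  · exact fun i j => (S.measurableEntries_initial l i j).comp measurable_snd

end Measurability

section SecondMoment

variable {n : ℕ → ℕ} {l : ℕ}

/-- The average of `f` over a Haar random state. -/
def haarAvg (f : GenTable n × PureState (n l) → ℝ) (ω : GenTable n) : ℝ :=
  ∫ φ, f (ω, φ) ∂(haarState (n l))

/-- The average of `f` over the states that the table assigns to the keys of length `l`. -/
def tableAvg (f : GenTable n × PureState (n l) → ℝ) (ω : GenTable n) : ℝ :=
  (∑ k : BitString l, f (ω, ω ⟨l, k⟩)) / 2 ^ l

/-- The advantage of `f`, without absolute value, in telling the states of the table from Haar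
random states. -/
def tableBias (f : GenTable n × PureState (n l) → ℝ) (ω : GenTable n) : ℝ :=
  tableAvg f ω - haarAvg f ω

/-- The deviation of `f` from its Haar average. -/
def deviation (f : GenTable n × PureState (n l) → ℝ) (p : GenTable n × PureState (n l)) : ℝ :=
  f p - haarAvg f p.1

/-- Reprogramming the table at a uniformly random key of length `l` changes `f` by at most `ε` on
average. -/
def Insensitive (f : GenTable n × PureState (n l) → ℝ) (ε : ℝ) : Prop :=
  ∀ (ω : GenTable n) (φ ψ : PureState (n l)),
    ∑ k : BitString l, |f (Function.update ω ⟨l, k⟩ ψ, φ) - f (ω, φ)| ≤ 2 ^ l * ε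

variable {f : GenTable n × PureState (n l) → ℝ}

lemma measurable_haarAvg (hf : Measurable f) : Measurable (haarAvg f) :=
  (hf.stronglyMeasurable.integral_prod_right' (ν := haarState (n l))).measurable

lemma measurable_deviation (hf : Measurable f) : Measurable (deviation f) :=
  hf.sub ((measurable_haarAvg hf).comp measurable_fst)

lemma measurable_tableBias (hf : Measurable f) : Measurable (tableBias f) :=
  ((Finset.measurable_sum _ fun _ _ => hf.comp
    (measurable_id.prodMk (measurable_pi_apply _))).div_const _).sub (measurable_haarAvg hf)

lemma tableAvg_mem (hf01 : ∀ p, f p ∈ Set.Icc (0 : ℝ) 1) (ω : GenTable n) :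
    tableAvg f ω ∈ Set.Icc (0 : ℝ) 1 := by
  refine ⟨div_nonneg (Finset.sum_nonneg fun k _ => (hf01 _).1) (by positivity), ?_⟩
  rw [tableAvg, div_le_one (by positivity)]
  exact (Finset.sum_le_sum fun k _ => (hf01 _).2).trans (by simp)

section Bounded

variable (hf : Measurable f) (hf01 : ∀ p, f p ∈ Set.Icc (0 : ℝ) 1)

include hf hf01

lemma integrable_section (ω : GenTable n) :
    Integrable (fun φ => f (ω, φ)) (haarState (n l)) :=
  Integrable.of_bound (hf.comp measurable_prodMk_left).aestronglyMeasurable 1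
    (ae_of_all _ fun φ => by rw [Real.norm_of_nonneg (hf01 _).1]; exact (hf01 _).2)

lemma haarAvg_mem (ω : GenTable n) : haarAvg f ω ∈ Set.Icc (0 : ℝ) 1 := by
  refine ⟨integral_nonneg fun φ => (hf01 _).1, ?_⟩
  exact (integral_mono (integrable_section hf hf01 ω) (integrable_const 1)
    fun φ => (hf01 _).2).trans (by simp)

lemma abs_tableBias_le (ω : GenTable n) : |tableBias f ω| ≤ 1 :=
  Real.dist_le_of_mem_Icc_01 (tableAvg_mem hf01 ω) (haarAvg_mem hf hf01 ω)

lemma abs_deviation_le (p : GenTable n × PureState (n l)) : |deviation f p| ≤ 1 :=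
  Real.dist_le_of_mem_Icc_01 (hf01 p) (haarAvg_mem hf hf01 p.1)

lemma integral_deviation (ω : GenTable n) :
    ∫ φ, deviation f (ω, φ) ∂(haarState (n l)) = 0 := by
  simp only [deviation]
  rw [integral_sub (integrable_section hf hf01 ω) (integrable_const _), integral_const]
  simp [haarAvg]

section Resampling

variable {ε : ℝ} (hε : Insensitive f ε)

include hε

lemma sum_abs_haarAvg_update_sub_le (ω : GenTable n) (ψ : PureState (n l)) :
    ∑ k : BitString l, |haarAvg f (Function.update ω ⟨l, k⟩ ψ) - haarAvg f ω| ≤ 2 ^ l * ε := by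
  have hint : ∀ k : BitString l, Integrable
      (fun φ => |f (Function.update ω ⟨l, k⟩ ψ, φ) - f (ω, φ)|) (haarState (n l)) := fun k =>
    ((integrable_section hf hf01 _).sub (integrable_section hf hf01 _)).abs
  calc ∑ k : BitString l, |haarAvg f (Function.update ω ⟨l, k⟩ ψ) - haarAvg f ω|
      ≤ ∑ k : BitString l, ∫ φ, |f (Function.update ω ⟨l, k⟩ ψ, φ) - f (ω, φ)|
          ∂(haarState (n l)) := Finset.sum_le_sum fun k _ => by
        rw [haarAvg, haarAvg, ← integral_sub (integrable_section hf hf01 _)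
          (integrable_section hf hf01 _)]
        exact abs_integral_le_integral_abs
    _ = ∫ φ, ∑ k : BitString l, |f (Function.update ω ⟨l, k⟩ ψ, φ) - f (ω, φ)|
          ∂(haarState (n l)) := (integral_finsetSum _ fun k _ => hint k).symm
    _ ≤ ∫ _, 2 ^ l * ε ∂(haarState (n l)) :=
        integral_mono (integrable_finsetSum _ fun k _ => hint k) (integrable_const _)
          fun φ => hε ω φ ψ
    _ = 2 ^ l * ε := by simp

omit hf in
lemma sum_abs_tableAvg_update_sub_le (ω : GenTable n) (ψ : PureState (n l)) :
    ∑ k : BitString l, |tableAvg f (Function.update ω ⟨l, k⟩ ψ) - tableAvg f ω| ≤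
      1 + 2 ^ l * ε := by
  set up : BitString l → GenTable n := fun k => Function.update ω ⟨l, k⟩ ψ
  have hterm : ∀ k j : BitString l, |f (up k, up k ⟨l, j⟩) - f (ω, ω ⟨l, j⟩)| ≤
      (if j = k then 1 else 0) + |f (up k, ω ⟨l, j⟩) - f (ω, ω ⟨l, j⟩)| := by
    intro k j
    split_ifs with hj
    · exact (Real.dist_le_of_mem_Icc_01 (hf01 _) (hf01 _)).trans
        (le_add_of_nonneg_right (abs_nonneg _))
    · have hstate : up k ⟨l, j⟩ = ω ⟨l, j⟩ := Function.update_of_ne (by simpa using hj) _ _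
      rw [hstate, zero_add]
  have hcard : (Fintype.card (BitString l) : ℝ) = 2 ^ l := by simp
  calc ∑ k, |tableAvg f (up k) - tableAvg f ω|
      ≤ ∑ k, (∑ j : BitString l, ((if j = k then 1 else 0) +
          |f (up k, ω ⟨l, j⟩) - f (ω, ω ⟨l, j⟩)|)) / 2 ^ l := Finset.sum_le_sum fun k _ => by
        rw [tableAvg, tableAvg, ← sub_div, ← Finset.sum_sub_distrib, abs_div,
          abs_of_pos (a := (2 : ℝ) ^ l) (by positivity)]
        gcongr
        exact (Finset.abs_sum_le_sum_abs _ _).trans (Finset.sum_le_sum fun j _ => hterm k j)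
    _ = (2 ^ l + ∑ j : BitString l, ∑ k, |f (up k, ω ⟨l, j⟩) - f (ω, ω ⟨l, j⟩)|) / 2 ^ l := by
        simp only [← Finset.sum_div, Finset.sum_add_distrib, Finset.sum_ite_eq',
          Finset.mem_univ, if_true, Finset.sum_const, Finset.card_univ, hcard, nsmul_eq_mul,
          mul_one]
        rw [Finset.sum_comm]
    _ ≤ (2 ^ l + ∑ _j : BitString l, 2 ^ l * ε) / 2 ^ l := by
        gcongr with j
        exact hε ω (ω ⟨l, j⟩) ψ
    _ = 1 + 2 ^ l * ε := by
        rw [Finset.sum_const, Finset.card_univ, nsmul_eq_mul, hcard]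
        field_simp

lemma sum_abs_tableBias_update_sub_le (ω : GenTable n) (ψ : PureState (n l)) :
    ∑ k : BitString l, |tableBias f (Function.update ω ⟨l, k⟩ ψ) - tableBias f ω| ≤
      1 + 2 ^ l * (2 * ε) := by
  calc _ ≤ ∑ k : BitString l, (|tableAvg f (Function.update ω ⟨l, k⟩ ψ) - tableAvg f ω| +
        |haarAvg f (Function.update ω ⟨l, k⟩ ψ) - haarAvg f ω|) :=
        Finset.sum_le_sum fun k _ => by
          rw [tableBias, tableBias, sub_sub_sub_comm]
          exact abs_sub _ _
    _ ≤ (1 + 2 ^ l * ε) + 2 ^ l * ε := by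
        rw [Finset.sum_add_distrib]
        exact add_le_add (sum_abs_tableAvg_update_sub_le hf01 hε ω ψ)
          (sum_abs_haarAvg_update_sub_le hf hf01 hε ω ψ)
    _ = 1 + 2 ^ l * (2 * ε) := by ring

lemma sum_abs_deviation_update_sub_le (ω : GenTable n) (φ ψ : PureState (n l)) :
    ∑ k : BitString l, |deviation f (Function.update ω ⟨l, k⟩ ψ, φ) - deviation f (ω, φ)| ≤
      2 ^ l * (2 * ε) := by
  calc _ ≤ ∑ k : BitString l, (|f (Function.update ω ⟨l, k⟩ ψ, φ) - f (ω, φ)| +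
        |haarAvg f (Function.update ω ⟨l, k⟩ ψ) - haarAvg f ω|) :=
        Finset.sum_le_sum fun k _ => by
          rw [deviation, deviation, sub_sub_sub_comm]
          exact abs_sub _ _
    _ ≤ 2 ^ l * ε + 2 ^ l * ε := by
        rw [Finset.sum_add_distrib]
        exact add_le_add (hε ω φ ψ) (sum_abs_haarAvg_update_sub_le hf hf01 hε ω ψ)
    _ = 2 ^ l * (2 * ε) := by ring

lemma sum_deviation_mul_tableBias_update_le (ω : GenTable n) (ψ : PureState (n l)) :
    ∑ k : BitString l, deviation f (Function.update ω ⟨l, k⟩ ψ, ψ) *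
        tableBias f (Function.update ω ⟨l, k⟩ ψ) ≤
      2 ^ l * (deviation f (ω, ψ) * tableBias f ω) + (2 ^ l * (4 * ε) + 1) := by
  have hterm : ∀ k : BitString l, deviation f (Function.update ω ⟨l, k⟩ ψ, ψ) *
        tableBias f (Function.update ω ⟨l, k⟩ ψ) ≤ deviation f (ω, ψ) * tableBias f ω +
      (|deviation f (Function.update ω ⟨l, k⟩ ψ, ψ) - deviation f (ω, ψ)| +
        |tableBias f (Function.update ω ⟨l, k⟩ ψ) - tableBias f ω|) := by
    intro k
    set ω' := Function.update ω ⟨l, k⟩ ψ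
    have hdev : (deviation f (ω', ψ) - deviation f (ω, ψ)) * tableBias f ω' ≤
        |deviation f (ω', ψ) - deviation f (ω, ψ)| :=
      (le_abs_self _).trans <| (abs_mul _ _).trans_le <|
        mul_le_of_le_one_right (abs_nonneg _) (abs_tableBias_le hf hf01 ω')
    have hbias : deviation f (ω, ψ) * (tableBias f ω' - tableBias f ω) ≤
        |tableBias f ω' - tableBias f ω| :=
      (le_abs_self _).trans <| (abs_mul _ _).trans_le <|
        mul_le_of_le_one_left (abs_nonneg _) (abs_deviation_le hf hf01 (ω, ψ))
    linarith
  refine (Finset.sum_le_sum fun k _ => hterm k).trans ?_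
  have hdev := sum_abs_deviation_update_sub_le hf hf01 hε ω ψ ψ
  have hbias := sum_abs_tableBias_update_sub_le hf hf01 hε ω ψ
  have hconst : ∑ _k : BitString l, deviation f (ω, ψ) * tableBias f ω =
      2 ^ l * (deviation f (ω, ψ) * tableBias f ω) := by simp
  rw [Finset.sum_add_distrib, Finset.sum_add_distrib, hconst]
  linarith

end Resampling

omit hf hf01 in
lemma sum_deviation_mul_tableBias (ω : GenTable n) :
    ∑ k : BitString l, deviation f (ω, ω ⟨l, k⟩) * tableBias f ω =
      2 ^ l * tableBias f ω ^ 2 := by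
  have hsum : ∑ k : BitString l, deviation f (ω, ω ⟨l, k⟩) = 2 ^ l * tableBias f ω := by
    rw [tableBias, tableAvg, mul_sub, mul_div_cancel₀ _ (by positivity)]
    simp [deviation]
  rw [← Finset.sum_mul, hsum]
  ring

omit hf hf01 in
lemma integral_comp_update {g : GenTable n × PureState (n l) → ℝ} (hg : Measurable g)
    (k : BitString l) :
    ∫ p, g (Function.update p.1 ⟨l, k⟩ p.2, p.2) ∂(randomTable n).prod (haarState (n l)) =
      ∫ ω, g (ω, ω ⟨l, k⟩) ∂(randomTable n) := by
  have hmp : MeasurePreserving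
      (fun p : GenTable n × PureState (n l) => Function.update p.1 (⟨l, k⟩ : AnyKey) p.2)
      ((randomTable n).prod (haarState (n l))) (randomTable n) :=
    measurePreserving_update (fun x : AnyKey => haarState (n x.1)) ⟨l, k⟩
  have hmeas : Measurable fun ω : GenTable n => g (ω, ω ⟨l, k⟩) :=
    hg.comp (measurable_id.prodMk (measurable_pi_apply _))
  have hmap := integral_map hmp.aemeasurable hmeas.aestronglyMeasurable
  rw [hmp.map_eq] at hmap
  simp only [hmap, Function.update_self]

lemma integrable_deviation_mul_tableBias {α : Type*} [MeasurableSpace α] {μ : Measure α}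
    [IsFiniteMeasure μ] {g : α → GenTable n × PureState (n l)} (hg : Measurable g) :
    Integrable (fun a => deviation f (g a) * tableBias f (g a).1) μ := by
  have hmeas : Measurable fun a => deviation f (g a) * tableBias f (g a).1 :=
    ((measurable_deviation hf).comp hg).mul ((measurable_tableBias hf).comp hg.fst)
  refine Integrable.of_bound hmeas.aestronglyMeasurable 1 (ae_of_all _ fun a => ?_)
  rw [Real.norm_eq_abs, abs_mul]
  exact mul_le_one₀ (abs_deviation_le hf hf01 _) (abs_nonneg _) (abs_tableBias_le hf hf01 _)

/-- Resampling the state of the key `k` turns the expectation of `tableBias ^ 2`, in which the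
evaluation point `ω ⟨l, k⟩` is correlated with `ω`, into one where `deviation` is evaluated at an
independent point and averages to zero. -/
lemma integral_tableBias_sq_le {ε : ℝ} (hε : Insensitive f ε) :
    ∫ ω, tableBias f ω ^ 2 ∂(randomTable n) ≤ (2 ^ l : ℝ)⁻¹ + 4 * ε := by
  set μν := (randomTable n).prod (haarState (n l))
  set r : GenTable n × PureState (n l) → ℝ := fun p => deviation f p * tableBias f p.1
  have hr_meas : Measurable r :=
    (measurable_deviation hf).mul ((measurable_tableBias hf).comp measurable_fst)
  have hr_int : Integrable r μν := integrable_deviation_mul_tableBias hf hf01 measurable_id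
  have hr_zero : ∫ p, r p ∂μν = 0 := by
    rw [integral_prod _ hr_int]
    simp only [r, integral_mul_const, integral_deviation hf hf01, zero_mul, integral_zero]
  have htable_int : ∀ k : BitString l,
      Integrable (fun ω => r (ω, ω ⟨l, k⟩)) (randomTable n) := fun k =>
    integrable_deviation_mul_tableBias hf hf01 (measurable_id.prodMk (measurable_pi_apply _))
  have hupdate_int : ∀ k : BitString l,
      Integrable (fun p => r (Function.update p.1 ⟨l, k⟩ p.2, p.2)) μν := fun k =>
    integrable_deviation_mul_tableBias hf hf01
      ((measurable_update' (a := (⟨l, k⟩ : AnyKey))).prodMk measurable_snd)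
  have hmain : 2 ^ l * ∫ ω, tableBias f ω ^ 2 ∂(randomTable n) ≤ 2 ^ l * (4 * ε) + 1 :=
    calc 2 ^ l * ∫ ω, tableBias f ω ^ 2 ∂(randomTable n)
        = ∑ k : BitString l, ∫ p, r (Function.update p.1 ⟨l, k⟩ p.2, p.2) ∂μν := by
          simp only [μν, integral_comp_update hr_meas]
          rw [← integral_const_mul, ← integral_finsetSum _ fun k _ => htable_int k]
          simp only [r, sum_deviation_mul_tableBias]
      _ = ∫ p, ∑ k : BitString l, r (Function.update p.1 ⟨l, k⟩ p.2, p.2) ∂μν :=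
          (integral_finsetSum _ fun k _ => hupdate_int k).symm
      _ ≤ ∫ p, (2 ^ l * r p + (2 ^ l * (4 * ε) + 1)) ∂μν :=
          integral_mono (integrable_finsetSum _ fun k _ => hupdate_int k)
            ((hr_int.const_mul _).add (integrable_const _))
            fun p => sum_deviation_mul_tableBias_update_le hf hf01 hε p.1 p.2
      _ = 2 ^ l * (4 * ε) + 1 := by
          rw [integral_add (hr_int.const_mul _) (integrable_const _), integral_const_mul, hr_zero]
          simp
  rw [← mul_le_mul_iff_right₀ (by positivity : (0 : ℝ) < 2 ^ l), mul_add,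
    mul_inv_cancel₀ (by positivity), add_comm]
  exact hmain

end Bounded
end SecondMoment

section Advantage

variable {n : ℕ → ℕ} {C : Construction n} (S : Distinguisher C fun _ => 0)

/-- The acceptance probability relative to the eavesdropper `C.eve`, as a function of the table and
of the input state. -/
def Distinguisher.accept (l : ℕ) (p : GenTable n × PureState (n l)) : ℝ :=
  S.acceptProb p.1.gen (C.eve p.1) l p.2

lemma Distinguisher.measurable_accept (l : ℕ) : Measurable (S.accept l) :=
  S.measurable_acceptProb l

lemma Distinguisher.accept_mem (l : ℕ) (p : GenTable n × PureState (n l)) :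
    S.accept l p ∈ Set.Icc (0 : ℝ) 1 :=
  S.acceptProb_mem _ _ l p.2

lemma Distinguisher.advantage_eve (l : ℕ) (ω : GenTable n) :
    S.advantage ω.gen (C.eve ω) l = |tableBias (S.accept l) ω| := rfl

lemma Distinguisher.measurable_advantage_eve (l : ℕ) :
    Measurable fun ω : GenTable n => S.advantage ω.gen (C.eve ω) l :=
  (measurable_tableBias (S.measurable_accept l)).abs

lemma Distinguisher.abs_advantage_eve_le_one (l : ℕ) (ω : GenTable n) :
    |S.advantage ω.gen (C.eve ω) l| ≤ 1 := by
  rw [advantage_eve, abs_abs]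
  exact abs_tableBias_le (S.measurable_accept l) (S.accept_mem l) ω

lemma Distinguisher.insensitive_accept {l : ℕ}
    (hlong : ∀ l' ≤ S.eveLen l, C.longDim l' ≤ 2 ^ n l) :
    Insensitive (S.accept l) (4 * S.queries l / √(2 ^ l)) := by
  intro ω φ ψ
  have heve : ∀ k : BitString l, S.accept l (Function.update ω ⟨l, k⟩ ψ, φ) =
      S.acceptProb (GenTable.gen (Function.update ω ⟨l, k⟩ ψ)) (C.eve ω) l φ := fun k =>
    S.acceptProb_congr _ (fun l' hl' => C.eve_update (x := ⟨l, k⟩) (hlong l' hl') ω ψ) φ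
  calc ∑ k : BitString l, |S.accept l (Function.update ω ⟨l, k⟩ ψ, φ) - S.accept l (ω, φ)|
      = ∑ k : BitString l, |S.acceptProb ω.gen (C.eve ω) l φ -
          S.acceptProb (GenTable.gen (Function.update ω ⟨l, k⟩ ψ)) (C.eve ω) l φ| :=
        Finset.sum_congr rfl fun k _ => by rw [heve k, abs_sub_comm, accept]
    _ ≤ 4 * (S.queries l * √(2 ^ l)) :=
        S.sum_abs_acceptProb_update_sub_le ω (C.eve ω) l φ fun _ => ψ
    _ = 2 ^ l * (4 * S.queries l / √(2 ^ l)) := by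
        rw [mul_div_left_comm, Real.div_sqrt]
        ring

lemma Distinguisher.integral_advantage_eve_sq_le {l : ℕ}
    (hlong : ∀ l' ≤ S.eveLen l, C.longDim l' ≤ 2 ^ n l) :
    ∫ ω : GenTable n, S.advantage ω.gen (C.eve ω) l ^ 2 ∂(randomTable n) ≤
      (2 ^ l : ℝ)⁻¹ + 16 * S.queries l / √(2 ^ l) := by
  simp only [advantage_eve, sq_abs]
  refine (integral_tableBias_sq_le (S.measurable_accept l) (S.accept_mem l)
    (S.insensitive_accept hlong)).trans_eq ?_
  ring

end Advantage

section Asymptotics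

lemma monotone_polynomial_eval (p : Polynomial ℕ) : Monotone fun a : ℕ => p.eval a := by
  intro a b hab
  simp only [Polynomial.eval_eq_sum_range]
  gcongr

lemma eventually_polynomial_eval_le_pow (p : Polynomial ℕ) :
    ∃ d : ℕ, ∀ᶠ l : ℕ in atTop, p.eval l ≤ l ^ d := by
  refine ⟨p.natDegree + 1, ?_⟩
  filter_upwards [eventually_ge_atTop 1, eventually_ge_atTop (p.eval 1)] with l hl_one hl_eval
  calc p.eval l ≤ p.eval 1 * l ^ p.natDegree := by
        rw [Polynomial.eval_eq_sum_range, Polynomial.eval_eq_sum_range, Finset.sum_mul]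
        refine Finset.sum_le_sum fun i hi => ?_
        rw [one_pow, mul_one]
        gcongr
        exact Nat.lt_succ_iff.1 (Finset.mem_range.1 hi)
    _ ≤ l * l ^ p.natDegree := by gcongr
    _ = l ^ (p.natDegree + 1) := (pow_succ' _ _).symm

lemma SuperLog.eventually_pow_le {n : ℕ → ℕ} (hn : SuperLog n) (d : ℕ) :
    ∀ᶠ l : ℕ in atTop, (l : ℝ) ^ d ≤ 2 ^ n l := by
  have hc : (0 : ℝ) < Real.log 2 / (d + 1) := div_pos (Real.log_pos (by norm_num)) (by positivity)
  filter_upwards [hn.def hc, eventually_ge_atTop 1] with l hlog hl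
  have hl_one : (1 : ℝ) ≤ l := by exact_mod_cast hl
  have hlog_nonneg := Real.log_nonneg hl_one
  rw [Real.norm_of_nonneg hlog_nonneg, Real.norm_of_nonneg (by positivity)] at hlog
  have hexp : d * Real.log l ≤ n l * Real.log 2 :=
    calc d * Real.log l ≤ (d + 1) * Real.log l := by gcongr; simp
      _ ≤ (d + 1) * (Real.log 2 / (d + 1) * n l) := by gcongr
      _ = n l * Real.log 2 := by field_simp
  rw [← Real.log_pow, ← Real.log_pow] at hexp
  exact (Real.log_le_log_iff (by positivity) (by positivity)).1 hexp

lemma SuperLog.eventually_polynomial_eval_le {n : ℕ → ℕ} (hn : SuperLog n) (p : Polynomial ℕ) :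
    ∀ᶠ l : ℕ in atTop, ((p.eval l : ℕ) : ℝ) ≤ 2 ^ n l := by
  obtain ⟨d, hd⟩ := eventually_polynomial_eval_le_pow p
  filter_upwards [hd, hn.eventually_pow_le d] with l hpoly hpow
  exact le_trans (by exact_mod_cast hpoly) hpow

lemma eventually_longDim_le {n : ℕ → ℕ} (hn : SuperLog n) {C : Construction n}
    (hC : PolyBounded C.rounds) {e : ℕ → ℕ} (he : PolyBounded e) :
    ∀ᶠ l : ℕ in atTop, ∀ l' ≤ e l, C.longDim l' ≤ 2 ^ n l := by
  obtain ⟨p, hp⟩ := hC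
  obtain ⟨q, hq⟩ := he
  filter_upwards [hn.eventually_polynomial_eval_le (8 * (p.comp q + 1) ^ 2)] with l hl l' hl'
  refine le_trans ?_ hl
  have hrounds : C.rounds l' ≤ p.eval (q.eval l) :=
    (hp l').trans (monotone_polynomial_eval p (hl'.trans (hq l)))
  simp only [Polynomial.eval_mul, Polynomial.eval_pow, Polynomial.eval_add, Polynomial.eval_comp,
    Polynomial.eval_one, Polynomial.eval_ofNat]
  rw [Construction.longDim]
  push_cast
  gcongr

lemma summable_pow_mul_polyBounded_div_sqrt {q : ℕ → ℕ} (hq : PolyBounded q) (d : ℕ) :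
    Summable fun l : ℕ => (l : ℝ) ^ d * (q l / √(2 ^ l)) := by
  obtain ⟨p, hp⟩ := hq
  obtain ⟨e, he⟩ := eventually_polynomial_eval_le_pow p
  have hratio : ‖(√2)⁻¹‖ < 1 := by
    rw [norm_inv, Real.norm_of_nonneg (Real.sqrt_nonneg _)]
    exact inv_lt_one_of_one_lt₀ (Real.lt_sqrt_of_sq_lt (by norm_num))
  refine Summable.of_norm_bounded_eventually_nat
    (summable_pow_mul_geometric_of_norm_lt_one (d + e) hratio) ?_
  filter_upwards [he] with l hl
  have hql : (q l : ℝ) ≤ (l : ℝ) ^ e := by exact_mod_cast (hp l).trans hl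
  have hsqrt : √((2 : ℝ) ^ l) = √2 ^ l := by
    rw [Real.sqrt_eq_iff_mul_self_eq (by positivity) (by positivity), ← mul_pow]
    norm_num
  rw [Real.norm_of_nonneg (by positivity), hsqrt, pow_add, inv_pow, ← div_eq_mul_inv,
    mul_div_assoc]
  gcongr

lemma summable_pow_mul_advantage_bound {q : ℕ → ℕ} (hq : PolyBounded q) (d : ℕ) :
    Summable fun l : ℕ => (l : ℝ) ^ d * ((2 ^ l : ℝ)⁻¹ + 16 * q l / √(2 ^ l)) := by
  have hgeom := summable_pow_mul_geometric_of_norm_lt_one d (r := (2 : ℝ)⁻¹) (by norm_num)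
  refine (hgeom.add ((summable_pow_mul_polyBounded_div_sqrt hq d).mul_left 16)).congr fun l => ?_
  rw [inv_pow]
  ring

end Asymptotics

section AlmostSure

variable {Ω : Type*} [MeasurableSpace Ω] {μ : Measure Ω}

lemma ae_tendsto_zero_of_summable {X : ℕ → Ω → ℝ} (hX : ∀ l, Integrable (X l) μ)
    (hX_nonneg : ∀ l ω, 0 ≤ X l ω) {b : ℕ → ℝ} (hb : Summable b)
    (hXb : ∀ᶠ l in atTop, ∫ ω, X l ω ∂μ ≤ b l) :
    ∀ᵐ ω ∂μ, Tendsto (fun l => X l ω) atTop (nhds 0) := by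
  obtain ⟨m, hm⟩ := eventually_atTop.1 hXb
  have hmeas : ∀ l, AEMeasurable (fun ω => ENNReal.ofReal (X l ω)) μ := fun l =>
    (hX l).aemeasurable.ennreal_ofReal
  have hsum : ∫⁻ ω, ∑' l, ENNReal.ofReal (X (l + m) ω) ∂μ ≠ ⊤ := by
    rw [lintegral_tsum fun l => hmeas _]
    refine ne_top_of_le_ne_top ((summable_nat_add_iff m).2 hb).tsum_ofReal_ne_top
      (ENNReal.tsum_le_tsum fun l => ?_)
    rw [← ofReal_integral_eq_lintegral_ofReal (hX _) (ae_of_all _ (hX_nonneg _))]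
    exact ENNReal.ofReal_le_ofReal (hm _ (Nat.le_add_left _ _))
  filter_upwards [ae_lt_top' (AEMeasurable.tsum fun l => hmeas (l + m)) hsum] with ω hω
  have hlim := (ENNReal.tendsto_toReal ENNReal.zero_ne_top).comp
    (ENNReal.tendsto_atTop_zero_of_tsum_ne_top hω.ne)
  rw [← tendsto_add_atTop_iff_nat m]
  simpa only [Function.comp_def, ENNReal.toReal_ofReal (hX_nonneg _ _), ENNReal.toReal_zero]
    using hlim

lemma le_of_le_lintegral_of_ae_le_add [IsProbabilityMeasure μ] {Z : ℕ → Ω → ℝ}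
    (hZ : ∀ l, Measurable (Z l)) {b : ℝ} (hZb : ∀ l ω, Z l ω ≤ b) {a c : ℝ} (hc : 0 ≤ c)
    (ha : ∀ l, ENNReal.ofReal a ≤ ∫⁻ ω, ENNReal.ofReal (Z l ω) ∂μ)
    (hZc : ∀ᵐ ω ∂μ, ∃ δ : ℕ → ℝ, Tendsto δ atTop (nhds 0) ∧ ∀ l, Z l ω ≤ c + δ l) :
    a ≤ c := by
  have hlimsup : ∀ᵐ ω ∂μ, limsup (fun l => ENNReal.ofReal (Z l ω)) atTop ≤ ENNReal.ofReal c := by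
    filter_upwards [hZc] with ω ⟨δ, hδ, hle⟩
    have hlim : Tendsto (fun l => ENNReal.ofReal (c + δ l)) atTop (nhds (ENNReal.ofReal c)) :=
      ENNReal.tendsto_ofReal (by simpa using hδ.const_add c)
    exact (limsup_le_limsup (Eventually.of_forall fun l =>
      ENNReal.ofReal_le_ofReal (hle l))).trans_eq hlim.limsup_eq
  refine (ENNReal.ofReal_le_ofReal_iff hc).1 ?_
  calc ENNReal.ofReal a = limsup (fun _ : ℕ => ENNReal.ofReal a) atTop := (limsup_const _).symm
    _ ≤ limsup (fun l => ∫⁻ ω, ENNReal.ofReal (Z l ω) ∂μ) atTop :=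
        limsup_le_limsup (Eventually.of_forall ha)
    _ ≤ ∫⁻ ω, limsup (fun l => ENNReal.ofReal (Z l ω)) atTop ∂μ :=
        limsup_lintegral_le (fun _ => ENNReal.ofReal b) (fun l => (hZ l).ennreal_ofReal)
          (fun l => ae_of_all _ fun ω => ENNReal.ofReal_le_ofReal (hZb l ω)) (by simp)
    _ ≤ ∫⁻ _, ENNReal.ofReal c ∂μ := lintegral_mono_ae hlimsup
    _ = ENNReal.ofReal c := by simp

end AlmostSure

section Reduction

variable {n : ℕ → ℕ} {C : Construction n}

lemma Negligible.tendsto {δ : ℕ → ℝ} (hδ : Negligible δ) : Tendsto δ atTop (nhds 0) := by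
  simpa using hδ 0

lemma ae_negligible_advantage (hn : SuperLog n) (hC : PolyBounded C.rounds)
    {S : Distinguisher C fun _ => 0} (hq : PolyBounded S.queries) (he : PolyBounded S.eveLen) :
    ∀ᵐ ω : GenTable n ∂(randomTable n), Negligible (S.advantage ω.gen (C.eve ω)) := by
  have hsq : ∀ d : ℕ, ∀ᵐ ω : GenTable n ∂(randomTable n), Tendsto
      (fun l : ℕ => (l : ℝ) ^ (d * 2) * S.advantage ω.gen (C.eve ω) l ^ 2) atTop (nhds 0) := by
    intro d
    refine ae_tendsto_zero_of_summable (fun l => Integrable.const_mul ?_ _)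
      (fun l ω => by positivity) (summable_pow_mul_advantage_bound hq (d * 2)) ?_
    · refine Integrable.of_bound
        ((S.measurable_advantage_eve l).pow_const 2).aestronglyMeasurable 1
        (ae_of_all _ fun ω => ?_)
      rw [norm_pow]
      exact pow_le_one₀ (norm_nonneg _) (S.abs_advantage_eve_le_one l ω)
    · filter_upwards [eventually_longDim_le hn hC he] with l hlong
      rw [integral_const_mul]
      exact mul_le_mul_of_nonneg_left (S.integral_advantage_eve_sq_le hlong) (by positivity)
  filter_upwards [ae_all_iff.2 hsq] with ω hω d
  have hsqrt := (hω d).sqrt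
  rw [Real.sqrt_zero] at hsqrt
  refine hsqrt.congr fun l => ?_
  rw [pow_mul, ← mul_pow, Real.sqrt_sq]
  exact mul_nonneg (by positivity) (abs_nonneg _)

lemma Construction.winAddDisagree_le_of_isComplete_of_not_isBrokenBy {ω : GenTable n}
    (hcomplete : C.IsComplete ω.gen) (hunbroken : ¬ C.IsBrokenBy ω.gen (C.eve ω)) :
    ∃ δ : ℕ → ℝ, Tendsto δ atTop (nhds 0) ∧ ∀ l, C.winAddDisagree ω l ≤ 1 / 2 + δ l := by
  obtain ⟨ε, hε, hagree⟩ := hcomplete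
  obtain ⟨δ, hδ, hwin⟩ := not_not.1 hunbroken
  refine ⟨fun l => δ l + ε l, by simpa using hδ.tendsto.add hε.tendsto, fun l => ?_⟩
  rw [winAddDisagree]
  linarith [hwin l, hagree l]

end Reduction

end QCCC

end

theorem mainTheorem4_general {n : ℕ → ℕ} (hn : QCCC.SuperLog n) (C : QCCC.Construction n)
    (hC : QCCC.PolyBounded C.rounds) (S : QCCC.Distinguisher C fun _ => 0)
    (hq : QCCC.PolyBounded S.queries) (he : QCCC.PolyBounded S.eveLen) :
    ∃ I : QCCC.Generator n, ¬ C.IsComplete I ∨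
      ∃ E : C.Eavesdropper fun _ => 0, C.IsBrokenBy I E ∧ ¬ S.Breaks I E := by
  by_contra! hreduction
  have hbound : (7 / 8 : ℝ) ≤ 1 / 2 := by
    refine QCCC.le_of_le_lintegral_of_ae_le_add C.measurable_winAddDisagree
      (fun l ω => C.winAddDisagree_le_two ω l) (by norm_num) C.lintegral_winAddDisagree_ge ?_
    filter_upwards [QCCC.ae_negligible_advantage hn hC hq he] with ω hsecure
    obtain ⟨hcomplete, hbreaks⟩ := hreduction (QCCC.GenTable.gen ω)
    exact C.winAddDisagree_le_of_isComplete_of_not_isBrokenBy hcomplete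
      fun hbroken => hbreaks (C.eve ω) hbroken hsecure
  norm_num at hbound

theorem mainTheorem4 (n : ℕ → ℕ) (hn : QCCC.SuperLog n) :
    ¬ ∃ (C : QCCC.Construction n) (S : ∀ w : ℕ → ℕ, QCCC.Distinguisher C w),
      QCCC.IsFullyBlackBoxReduction C S := by
  rintro ⟨C, S, h⟩
  obtain ⟨hC, -⟩ := h.efficient_construction
  obtain ⟨-, hq, -, he⟩ := h.efficient_reduction fun _ => 0
  obtain ⟨I, hI | ⟨E, hbroken, hsecure⟩⟩ := mainTheorem4_general hn C hC (S fun _ => 0) hq he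
  · exact hI (h.correctness I)
  · exact hsecure (h.security I _ E hbroken)
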